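/- **Setting.** Let $Q$ be a smooth $D$-dimensional manifold (Hausdorff, second countable), $\mathbb P_L=TQ$ with projection $\tau:TQ\to Q$ and points $u=(q,v)$, and let $L:TQ\to\mathbb R$ be smooth. Let $E=v^a\,\partial L/\partial v^a-L$, $\theta_L=(\partial L/\partial v^a)\,dq^a$, $\Omega_L=-d\theta_L$, $M_{ab}=\partial^2L/\partial v^a\partial v^b$, $F_{ab}=\partial^2L/\partial v^a\partial q^b-\partial^2L/\partial v^b\partial q^a$. A vector $A\in T_uTQ$ is *vertical* if $T\tau A=0$. For a vector field $X$ put $\beta[X]=dE-i_X\Omega_L$. *First-order constraint functions* are the functions $\gamma=\langle\beta[\Gamma]\,|\,C\rangle$, where $\Gamma$ is a second-order smooth vector field ($T\tau\,\Gamma(q,v)=v$) and $C$ is a smooth vector field with $T\tau C\in\ker M$; in coordinates, with $z=T\tau C$, $\gamma=z^a(\partial E/\partial q^a+F_{ab}v^b)$. Let $\mathbb P_L^{[1]}$ be the set of $u\in TQ$ where $z^a(\partial E/\partial q^a+F_{ab}v^b)=0$ for all $z\in\ker M(u)$. Assume that there is an integer $N_0<D$ such that for all $u\in TQ$ one has $\dim\ker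 M(u)=N_0$ and $\dim\ker\Omega_L(u)=2N_0$, and that near each of its points $\mathbb P^{[1]}_L$ is the common zero set of finitely many first-order constraint functions with linearly independent differentials at that point. Let $\mathcal G$ be the set of smooth vertical vector fields in $\ker\Omega_L$, and let $\overline{\ker\Omega_L}$ be the set of smooth vector fields $P$ in $\ker\Omega_L$ such that $[G,P]$ is vertical for all $G\in\mathcal G$. Fix a pair $(W,\beta_0)$ of one of the following two kinds: * (on the constraint surface) $W=\mathbb P_L^{[1]}$ and $\beta_0=0$; * (constraint one-form fixed on all of phase space) $W=\mathbb P_L$ and $\beta_0$ is a one-form on $\mathbb P_L$ that vanishes on $\mathbb P_L^{[1]}$ and satisfies $\mathfrak L_G\beta_0=0$ for all $G\in\mathcal G$. For $V\subseteq TQ$ open let $\mathcal S\mathrm{ol}(V)$ be the set of smooth vector fields $X$ on $V$ with $\beta[X]=\beta_0$ on $V\cap W$ (for $W=\mathbb P_L^{[1]}$: $i_X\Omega_L=dE$ on $\mathbb P_L^{[1]}\cap V$), and let $\overline{\mathcal S\mathrm{ol}}(V)$, the second-order Euler–Lagrange vector fields on $V$, be the set of those $X\in\mathcal S\mathrm{ol}(V)$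 for which $[G,X]$ is vertical on $V\cap W$ for all $G\in\mathcal G$. Write $\mathcal S\mathrm{ol}=\mathcal S\mathrm{ol}(TQ)$, $\overline{\mathcal S\mathrm{ol}}=\overline{\mathcal S\mathrm{ol}}(TQ)$. Let $\mathcal S\mathrm{ym}\subseteq\overline{\ker\Omega_L}/\mathcal G$ consist of the classes of those $P\in\overline{\ker\Omega_L}$ such that, for every $X\in\mathcal S\mathrm{ol}$, $\mathfrak L_P\beta[X]=d(i_P\beta[X])$ on $W$; below, $P$ may be any such representative. Let $\mathrm{Gr}_{\mathcal S\mathrm{ym}}$ be the group of bijections of $TQ$ generated by the maps $\sigma_P(\varepsilon,\cdot)$, $\varepsilon\in\mathbb R$, where $P$ is a representative of an element of $\mathcal S\mathrm{ym}$ that has a global smooth flow $\sigma_P$. For an open interval $T$, $t_0\in T$ and $u_0\in TQ$, let $\mathcal O_{EL}(u_0)$ be the set of curves $u$ in $TQ$ with $u(t_0)=u_0$ for which there is $\overline X\in\overline{\mathcal S\mathrm{ol}}$ with $du/dt=\overline X(u)$ on $T$. **Theorem.** $\mathrm{Gr}_{\mathcal S\mathrm{ym}}$ is a group of symmetry transformations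 of the families $\mathcal O_{EL}(u_0)$. That is: 1. Every $\sigma\in\mathrm{Gr}_{\mathcal S\mathrm{ym}}$ is smooth, $\sigma_*X\in\overline{\mathcal S\mathrm{ol}}$ for every $X\in\overline{\mathcal S\mathrm{ol}}$, and $u\mapsto\sigma\circ u$ is a bijection of $\mathcal O_{EL}(u_0)$ onto $\mathcal O_{EL}(\sigma(u_0))$, for all $T$, $t_0\in T$ and $u_0$ (in particular of $\mathcal O_{EL}(u_0)$ onto itself if $\sigma(u_0)=u_0$). 2. Let $P$ be any representative of an element of $\mathcal S\mathrm{ym}$, complete or not, with a smooth local flow $\sigma_P$ on $(a,b)\times U$, where $a<0<b$ and $U\subseteq TQ$ is open. Then each $\sigma_P(\varepsilon,\cdot)$, $\varepsilon\in(a,b)$, is injective on $U$ with open image $U_\varepsilon$. Let moreover $u$ be a curve with $u(t_0)=u_0$ and $u(t)\in U$ on an open interval $T\ni t_0$, which is an integral curve on $T$ of $X\in\overline{\mathcal S\mathrm{ol}}$, and let $\varepsilon:T\to(a,b)$ be differentiable. Then the curve $u_Y(t)=\sigma_P(\varepsilon(t),u(t))$ satisfies $du_Y/dt=Y_t(u_Y(t))$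 on $T$, where $$Y_t=\sigma_P(\varepsilon(t),\cdot)_*X+\varepsilon'(t)\,P\ \in\ \overline{\mathcal S\mathrm{ol}}(U_{\varepsilon(t)})\qquad(t\in T),$$ and $u_Y(t_0)=u_0$ if $\varepsilon(t_0)=0$. For constant $\varepsilon$, $Y=\sigma_P(\varepsilon,\cdot)_*X$. -/

import Mathlib

open Set Topology
open scoped Manifold ContDiff

noncomputable section

/-- The coordinate space `ℝ^D` on which the configuration manifold is modelled. -/
abbrev CoordSpace (D : ℕ) : Type := EuclideanSpace ℝ (Fin D)

/-- The Lagrangian (velocity) phase space `P_L = TQ`. A point `u` is the pair `(u.1, u.2) = (q, v)`. -/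
abbrev VelPhase (D : ℕ) (Q : Type*) [TopologicalSpace Q] [ChartedSpace (CoordSpace D) Q]
    [IsManifold (𝓡 D) ∞ Q] : Type _ := TangentBundle (𝓡 D) Q

/-- The model with corners of `TQ` (boundaryless, with model vector space `ℝ^D × ℝ^D`). -/
abbrev velModel (D : ℕ) := (𝓡 D).tangent

section Basic

variable {D : ℕ} {Q : Type*} [TopologicalSpace Q] [ChartedSpace (CoordSpace D) Q]
  [IsManifold (𝓡 D) ∞ Q]

variable (D Q) in
/-- (Not necessarily smooth) vector fields on `P_L = TQ`. -/
abbrev VelField : Type _ := (u : VelPhase D Q) → TangentSpace (velModel D) u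

variable (D Q) in
/-- (Not necessarily smooth) one-forms on `P_L = TQ`. -/
abbrev VelForm : Type _ := (u : VelPhase D Q) → (TangentSpace (velModel D) u →L[ℝ] ℝ)

/-- The vector field `X` is smooth on the set `V`. -/
def SmoothFieldOn (X : VelField D Q) (V : Set (VelPhase D Q)) : Prop :=
  ContMDiffOn (velModel D) (velModel D).tangent ∞
    (fun u => (⟨u, X u⟩ : TangentBundle (velModel D) (VelPhase D Q))) V

/-- The vector field `X` is smooth on all of `P_L`. -/
abbrev SmoothField (X : VelField D Q) : Prop := SmoothFieldOn X univ

/-- The differential `df` of a function on `P_L`, at the point `u`. -/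
def dFun (f : VelPhase D Q → ℝ) (u : VelPhase D Q) : TangentSpace (velModel D) u →L[ℝ] ℝ :=
  mfderiv (velModel D) 𝓘(ℝ, ℝ) f u

/-- `Tτ_Q : T_u(TQ) → T_qQ`, the derivative of the bundle projection `τ_Q : TQ → Q`. -/
def projT (u : VelPhase D Q) : TangentSpace (velModel D) u →L[ℝ] CoordSpace D :=
  mfderiv (velModel D) (𝓡 D) (fun w : VelPhase D Q => w.1) u

/-- A vector field that is vertical at `u`. -/
def VerticalAt (X : VelField D Q) (u : VelPhase D Q) : Prop := projT u (X u) = 0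

/-- The Lie bracket `[X, Y]` of vector fields on `P_L`. -/
def bracket (X Y : VelField D Q) : VelField D Q :=
  VectorField.mlieBracket (velModel D) X Y

/-- The exterior derivative of a one-form, `dα(A, B) = (D_A α)(B) - (D_B α)(A)`, computed at the
point `u` in the chart at `u` (in which Mathlib identifies `T_u(TQ)` with `ℝ^D × ℝ^D`). -/
def extDer (α : VelForm D Q) (u : VelPhase D Q) :
    TangentSpace (velModel D) u →L[ℝ] TangentSpace (velModel D) u →L[ℝ] ℝ :=
  let c := extChartAt (velModel D) u
  let αc : CoordSpace D × CoordSpace D → (CoordSpace D × CoordSpace D →L[ℝ] ℝ) := fun x =>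
    (α (c.symm x)).comp
      (mfderiv 𝓘(ℝ, CoordSpace D × CoordSpace D) (velModel D) c.symm x)
  let dαc : (CoordSpace D × CoordSpace D) →L[ℝ] (CoordSpace D × CoordSpace D →L[ℝ] ℝ) :=
    fderiv ℝ αc (c u)
  dαc - dαc.flip

/-- The Lie derivative of a one-form, `(𝔏_P α)(Y) = P(α(Y)) - α([P, Y])`. -/
def lieForm (P : VelField D Q) (α : VelForm D Q) (Y : VelField D Q) (u : VelPhase D Q) : ℝ :=
  dFun (fun w => α w (Y w)) u (P u) - α u (bracket P Y u)

/-- The fibre derivative of `L`: at `u = (q, v)` the covector `w ↦ ∂L/∂v (q, v) w`. -/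
def fibreDer (L : VelPhase D Q → ℝ) (u : VelPhase D Q) : CoordSpace D →L[ℝ] ℝ :=
  fderiv ℝ (fun w : CoordSpace D => L ⟨u.1, w⟩) u.2

/-- The fibre Hessian `M = ∂²L/∂v∂v` of `L` at `u`. -/
def fibreHess (L : VelPhase D Q → ℝ) (u : VelPhase D Q) :
    CoordSpace D →L[ℝ] CoordSpace D →L[ℝ] ℝ :=
  fderiv ℝ (fun w : CoordSpace D => fibreDer L ⟨u.1, w⟩) u.2

/-- The energy `E = v ∂L/∂v - L`. -/
def energy (L : VelPhase D Q → ℝ) (u : VelPhase D Q) : ℝ := fibreDer L u u.2 - L u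

/-- The one-form `θ_L = (∂L/∂v) dq`. -/
def thetaL (L : VelPhase D Q → ℝ) : VelForm D Q := fun u => (fibreDer L u).comp (projT u)

/-- The Lagrangian two-form `Ω_L = -dθ_L`. -/
def omegaL (L : VelPhase D Q → ℝ) (u : VelPhase D Q) :
    TangentSpace (velModel D) u →L[ℝ] TangentSpace (velModel D) u →L[ℝ] ℝ :=
  -extDer (thetaL L) u

/-- The kernel of the fibre Hessian at `u`. -/
def kerHess (L : VelPhase D Q → ℝ) (u : VelPhase D Q) : Submodule ℝ (CoordSpace D) :=
  LinearMap.ker (fibreHess L u).toLinearMap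

/-- `ker Ω_L(u)`. -/
def kerOmega (L : VelPhase D Q → ℝ) (u : VelPhase D Q) :
    Submodule ℝ (TangentSpace (velModel D) u) :=
  LinearMap.ker (omegaL L u).toLinearMap

/-- The constraint one-form `β[X] = dE - i_X Ω_L`. -/
def betaForm (L : VelPhase D Q → ℝ) (X : VelField D Q) : VelForm D Q :=
  fun u => dFun (energy L) u - omegaL L u (X u)

/-- First-order constraint functions `γ = ⟨β[Γ] | C⟩`, where `Γ` is a second-order vector field and
the horizontal part of `C` is in the kernel of the Hessian. In coordinates, if `C` has horizontal
part `z`, this is `γ = z^a (∂E/∂q^a + F_ab v^b)`. -/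
def IsConstraintFun (L : VelPhase D Q → ℝ) (γ : VelPhase D Q → ℝ) : Prop :=
  ∃ Γ C : VelField D Q, SmoothField Γ ∧ SmoothField C ∧
    (∀ u, projT u (Γ u) = u.2) ∧ (∀ u, projT u (C u) ∈ kerHess L u) ∧
    γ = fun u => betaForm L Γ u (C u)

/-- The first-order Lagrangian constraint submanifold `P_L^[1]`: the common zeros of
`z^a (∂E/∂q^a + F_ab v^b)`, for `z ∈ ker M(u)`. -/
def firstConstraintSet (L : VelPhase D Q → ℝ) : Set (VelPhase D Q) :=
  {u | ∀ Γ C : TangentSpace (velModel D) u, projT u Γ = u.2 → projT u C ∈ kerHess L u →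
    dFun (energy L) u C - omegaL L u Γ C = 0}

/-- The standing assumptions on the Lagrangian. -/
structure IsSingularLagrangian (L : VelPhase D Q → ℝ) (N₀ : ℕ) : Prop where
  smooth : ContMDiff (velModel D) 𝓘(ℝ, ℝ) ∞ L
  /-- The Hessian has constant rank `D - N₀`, which is not zero. -/
  lt_dim : N₀ < D
  finrank_kerHess : ∀ u, Module.finrank ℝ (kerHess L u) = N₀
  /-- `Ω_L` has constant rank, and its kernel has dimension `2 N₀`. -/
  finrank_kerOmega : ∀ u, Module.finrank ℝ (kerOmega L u) = 2 * N₀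
  /-- `P_L^[1]` is a submanifold, cut out by independent first-order constraint functions. -/
  regular : ∀ u ∈ firstConstraintSet L, ∃ (k : ℕ) (γ : Fin k → VelPhase D Q → ℝ),
    (∀ i, IsConstraintFun L (γ i)) ∧ LinearIndependent ℝ (fun i => dFun (γ i) u) ∧
    ∀ᶠ w in 𝓝 u, (∀ i, γ i w = 0) → w ∈ firstConstraintSet L

/-- The vertical vector fields `𝒢` in the kernel of `Ω_L`, i.e. `G = z^a ∂/∂v^a` with
`z ∈ ker M`. -/
def IsGField (L : VelPhase D Q → ℝ) (G : VelField D Q) : Prop :=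
  SmoothField G ∧ ∀ u, VerticalAt G u ∧ G u ∈ kerOmega L u

/-- The vector fields `P` in the kernel of `Ω_L` such that `[G, P]` is vertical for all `G ∈ 𝒢`. -/
def IsKerBarField (L : VelPhase D Q → ℝ) (P : VelField D Q) : Prop :=
  SmoothField P ∧ (∀ u, P u ∈ kerOmega L u) ∧
    ∀ G, IsGField L G → ∀ u, VerticalAt (bracket G P) u

/-- The set `W` on which the defining equations are imposed, with the value `β₀` that the constraint
one-form has there. Either `W` is `P_L^[1]`, where the constraint one-form vanishes; or `W` is all of
`P_L`, and `β₀` is a one-form on `P_L` that vanishes on `P_L^[1]` and has `𝔏_G β₀ = 0` for all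
`G ∈ 𝒢`. -/
def IsConstraintData (L : VelPhase D Q → ℝ) (W : Set (VelPhase D Q)) (β₀ : VelForm D Q) : Prop :=
  (W = firstConstraintSet L ∧ ∀ u, β₀ u = 0) ∨
  (W = univ ∧ (∀ u ∈ firstConstraintSet L, β₀ u = 0) ∧
    ∀ G Y, IsGField L G → SmoothField Y → ∀ u, lieForm G β₀ Y u = 0)

/-- General solutions of the energy equation, over an open set `V`: `β[X] = β₀` on `W`. For
`W = P_L^[1]` and `β₀ = 0` this is `i_X Ω_L = dE` on `P_L^[1]`. -/
def IsSol (L : VelPhase D Q → ℝ) (W : Set (VelPhase D Q)) (β₀ : VelForm D Q)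
    (V : Set (VelPhase D Q)) (X : VelField D Q) : Prop :=
  SmoothFieldOn X V ∧ ∀ u ∈ V ∩ W, betaForm L X u = β₀ u

/-- Second-order Euler-Lagrange vector fields over an open set `V`: the solutions `X` such that
`[G, X]` is vertical on `W` for all `G ∈ 𝒢`. -/
def IsSolBar (L : VelPhase D Q → ℝ) (W : Set (VelPhase D Q)) (β₀ : VelForm D Q)
    (V : Set (VelPhase D Q)) (X : VelField D Q) : Prop :=
  IsSol L W β₀ V X ∧ ∀ G, IsGField L G → ∀ u ∈ V ∩ W, VerticalAt (bracket G X) u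

/-- `P` represents a class in `Sym`: it lies in the space of `IsKerBarField`, and
`𝔏_P β[X] = d(i_P β[X])` on `W` for every solution `X` of the energy equation. All the
representatives, modulo `𝒢`, of the classes in `Sym` are admitted. -/
def IsSym (L : VelPhase D Q → ℝ) (W : Set (VelPhase D Q)) (β₀ : VelForm D Q)
    (P : VelField D Q) : Prop :=
  IsKerBarField L P ∧ ∀ X, IsSol L W β₀ univ X → ∀ Y, SmoothField Y → ∀ u ∈ W,
    lieForm P (betaForm L X) Y u = dFun (fun w => betaForm L X w (P w)) u (Y u)

/-- `φ` is the (global) flow of `P`. -/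
def IsFlow (P : VelField D Q) (φ : ℝ → VelPhase D Q → VelPhase D Q) : Prop :=
  ContMDiff (𝓘(ℝ, ℝ).prod (velModel D)) (velModel D) ∞
      (fun p : ℝ × VelPhase D Q => φ p.1 p.2) ∧
    ∀ u, φ 0 u = u ∧ IsMIntegralCurve (I := velModel D) (fun ε => φ ε u) P

/-- `φ` is a local flow of `P`, defined on `(a, b) × U`. -/
def IsLocalFlow (P : VelField D Q) (a b : ℝ) (U : Set (VelPhase D Q))
    (φ : ℝ → VelPhase D Q → VelPhase D Q) : Prop :=
  a < 0 ∧ 0 < b ∧ IsOpen U ∧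
    ContMDiffOn (𝓘(ℝ, ℝ).prod (velModel D)) (velModel D) ∞
      (fun p : ℝ × VelPhase D Q => φ p.1 p.2) (Ioo a b ×ˢ U) ∧
    ∀ u ∈ U, φ 0 u = u ∧
      IsMIntegralCurveOn (I := velModel D) (fun ε => φ ε u) P (Ioo a b)

/-- The group `Gr_Sym` of transformations of `P_L` generated by the one-parameter subgroups of the
vector fields in `Sym`. -/
def GrSym (L : VelPhase D Q → ℝ) (W : Set (VelPhase D Q)) (β₀ : VelForm D Q) :
    Subgroup (Equiv.Perm (VelPhase D Q)) :=
  Subgroup.closure {σ | ∃ P φ ε, IsSym L W β₀ P ∧ IsFlow P φ ∧ ∀ u, σ u = φ ε u}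

/-- `O_EL(u₀)`: the curves `t ↦ u(t)`, on the time interval `T`, that are integral curves of some
second-order Euler-Lagrange vector field and have `u(t₀) = u₀`. -/
def orbitEL (L : VelPhase D Q → ℝ) (W : Set (VelPhase D Q)) (β₀ : VelForm D Q)
    (T : Set ℝ) (t₀ : ℝ) (u₀ : VelPhase D Q) : Set (ℝ → VelPhase D Q) :=
  {c | c t₀ = u₀ ∧ ∃ X, IsSolBar L W β₀ univ X ∧ IsMIntegralCurveOn (I := velModel D) c X T}

/-- The image of the vector `A ∈ T_u(TQ)` under the derivative of `σ : TQ → TQ`. -/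
def push (σ : VelPhase D Q → VelPhase D Q) (u : VelPhase D Q)
    (A : TangentSpace (velModel D) u) : TangentSpace (velModel D) (σ u) :=
  mfderiv (velModel D) (velModel D) σ u A

end Basic

end

/-! Write `Ω` for `omegaL L`, `M` for the fibre Hessian, `β[X]` for `betaForm L X` and `S` for
`firstConstraintSet L`. A representative `P` of a symmetry lies in `ker Ω`, and `Ω` is closed, so
`𝔏_P Ω = 0`. Hence `𝔏_P β[X] = d(P E) - i_{[P,X]} Ω`, while `i_P β[X] = P E`. The symmetry condition
therefore says exactly that `[P, X] ∈ ker Ω` on `W` for every solution `X`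
(`IsSym.mlieBracket_mem_kerOmega`). Moreover brackets with `P` preserve the sections of `ker Ω`,
which is involutive, and those of its vertical part `verticalKer`, by the definition of
`IsKerBarField`.

These infinitesimal facts are integrated along the flow `φ` of `P` by
`IsSmoothLocalFlow.mem_distribution`. If brackets with `P` preserve a distribution of constant rank
and `[P, X]` lies in it along a flow line, then `Dφ_ε A - X`, read modulo the distribution, solves a
homogeneous linear differential equation. It thus vanishes everywhere on the flow line or nowhere.
With the zero distribution this makes `φ_ε` a local diffeomorphism; with `verticalKer` it shows that
`Dφ_ε` preserves `verticalKer`; with `ker Ω` it gives `(φ_ε)_* X - X ∈ ker Ω` on `W`, so that `β`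
has the same value there on `(φ_ε)_* X` and on `X`.

The last application needs flow lines that start in `W` to stay there. For `W = S` the reason is
that `X + f V` is again a solution whenever `f` vanishes on `S`. So `[P, f V] = (P f) V + f [P, V]`
lies in `ker Ω` on `S`, and a `V` outside `ker Ω` forces `P f = 0`: the field `P` is tangent to `S`.
Since `S` is locally a regular zero set, it is invariant under the flow
(`IsMIntegralCurveOn.mem_zeroSet_iff`).

It remains to see that `[G, (φ_ε)_* X]` is vertical for `G ∈ 𝒢`. It is the image under `Dφ_ε` of
`[G', X]`, where `G'` is the pullback of `G` and belongs to `𝒢` locally. The flow does not preserve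
all vertical vectors, only those in `ker Ω`, so `[G', X] ∈ ker Ω` on `W` is needed as well. As `G' E
= 0`, this amounts to `𝔏_{G'} β[X] = 0` on `W`. That is assumed of `β₀` when `W` is everything; for
`W = S` it holds because `𝒢` is tangent to `S`
(`IsSingularLagrangian.vfDeriv_constraintFun_eq_zero`).

Adding a multiple of `P` changes none of these properties, since `P ∈ ker Ω` and `[G, P]` is
vertical. A time-dependent parameter adds just such a term by the chain rule. The group statement
follows by composing flows and their inverses. -/

/-! ### Analysis in vector spaces: constant rank families, differential inequalities, linearized
flows. -/

noncomputable section VectorSpaceLemmas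

open Filter Module

variable {E E₁ F G : Type*} [NormedAddCommGroup E] [NormedSpace ℝ E]
  [NormedAddCommGroup E₁] [NormedSpace ℝ E₁] [NormedAddCommGroup F] [NormedSpace ℝ F]
  [NormedAddCommGroup G] [NormedSpace ℝ G]

/-- A smooth family of linear maps of locally constant rank has a smooth family of generalized
inverses. -/
theorem exists_contDiffAt_generalized_inverse [FiniteDimensional ℝ E₁] [FiniteDimensional ℝ F]
    {K : E → E₁ →L[ℝ] F} {x₀ : E} {n : WithTop ℕ∞} {r : ℕ}
    (hK : ∀ᶠ x in 𝓝 x₀, ContDiffAt ℝ n K x)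
    (hr : ∀ᶠ x in 𝓝 x₀, finrank ℝ (LinearMap.ker (K x).toLinearMap) = r) :
    ∃ J : E → F →L[ℝ] E₁, (∀ᶠ x in 𝓝 x₀, ContDiffAt ℝ n J x) ∧
      ∀ᶠ x in 𝓝 x₀, ∀ a, K x (J x (K x a)) = K x a := by
  -- On a complement `N` of the kernel at `x₀` the map `K x₀` has a left inverse `ρ`. The
  -- compression `ρ K ι` is the identity of `N` at `x₀`, hence invertible nearby, and `ι (ρ K ι)⁻¹
  -- ρ` will be the generalized inverse.
  obtain ⟨N, hN⟩ := Submodule.exists_isCompl (LinearMap.ker (K x₀).toLinearMap)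
  let ι : N →L[ℝ] E₁ := N.subtypeL
  have hinj : LinearMap.ker ((K x₀).toLinearMap ∘ₗ N.subtype) = ⊥ := by
    rw [LinearMap.ker_eq_bot']
    intro m hm
    have : (m : E₁) ∈ LinearMap.ker (K x₀).toLinearMap ⊓ N := ⟨hm, m.2⟩
    rw [hN.inf_eq_bot] at this
    simpa using this
  obtain ⟨ρ', hρ'⟩ := LinearMap.exists_leftInverse_of_injective _ hinj
  let ρ : F →L[ℝ] N := LinearMap.toContinuousLinearMap ρ'
  let T : E → N →L[ℝ] N := fun x => ρ ∘L K x ∘L ι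
  have hT₀ : T x₀ = ContinuousLinearMap.id ℝ N := by
    ext m
    have := LinearMap.congr_fun hρ' m
    exact congrArg Subtype.val this
  have hT : ∀ x, ContDiffAt ℝ n K x → ContDiffAt ℝ n T x := fun x hx =>
    contDiffAt_const.clm_comp (hx.clm_comp contDiffAt_const)
  have hKc : ContinuousAt K x₀ := hK.self_of_nhds.continuousAt
  have hTc : ContinuousAt T x₀ := by
    have : Continuous fun A : E₁ →L[ℝ] F => ρ ∘L A ∘L ι := by fun_prop
    exact this.continuousAt.comp hKc
  have hTinv : ∀ᶠ x in 𝓝 x₀, (T x).IsInvertible := by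
    have : range ((↑) : (N ≃L[ℝ] N) → N →L[ℝ] N) ∈ 𝓝 (T x₀) := by
      rw [hT₀]
      exact ContinuousLinearEquiv.nhds (ContinuousLinearEquiv.refl ℝ N)
    filter_upwards [hTc this] with x hx
    exact hx
  refine ⟨fun x => ι ∘L (T x).inverse ∘L ρ, ?_, ?_⟩
  · filter_upwards [hK, hTinv] with x hx hi
    exact contDiffAt_const.clm_comp
      ((hi.contDiffAt_map_inverse.comp x (hT x hx)).clm_comp contDiffAt_const)
  · filter_upwards [hTinv, hr] with x hi hrx a
    -- Constancy of the rank enters here: `ρ K x` is onto `N`, so its kernel has the dimension `r`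
    -- of the smaller space `ker (K x)`, and the two coincide.
    have hker : LinearMap.ker (K x).toLinearMap
        = LinearMap.ker (ρ'.comp (K x).toLinearMap) := by
      apply Submodule.eq_of_le_of_finrank_eq
      · intro z hz
        rw [LinearMap.mem_ker] at hz ⊢
        rw [LinearMap.comp_apply, hz, map_zero]
      · have hs : LinearMap.range (ρ'.comp (K x).toLinearMap) = ⊤ := by
          rw [LinearMap.range_eq_top]
          intro m
          obtain ⟨m', hm'⟩ := hi.surjective m
          exact ⟨m', hm'⟩
        have h1 := LinearMap.finrank_range_add_finrank_ker (ρ'.comp (K x).toLinearMap)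
        rw [hs, finrank_top] at h1
        have h2 := Submodule.finrank_add_eq_of_isCompl hN
        have h3 := hr.self_of_nhds
        omega
    have hmem : a - ι ((T x).inverse (ρ (K x a))) ∈ LinearMap.ker (K x).toLinearMap := by
      rw [hker, LinearMap.mem_ker]
      have := hi.self_apply_inverse (ρ (K x a))
      change ρ (K x (a - ι ((T x).inverse (ρ (K x a))))) = 0
      rw [map_sub, map_sub, sub_eq_zero]
      exact this.symm
    have h4 : K x (a - ι ((T x).inverse (ρ (K x a)))) = 0 := hmem
    rw [map_sub, sub_eq_zero] at h4
    exact h4.symm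

/-- A curve whose velocity is bounded by a multiple of its norm vanishes near each of its zeros. -/
theorem eventually_eq_zero_of_norm_deriv_le {y y' : ℝ → F} {t₀ C : ℝ}
    (hy : ∀ᶠ t in 𝓝 t₀, HasDerivAt y (y' t) t) (hC : ∀ᶠ t in 𝓝 t₀, ‖y' t‖ ≤ C * ‖y t‖)
    (h0 : y t₀ = 0) : ∀ᶠ t in 𝓝 t₀, y t = 0 := by
  -- An artificial vector field, Lipschitz in `z` with constant `C`, that has both `y` and the zero
  -- curve as solutions; uniqueness then identifies them. Where `y t = 0`, division by zero makes
  -- the field vanish, in agreement with `y' t = 0`.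
  let v : ℝ → F → F := fun t z => (‖z‖ / ‖y t‖) • y' t
  have hv : ∀ᶠ t in 𝓝 t₀, LipschitzOnWith (C.toNNReal) (v t) univ := by
    filter_upwards [hC] with t ht
    apply LipschitzOnWith.of_dist_le_mul
    intro z _ w _
    rw [dist_eq_norm]
    have : v t z - v t w = ((‖z‖ - ‖w‖) / ‖y t‖) • y' t := by
      simp only [v]
      rw [← sub_smul, sub_div]
    rw [this, norm_smul, norm_div, norm_norm, dist_eq_norm]
    by_cases h : ‖y t‖ = 0
    · rw [h]
      simp only [div_zero, zero_mul]
      positivity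
    · have hp : 0 < ‖y t‖ := lt_of_le_of_ne (norm_nonneg _) (Ne.symm h)
      rw [div_mul_eq_mul_div, div_le_iff₀ hp]
      have h1 : ‖‖z‖ - ‖w‖‖ ≤ ‖z - w‖ := abs_norm_sub_norm_le z w
      have h2 : ‖y' t‖ ≤ C.toNNReal * ‖y t‖ :=
        ht.trans (mul_le_mul_of_nonneg_right (Real.le_coe_toNNReal C) hp.le)
      calc ‖‖z‖ - ‖w‖‖ * ‖y' t‖ ≤ ‖z - w‖ * (C.toNNReal * ‖y t‖) :=
            mul_le_mul h1 h2 (norm_nonneg _) (norm_nonneg _)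
        _ = _ := by ring
  have hf : ∀ᶠ t in 𝓝 t₀, HasDerivAt y (v t (y t)) t ∧ y t ∈ (univ : Set F) := by
    filter_upwards [hy, hC] with t ht hCt
    refine ⟨?_, mem_univ _⟩
    by_cases h : ‖y t‖ = 0
    · have : y' t = 0 := by
        rw [h, mul_zero] at hCt
        exact norm_le_zero_iff.1 hCt
      simp only [v, this, smul_zero]
      rwa [this] at ht
    · simp only [v, div_self h, one_smul]
      exact ht
  have hg : ∀ᶠ t in 𝓝 t₀, HasDerivAt (fun _ : ℝ => (0 : F)) (v t 0) t ∧ (0 : F) ∈ (univ : Set F) := by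
    refine Eventually.of_forall fun t => ⟨?_, mem_univ _⟩
    simp only [v, norm_zero, zero_div, zero_smul]
    exact hasDerivAt_const t 0
  exact ODE_solution_unique_of_eventually hv hf hg h0

/-- A function that vanishes on the regular zero set of `f` is bounded by a multiple of `f`. -/
theorem eventually_norm_le_of_eq_zero [CompleteSpace E] [CompleteSpace F]
    {f : E → F} {g : E → G} {f' : E →L[ℝ] F} {g' : E →L[ℝ] G} {x₀ : E}
    (hf : HasStrictFDerivAt f f' x₀) (hf' : f'.range = ⊤) (hg : HasStrictFDerivAt g g' x₀)
    (h0 : f x₀ = 0) (hfg : ∀ᶠ x in 𝓝 x₀, f x = 0 → g x = 0) :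
    ∃ C : ℝ, ∀ᶠ x in 𝓝 x₀, ‖g x‖ ≤ C * ‖f x‖ := by
  let S := f'.nonlinearRightInverseOfSurjective hf'
  have hSp : 0 < S.nnnorm := f'.nonlinearRightInverseOfSurjective_nnnorm_pos hf'
  -- Approximating `f` by `f'` up to half of the inverse norm of `S` leaves the surplus `d =
  -- S.nnnorm⁻¹ / 2`. Balls of radius `ρ` are then mapped onto sets containing balls of radius `d
  -- ρ`.
  have hc : 0 < S.nnnorm⁻¹ / 2 := by positivity
  obtain ⟨s, hs, hsf⟩ := hf.approximates_deriv_on_nhds (Or.inr hc)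
  obtain ⟨Kg, s', hs', hsg⟩ := hg.exists_lipschitzOnWith
  obtain ⟨δ, hδ, hball⟩ := Metric.mem_nhds_iff.1 (inter_mem (inter_mem hs hs') hfg)
  let d : ℝ := (S.nnnorm : ℝ)⁻¹ / 2
  have hd : 0 < d := by positivity
  have hnear : ∀ᶠ x in 𝓝 x₀, d⁻¹ * ‖f x‖ < δ / 2 := by
    have : Tendsto (fun x => d⁻¹ * ‖f x‖) (𝓝 x₀) (𝓝 (d⁻¹ * ‖f x₀‖)) :=
      (hf.continuousAt.norm).const_mul _
    rw [h0, norm_zero, mul_zero] at this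
    exact this.eventually (gt_mem_nhds (by positivity))
  -- Within distance `d⁻¹ ‖f x‖` of `x` there is a zero `z` of `f`, and `g z = 0`, so the Lipschitz
  -- bound for `g` between `x` and `z` gives this constant.
  refine ⟨Kg * d⁻¹, ?_⟩
  filter_upwards [hnear, Metric.ball_mem_nhds x₀ (half_pos hδ)] with x hx hxb
  have hsub : Metric.closedBall x (d⁻¹ * ‖f x‖) ⊆ Metric.ball x₀ δ := by
    intro z hz
    rw [Metric.mem_closedBall] at hz
    rw [Metric.mem_ball] at hxb ⊢
    linarith [dist_triangle z x x₀]
  have hsur := hsf.surjOn_closedBall_of_nonlinearRightInverse S (ε := d⁻¹ * ‖f x‖) (b := x)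
    (by positivity) (fun z hz => (hball (hsub hz)).1.1)
  have h0mem : (0 : F) ∈ Metric.closedBall (f x)
      (((S.nnnorm : ℝ)⁻¹ - ((S.nnnorm⁻¹ / 2 : NNReal) : ℝ)) * (d⁻¹ * ‖f x‖)) := by
    have : ((S.nnnorm : ℝ)⁻¹ - ((S.nnnorm⁻¹ / 2 : NNReal) : ℝ)) = d := by
      simp only [d]
      push_cast
      ring
    rw [this, ← mul_assoc, mul_inv_cancel₀ hd.ne', one_mul, Metric.mem_closedBall,
      dist_zero_left]
  obtain ⟨z, hz, hfz⟩ := hsur h0mem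
  have hgz : g z = 0 := (hball (hsub hz)).2 hfz
  have hxs : x ∈ Metric.ball x₀ δ := Metric.ball_subset_ball (by linarith) hxb
  have hl := hsg.dist_le_mul x (hball hxs).1.2 z (hball (hsub hz)).1.2
  rw [hgz, dist_zero_right] at hl
  calc ‖g x‖ ≤ Kg * dist x z := hl
    _ ≤ Kg * (d⁻¹ * ‖f x‖) := by
        rw [Metric.mem_closedBall, dist_comm] at hz
        gcongr
    _ = _ := by ring

/-- If the flow of `P` preserves the sections of a distribution of constant rank, the kernel of `K`,
then a solution of the linearized flow equation modulo the distribution stays in it. -/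
theorem eventually_mem_ker_of_linearized_flow [FiniteDimensional ℝ E] [FiniteDimensional ℝ F]
    {K : E → E →L[ℝ] F} {P : E → E} {x₀ : E} {r : ℕ}
    (hK : ∀ᶠ x in 𝓝 x₀, ContDiffAt ℝ ∞ K x)
    (hr : ∀ᶠ x in 𝓝 x₀, finrank ℝ (LinearMap.ker (K x).toLinearMap) = r)
    (hP : ContDiffAt ℝ 1 P x₀)
    (hbr : ∀ᶠ x in 𝓝 x₀, ∀ Z : E → E, (∀ᶠ y in 𝓝 x, ContDiffAt ℝ ∞ Z y) →
      (∀ᶠ y in 𝓝 x, K y (Z y) = 0) → K x (VectorField.lieBracket ℝ P Z x) = 0)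
    {c Z w : ℝ → E} {t₀ : ℝ} (hc₀ : c t₀ = x₀)
    (hc : ∀ᶠ t in 𝓝 t₀, HasDerivAt c (P (c t)) t)
    (hZ : ∀ᶠ t in 𝓝 t₀, HasDerivAt Z (fderiv ℝ P (c t) (Z t) + w t) t)
    (hw : ∀ᶠ t in 𝓝 t₀, K (c t) (w t) = 0)
    (h0 : K (c t₀) (Z t₀) = 0) : ∀ᶠ t in 𝓝 t₀, K (c t) (Z t) = 0 := by
  obtain ⟨J, hJ, hKJ⟩ := exists_contDiffAt_generalized_inverse hK hr
  -- Along the curve, the derivative of `K Z` is `R Z`, because `K w = 0`. The point is that `R`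
  -- kills `ker K`, so that `R = R J K` and the equation for `K Z` is closed and linear.
  let R : E → E →L[ℝ] F := fun x => fderiv ℝ K x (P x) + K x ∘L fderiv ℝ P x
  have hR : ∀ᶠ x in 𝓝 x₀, ∀ a, R x a = R x (J x (K x a)) := by
    filter_upwards [hK, hJ.eventually_nhds, hK.eventually_nhds, hKJ.eventually_nhds, hbr]
      with x hKx hJx hKx' hKJx hbrx a
    let Z : E → E := fun y => a - J y (K y a)
    let b : E := Z x
    -- A local section of `ker K` through `b`. Differentiating `K Z' = 0` along `P` and inserting `K
    -- [P, Z'] = 0` yields `R b = 0`.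
    let Z' : E → E := fun y => b - J y (K y b)
    have hZs : ∀ᶠ y in 𝓝 x, ContDiffAt ℝ ∞ Z' y := by
      filter_upwards [hJx, hKx'] with y hJy hKy
      exact contDiffAt_const.sub (hJy.clm_apply (hKy.clm_apply contDiffAt_const))
    have hZ0 : ∀ᶠ y in 𝓝 x, K y (Z' y) = 0 := by
      filter_upwards [hKJx] with y hy
      simp only [Z', map_sub, hy, sub_self]
    have hKb : K x b = 0 := by
      simp only [b, Z, map_sub, hKJx.self_of_nhds, sub_self]
    have hZx : Z' x = b := by simp only [Z', hKb, map_zero, sub_zero]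
    have hbx := hbrx Z' hZs hZ0
    have hZd : DifferentiableAt ℝ Z' x := hZs.self_of_nhds.differentiableAt (by simp)
    have hKd : DifferentiableAt ℝ K x := hKx.differentiableAt (by simp)
    have hd : fderiv ℝ (fun y => K y (Z' y)) x (P x) = 0 := by
      have : (fun y => K y (Z' y)) =ᶠ[𝓝 x] fun _ => 0 := hZ0
      rw [this.fderiv_eq]
      simp
    rw [fderiv_clm_apply hKd hZd] at hd
    have hRb : R x b = 0 := by
      rw [VectorField.lieBracket, map_sub, hZx] at hbx
      simp only [add_apply, ContinuousLinearMap.comp_apply,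
        ContinuousLinearMap.flip_apply, hZx] at hd
      simp only [R, add_apply, ContinuousLinearMap.comp_apply]
      rw [sub_eq_zero] at hbx
      rw [← hbx, add_comm]
      exact hd
    rw [← sub_eq_zero, ← map_sub]
    exact hRb
  have hK₀ := hK.self_of_nhds
  have hRc : ContinuousAt R x₀ := by
    have h1 : ContinuousAt (fderiv ℝ K) x₀ :=
      (hK₀.fderiv_right (m := 0) (by simp)).continuousAt
    have h2 : ContinuousAt (fderiv ℝ P) x₀ :=
      (hP.fderiv_right (m := 0) (by simp)).continuousAt
    exact (h1.clm_apply hP.continuousAt).add (hK₀.continuousAt.clm_comp h2)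
  have hRJ : ContinuousAt (fun x => R x ∘L J x) x₀ :=
    hRc.clm_comp hJ.self_of_nhds.continuousAt
  have hbound : ∀ᶠ x in 𝓝 x₀, ‖R x ∘L J x‖ ≤ ‖R x₀ ∘L J x₀‖ + 1 :=
    (hRJ.norm.eventually (gt_mem_nhds (lt_add_one _))).mono fun x hx => le_of_lt hx
  have hcc : Tendsto c (𝓝 t₀) (𝓝 x₀) := hc₀ ▸ hc.self_of_nhds.continuousAt
  refine eventually_eq_zero_of_norm_deriv_le (y' := fun t => R (c t) (Z t))
    (C := ‖R x₀ ∘L J x₀‖ + 1) ?_ ?_ h0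
  · filter_upwards [hc, hZ, hw, hcc.eventually hK] with t hct hZt hwt hKt
    have hKd : HasDerivAt (fun s => K (c s)) (fderiv ℝ K (c t) (P (c t))) t :=
      (hKt.differentiableAt (by simp)).hasFDerivAt.comp_hasDerivAt t hct
    have := hKd.clm_apply hZt
    convert this using 1
    simp only [R, add_apply, ContinuousLinearMap.comp_apply, map_add, hwt,
      add_zero]
  · filter_upwards [hcc.eventually hR, hcc.eventually hbound] with t hRt hbt
    rw [hRt]
    exact ((R (c t) ∘L J (c t)).le_opNorm (K (c t) (Z t))).trans
      (mul_le_mul_of_nonneg_right hbt (norm_nonneg _))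

/-- The derivative of a flow in the initial point satisfies the linearized flow equation. -/
theorem hasDerivAt_fderiv_flow {Φ : ℝ × E₁ → E} {P : E → E} {t₀ : ℝ} {x₀ : E₁}
    (hΦ : ContDiffAt ℝ 2 Φ (t₀, x₀)) (hP : DifferentiableAt ℝ P (Φ (t₀, x₀)))
    (hflow : ∀ᶠ p in 𝓝 (t₀, x₀), fderiv ℝ Φ p (1, 0) = P (Φ p)) (a : E₁) :
    HasDerivAt (fun t => fderiv ℝ Φ (t, x₀) (0, a))
      (fderiv ℝ P (Φ (t₀, x₀)) (fderiv ℝ Φ (t₀, x₀) (0, a))) t₀ := by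
  have hΦ' : DifferentiableAt ℝ (fderiv ℝ Φ) (t₀, x₀) :=
    (hΦ.fderiv_right (m := 1) (by norm_num)).differentiableAt (by simp)
  have hsymm : IsSymmSndFDerivAt ℝ Φ (t₀, x₀) := hΦ.isSymmSndFDerivAt (by simp)
  have h1 : HasDerivAt (fun t : ℝ => ((t, x₀) : ℝ × E₁)) (1, 0) t₀ :=
    (hasDerivAt_id t₀).prodMk (hasDerivAt_const t₀ x₀)
  have h2 : HasDerivAt (fun t => fderiv ℝ Φ (t, x₀))
      (fderiv ℝ (fderiv ℝ Φ) (t₀, x₀) (1, 0)) t₀ :=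
    hΦ'.hasFDerivAt.comp_hasDerivAt t₀ h1
  have h3 := h2.clm_apply (hasDerivAt_const t₀ ((0, a) : ℝ × E₁))
  rw [map_zero, add_zero] at h3
  -- Differentiate the flow equation in the direction `(0, a)`; symmetry of the second derivative
  -- turns the left side into the time derivative of `DΦ (0, a)`.
  have h4 : fderiv ℝ (fun p => fderiv ℝ Φ p (1, 0)) (t₀, x₀) = fderiv ℝ (P ∘ Φ) (t₀, x₀) :=
    Filter.EventuallyEq.fderiv_eq hflow
  rw [fderiv_comp _ hP (hΦ.differentiableAt (by simp)),
    fderiv_clm_apply hΦ' (by fun_prop)] at h4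
  have h5 := congrArg (fun A => A (0, a)) h4
  simp only [add_apply, ContinuousLinearMap.comp_apply,
    ContinuousLinearMap.flip_apply, fderiv_fun_const, Pi.zero_apply, zero_apply, map_zero,
    zero_add] at h5
  convert h3 using 1
  rw [← h5]
  exact hsymm (0, a) (1, 0)

end VectorSpaceLemmas

/-! ### Vector fields and brackets read in charts. -/

noncomputable section ManifoldCalculus

open Filter VectorField

variable {E H M : Type*} [NormedAddCommGroup E] [NormedSpace ℝ E]
  [TopologicalSpace H] {I : ModelWithCorners ℝ E H} [TopologicalSpace M] [ChartedSpace H M]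
  [IsManifold I ∞ M]

theorem minSmoothness_two_le_infty : minSmoothness ℝ 2 ≤ ∞ := by
  rw [minSmoothness_of_isRCLikeNormedField]
  exact WithTop.coe_le_coe.2 (le_top (a := (2 : ℕ∞)))

variable (I) in
/-- The vector field `X` is smooth on the manifold `M`. -/
abbrev IsSmoothVF (X : (u : M) → TangentSpace I u) : Prop :=
  ContMDiff I I.tangent ∞ (fun u => (⟨u, X u⟩ : TangentBundle I M))

/-- The expression of a vector field in the chart at `p`. -/
def chartField (p : M) (X : (u : M) → TangentSpace I u) : E → E :=
  mpullback 𝓘(ℝ, E) I (extChartAt I p).symm X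

variable [I.Boundaryless]

theorem isInvertible_mfderiv_extChartAt_symm {p : M} {x : E} (hx : x ∈ (extChartAt I p).target) :
    (mfderiv 𝓘(ℝ, E) I (extChartAt I p).symm x).IsInvertible := by
  have : IsManifold I 1 M := .of_le (n := ∞) (by simp)
  have := isInvertible_mfderivWithin_extChartAt_symm (I := I) hx
  rwa [I.range_eq_univ, mfderivWithin_univ] at this

theorem mfderiv_extChartAt_symm_comp {p : M} {q : M} (hq : q ∈ (extChartAt I p).source)
    (A : TangentSpace I q) :
    (mfderiv 𝓘(ℝ, E) I (extChartAt I p).symm (extChartAt I p q)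
      (mfderiv I 𝓘(ℝ, E) (extChartAt I p) q A) : E) = A := by
  have : IsManifold I 1 M := .of_le (n := ∞) (by simp)
  have := mfderivWithin_extChartAt_symm_comp_mfderiv_extChartAt' (I := I) hq
  rw [I.range_eq_univ, mfderivWithin_univ] at this
  exact congrArg (fun T : E →L[ℝ] E => T A) this

theorem mfderiv_extChartAt_comp_symm {p : M} {x : E} (hx : x ∈ (extChartAt I p).target) (a : E) :
    (mfderiv I 𝓘(ℝ, E) (extChartAt I p) ((extChartAt I p).symm x)
      (mfderiv 𝓘(ℝ, E) I (extChartAt I p).symm x a) : E) = a := by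
  have : IsManifold I 1 M := .of_le (n := ∞) (by simp)
  have := mfderiv_extChartAt_comp_mfderivWithin_extChartAt_symm (I := I) hx
  rw [I.range_eq_univ, mfderivWithin_univ] at this
  exact congrArg (fun T : E →L[ℝ] E => T a) this

/-- The tangent space at `p` is the model space by way of the preferred chart at `p`, so this chart
has the identity as derivative at `p`. All pointwise coordinate computations below rely on this. -/
theorem mfderiv_extChartAt_symm_self (p : M) (a : E) :
    (mfderiv 𝓘(ℝ, E) I (extChartAt I p).symm (extChartAt I p p) a : E) = a := by
  have := mfderiv_extChartAt_symm_comp (I := I) (mem_extChartAt_source (I := I) p) a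
  rwa [mfderiv_extChartAt_self] at this

theorem mfderiv_symm_chartField {p : M} {x : E} (hx : x ∈ (extChartAt I p).target)
    (X : (u : M) → TangentSpace I u) :
    mfderiv 𝓘(ℝ, E) I (extChartAt I p).symm x (chartField (I := I) p X x : E)
      = X ((extChartAt I p).symm x) :=
  (isInvertible_mfderiv_extChartAt_symm hx).self_apply_inverse _

theorem chartField_apply {p q : M} (hq : q ∈ (extChartAt I p).source)
    (X : (u : M) → TangentSpace I u) :
    chartField p X (extChartAt I p q) = mfderiv I 𝓘(ℝ, E) (extChartAt I p) q (X q) := by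
  have ht := (extChartAt I p).map_source hq
  apply (isInvertible_mfderiv_extChartAt_symm (I := I) ht).injective
  rw [mfderiv_symm_chartField ht]
  refine Eq.trans ?_ (mfderiv_extChartAt_symm_comp hq (X q)).symm
  rw [(extChartAt I p).left_inv hq]

theorem chartField_self (p : M) (X : (u : M) → TangentSpace I u) :
    chartField p X (extChartAt I p p) = X p := by
  rw [chartField_apply (mem_extChartAt_source p)]
  rw [mfderiv_extChartAt_self]
  rfl

theorem contMDiffAt_extChartAt_symm' {p : M} {x : E} (hx : x ∈ (extChartAt I p).target) :
    ContMDiffAt 𝓘(ℝ, E) I ∞ (extChartAt I p).symm x :=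
  (contMDiffOn_extChartAt_symm p).contMDiffAt ((isOpen_extChartAt_target p).mem_nhds hx)

theorem contDiffAt_chartField [CompleteSpace E] {p : M} {x : E}
    (hx : x ∈ (extChartAt I p).target) {X : (u : M) → TangentSpace I u}
    (hX : ContMDiffAt I I.tangent ∞ (fun u => (⟨u, X u⟩ : TangentBundle I M))
      ((extChartAt I p).symm x)) :
    ContDiffAt ℝ ∞ (chartField p X) x := by
  have : IsManifold I (∞ + 1) M := by simpa using ‹IsManifold I ∞ M›
  have := ContMDiffAt.mpullback_vectorField_preimage (n := ∞) (m := ∞) hX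
    (contMDiffAt_extChartAt_symm' hx) (isInvertible_mfderiv_extChartAt_symm hx) (by simp)
  exact contMDiffAt_vectorSpace_iff_contDiffAt.1 this

/-- Naturality of the bracket under pullback by the inverse chart; it turns brackets on the manifold
into brackets in the model space. -/
theorem chartField_mlieBracket [CompleteSpace E] {p : M} {x : E}
    (hx : x ∈ (extChartAt I p).target) {X Y : (u : M) → TangentSpace I u}
    (hX : IsSmoothVF I X) (hY : IsSmoothVF I Y) :
    chartField p (mlieBracket I X Y) x
      = lieBracket ℝ (chartField p X) (chartField p Y) x := by
  have : IsManifold I (∞ + 1) M := by simpa using ‹IsManifold I ∞ M›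
  have : IsManifold I (minSmoothness ℝ 2) M := .of_le minSmoothness_two_le_infty
  have := mpullback_mlieBracket (n := ∞) (I := 𝓘(ℝ, E)) (I' := I)
    (f := (extChartAt I p).symm) (x₀ := x) ((hX _).mdifferentiableAt (by simp))
    ((hY _).mdifferentiableAt (by simp)) (contMDiffAt_extChartAt_symm' hx)
    minSmoothness_two_le_infty
  refine this.trans ?_
  rw [← mlieBracketWithin_univ, mlieBracketWithin_eq_lieBracketWithin]
  exact congrFun (lieBracketWithin_univ (V := chartField p X) (W := chartField p Y)) x

end ManifoldCalculus

/-! ### Vector fields as derivations, Cartan's formula, invariance of exact two-forms. -/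

noncomputable section ManifoldDerivations

open Filter VectorField

variable {E H M : Type*} [NormedAddCommGroup E] [NormedSpace ℝ E]
  [TopologicalSpace H] {I : ModelWithCorners ℝ E H} [TopologicalSpace M] [ChartedSpace H M]

variable (I) in
/-- The derivative `X f` of a function along a vector field. -/
def vfDeriv (X : (u : M) → TangentSpace I u) (f : M → ℝ) (u : M) : ℝ :=
  mfderiv I 𝓘(ℝ, ℝ) f u (X u)

theorem vfDeriv_sub {X : (u : M) → TangentSpace I u} {f g : M → ℝ}
    {u : M} (hf : MDifferentiableAt I 𝓘(ℝ, ℝ) f u) (hg : MDifferentiableAt I 𝓘(ℝ, ℝ) g u) :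
    vfDeriv I X (fun w => f w - g w) u = vfDeriv I X f u - vfDeriv I X g u := by
  have := (hf.hasMFDerivAt.sub hg.hasMFDerivAt).mfderiv
  exact congrArg (fun T : E →L[ℝ] ℝ => T (X u)) this

theorem vfDeriv_add {X : (u : M) → TangentSpace I u} {f g : M → ℝ}
    {u : M} (hf : MDifferentiableAt I 𝓘(ℝ, ℝ) f u) (hg : MDifferentiableAt I 𝓘(ℝ, ℝ) g u) :
    vfDeriv I X (fun w => f w + g w) u = vfDeriv I X f u + vfDeriv I X g u := by
  have := (hf.hasMFDerivAt.add hg.hasMFDerivAt).mfderiv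
  exact congrArg (fun T : E →L[ℝ] ℝ => T (X u)) this

theorem vfDeriv_const {X : (u : M) → TangentSpace I u} (c : ℝ) (u : M) :
    vfDeriv I X (fun _ => c) u = 0 := by
  unfold vfDeriv
  rw [mfderiv_const]
  rfl

theorem contMDiffAt_of_contDiffAt_extChartAt {F : Type*} [NormedAddCommGroup F] [NormedSpace ℝ F]
    {f : M → F} {p : M} (hf : ContDiffAt ℝ ∞ (f ∘ (extChartAt I p).symm) (extChartAt I p p)) :
    ContMDiffAt I 𝓘(ℝ, F) ∞ f p := by
  have h := (contMDiffAt_iff_contDiffAt.2 hf).comp p (contMDiffAt_extChartAt (I := I) (n := ∞))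
  refine h.congr_of_eventuallyEq ?_
  filter_upwards [extChartAt_source_mem_nhds (I := I) p] with q hq
  rw [Function.comp_apply, Function.comp_apply, (extChartAt I p).left_inv hq]

variable [IsManifold I ∞ M]

theorem IsSmoothVF.mlieBracket [CompleteSpace E] {X Y : (u : M) → TangentSpace I u}
    (hX : IsSmoothVF I X) (hY : IsSmoothVF I Y) : IsSmoothVF I (mlieBracket I X Y) := by
  have : IsManifold I ((⊤ : ℕ∞) + 1) M := by simpa using ‹IsManifold I ∞ M›
  have : IsManifold I (minSmoothness ℝ 2) M := .of_le minSmoothness_two_le_infty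
  intro p
  exact ContMDiffAt.mlieBracket_vectorField (n := ⊤) (m := ⊤) (hX p) (hY p)
    (by rw [minSmoothness_of_isRCLikeNormedField]; simp)

variable [I.Boundaryless]

theorem mfderiv_real_apply {f : M → ℝ} {p : M}
    {x : E} (hx : x ∈ (extChartAt I p).target)
    (hf : MDifferentiableAt I 𝓘(ℝ, ℝ) f ((extChartAt I p).symm x)) (a : E) :
    (mfderiv I 𝓘(ℝ, ℝ) f ((extChartAt I p).symm x)
      (mfderiv 𝓘(ℝ, E) I (extChartAt I p).symm x a) : ℝ)
      = fderiv ℝ (f ∘ (extChartAt I p).symm) x a := by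
  have h := mfderiv_comp x hf ((contMDiffAt_extChartAt_symm' hx).mdifferentiableAt (by simp))
  rw [mfderiv_eq_fderiv] at h
  exact (congrArg (fun T : E →L[ℝ] ℝ => T a) h).symm

theorem vfDeriv_extChartAt_symm {f : M → ℝ} {p : M} {x : E} (hx : x ∈ (extChartAt I p).target)
    (hf : MDifferentiableAt I 𝓘(ℝ, ℝ) f ((extChartAt I p).symm x))
    (X : (u : M) → TangentSpace I u) :
    vfDeriv I X f ((extChartAt I p).symm x)
      = fderiv ℝ (f ∘ (extChartAt I p).symm) x (chartField p X x) := by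
  rw [← mfderiv_real_apply hx hf, mfderiv_symm_chartField hx]
  rfl

theorem vfDeriv_eq_fderiv {f : M → ℝ} {p : M} (hf : MDifferentiableAt I 𝓘(ℝ, ℝ) f p)
    (X : (u : M) → TangentSpace I u) :
    vfDeriv I X f p = fderiv ℝ (f ∘ (extChartAt I p).symm) (extChartAt I p p) (X p) := by
  have h := vfDeriv_extChartAt_symm (mem_extChartAt_target p) (f := f)
    (by rwa [extChartAt_to_inv]) X
  rw [extChartAt_to_inv, chartField_self] at h
  exact h

theorem contDiffAt_comp_extChartAt_symm {F : Type*} [NormedAddCommGroup F] [NormedSpace ℝ F]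
    {f : M → F} {p : M} {x : E} (hx : x ∈ (extChartAt I p).target)
    (hf : ContMDiffAt I 𝓘(ℝ, F) ∞ f ((extChartAt I p).symm x)) :
    ContDiffAt ℝ ∞ (f ∘ (extChartAt I p).symm) x :=
  contMDiffAt_iff_contDiffAt.1 (hf.comp x (contMDiffAt_extChartAt_symm' hx))

theorem ContMDiffAt.vfDeriv [CompleteSpace E] {X : (u : M) → TangentSpace I u} {f : M → ℝ} {p : M}
    (hX : ContMDiffAt I I.tangent ∞ (fun u => (⟨u, X u⟩ : TangentBundle I M)) p)
    (hf : ∀ᶠ w in 𝓝 p, ContMDiffAt I 𝓘(ℝ, ℝ) ∞ f w) :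
    ContMDiffAt I 𝓘(ℝ, ℝ) ∞ (vfDeriv I X f) p := by
  apply contMDiffAt_of_contDiffAt_extChartAt
  have hp : ∀ᶠ x in 𝓝 (extChartAt I p p), x ∈ (extChartAt I p).target :=
    extChartAt_target_mem_nhds (I := I) p
  have hs : Tendsto (extChartAt I p).symm (𝓝 (extChartAt I p p)) (𝓝 p) := by
    have := (contMDiffAt_extChartAt_symm' (mem_extChartAt_target (I := I) p)).continuousAt.tendsto
    rwa [extChartAt_to_inv] at this
  have hfp : ContDiffAt ℝ ∞ (f ∘ (extChartAt I p).symm) (extChartAt I p p) :=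
    contDiffAt_comp_extChartAt_symm (mem_extChartAt_target p)
      (by rw [extChartAt_to_inv]; exact hf.self_of_nhds)
  have hXp : ContDiffAt ℝ ∞ (chartField p X) (extChartAt I p p) :=
    contDiffAt_chartField (mem_extChartAt_target p) (by rw [extChartAt_to_inv]; exact hX)
  refine ((hfp.fderiv_right (m := ∞) (by simp)).clm_apply hXp).congr_of_eventuallyEq ?_
  filter_upwards [hp, hs.eventually hf] with x hx hfx
  exact vfDeriv_extChartAt_symm hx (hfx.mdifferentiableAt (by simp)) X

theorem ContMDiff.vfDeriv [CompleteSpace E] {X : (u : M) → TangentSpace I u} {f : M → ℝ}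
    (hX : IsSmoothVF I X) (hf : ContMDiff I 𝓘(ℝ, ℝ) ∞ f) :
    ContMDiff I 𝓘(ℝ, ℝ) ∞ (vfDeriv I X f) := fun p =>
  (hX p).vfDeriv (Eventually.of_forall hf)

/-- A bracket of vector fields acts on functions as the commutator. -/
theorem vfDeriv_mlieBracket [CompleteSpace E] {X Y : (u : M) → TangentSpace I u} {f : M → ℝ}
    (hX : IsSmoothVF I X) (hY : IsSmoothVF I Y) (hf : ContMDiff I 𝓘(ℝ, ℝ) ∞ f) (p : M) :
    vfDeriv I (mlieBracket I X Y) f p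
      = vfDeriv I X (vfDeriv I Y f) p - vfDeriv I Y (vfDeriv I X f) p := by
  have hmem := mem_extChartAt_target (I := I) p
  have key : ∀ Z : (u : M) → TangentSpace I u,
      (vfDeriv I Z f) ∘ (extChartAt I p).symm =ᶠ[𝓝 (extChartAt I p p)]
        fun x => fderiv ℝ (f ∘ (extChartAt I p).symm) x (chartField p Z x) := by
    intro Z
    filter_upwards [extChartAt_target_mem_nhds (I := I) p] with x hx
    exact vfDeriv_extChartAt_symm hx ((hf _).mdifferentiableAt (by simp)) Z
  have hd := fderiv_apply_lieBracket (n := ∞)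
    (contDiffAt_comp_extChartAt_symm hmem (hf _)) minSmoothness_two_le_infty
    ((contDiffAt_chartField hmem (hY _)).differentiableAt (by simp))
    ((contDiffAt_chartField hmem (hX _)).differentiableAt (by simp))
  rw [← chartField_mlieBracket hmem hX hY, chartField_self, ← (key Y).fderiv_eq,
    ← (key X).fderiv_eq, chartField_self, chartField_self] at hd
  rw [vfDeriv_eq_fderiv ((hf p).mdifferentiableAt (by simp)),
    vfDeriv_eq_fderiv ((ContMDiff.vfDeriv hX hf p).mdifferentiableAt (by simp)),
    vfDeriv_eq_fderiv ((ContMDiff.vfDeriv hY hf p).mdifferentiableAt (by simp))]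
  exact hd

/-- Cartan's formula for the exterior derivative of a one-form. -/
theorem extDer_apply_eq [CompleteSpace E] {α : (u : M) → TangentSpace I u →L[ℝ] ℝ} {p : M}
    {X Y : (u : M) → TangentSpace I u} (hX : IsSmoothVF I X) (hY : IsSmoothVF I Y)
    (αc : E → E →L[ℝ] ℝ)
    (hαc : αc = fun x => (α ((extChartAt I p).symm x)).comp
      (mfderiv 𝓘(ℝ, E) I (extChartAt I p).symm x))
    (hα : DifferentiableAt ℝ αc (extChartAt I p p))
    (hαX : MDifferentiableAt I 𝓘(ℝ, ℝ) (fun w => α w (X w)) p)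
    (hαY : MDifferentiableAt I 𝓘(ℝ, ℝ) (fun w => α w (Y w)) p) :
    fderiv ℝ αc (extChartAt I p p) (X p) (Y p) - fderiv ℝ αc (extChartAt I p p) (Y p) (X p)
      = vfDeriv I X (fun w => α w (Y w)) p - vfDeriv I Y (fun w => α w (X w)) p
        - α p (mlieBracket I X Y p) := by
  have hmem := mem_extChartAt_target (I := I) p
  have key : ∀ Z : (u : M) → TangentSpace I u,
      (fun w => α w (Z w)) ∘ (extChartAt I p).symm =ᶠ[𝓝 (extChartAt I p p)]
        fun x => αc x (chartField p Z x) := by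
    intro Z
    filter_upwards [extChartAt_target_mem_nhds (I := I) p] with x hx
    rw [hαc]
    exact congrArg (α ((extChartAt I p).symm x)) (mfderiv_symm_chartField hx Z).symm
  have hself : ∀ Z : (u : M) → TangentSpace I u, αc (extChartAt I p p) (Z p) = α p (Z p) := by
    intro Z
    have h : α ((extChartAt I p).symm (extChartAt I p p)) (Z ((extChartAt I p).symm
        (extChartAt I p p))) = αc (extChartAt I p p) (chartField p Z (extChartAt I p p)) :=
      (key Z).self_of_nhds
    rw [chartField_self, extChartAt_to_inv] at h
    exact h.symm
  have hXd : DifferentiableAt ℝ (chartField p X) (extChartAt I p p) :=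
    (contDiffAt_chartField hmem (hX _)).differentiableAt (by simp)
  have hYd : DifferentiableAt ℝ (chartField p Y) (extChartAt I p p) :=
    (contDiffAt_chartField hmem (hY _)).differentiableAt (by simp)
  have hder : ∀ Z : (u : M) → TangentSpace I u,
      DifferentiableAt ℝ (chartField p Z) (extChartAt I p p) → ∀ a : E,
      fderiv ℝ (fun x => αc x (chartField p Z x)) (extChartAt I p p) a
        = αc (extChartAt I p p) (fderiv ℝ (chartField p Z) (extChartAt I p p) a)
          + fderiv ℝ αc (extChartAt I p p) a (Z p) := by
    intro Z hZ a
    rw [fderiv_clm_apply hα hZ, chartField_self]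
    rfl
  have hbr : α p (mlieBracket I X Y p)
      = αc (extChartAt I p p) (fderiv ℝ (chartField p Y) (extChartAt I p p) (X p))
        - αc (extChartAt I p p) (fderiv ℝ (chartField p X) (extChartAt I p p) (Y p)) := by
    rw [← hself, ← chartField_self (I := I) p (mlieBracket I X Y),
      chartField_mlieBracket hmem hX hY, lieBracket, map_sub, chartField_self, chartField_self]
  rw [vfDeriv_eq_fderiv hαX, vfDeriv_eq_fderiv hαY, (key X).fderiv_eq, (key Y).fderiv_eq,
    hder X hXd (Y p), hder Y hYd (X p), hbr]
  ring

/-- A two-form `-dα` is invariant under vector fields in its kernel. -/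
theorem vfDeriv_twoForm_of_mem_ker [CompleteSpace E] {α : (u : M) → TangentSpace I u →L[ℝ] ℝ}
    (hα : ∀ Y : (u : M) → TangentSpace I u, IsSmoothVF I Y →
      ContMDiff I 𝓘(ℝ, ℝ) ∞ (fun w => α w (Y w)))
    {Ω : (u : M) → TangentSpace I u →L[ℝ] TangentSpace I u →L[ℝ] ℝ}
    (hΩ : ∀ X Y : (u : M) → TangentSpace I u, IsSmoothVF I X → IsSmoothVF I Y → ∀ p,
      Ω p (X p) (Y p) = -(vfDeriv I X (fun w => α w (Y w)) p - vfDeriv I Y (fun w => α w (X w)) p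
        - α p (mlieBracket I X Y p)))
    {P X Y : (u : M) → TangentSpace I u} (hP : IsSmoothVF I P) (hX : IsSmoothVF I X)
    (hY : IsSmoothVF I Y) (hPΩ : ∀ u, Ω u (P u) = 0) (p : M) :
    vfDeriv I P (fun w => Ω w (X w) (Y w)) p
      = Ω p (mlieBracket I P X p) (Y p) + Ω p (X p) (mlieBracket I P Y p) := by
  have d : ∀ {f : M → ℝ}, ContMDiff I 𝓘(ℝ, ℝ) ∞ f → MDifferentiableAt I 𝓘(ℝ, ℝ) f p :=
    fun hf => (hf p).mdifferentiableAt (by simp)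
  have hPX := hP.mlieBracket hX
  have hPY := hP.mlieBracket hY
  have hXY := hX.mlieBracket hY
  -- Cartan's formula with `P` in the kernel: `𝔏_P α = d(α(P))`, evaluated on `Z`.
  have h0 : ∀ Z : (u : M) → TangentSpace I u, IsSmoothVF I Z →
      vfDeriv I P (fun w => α w (Z w)) = fun w => vfDeriv I Z (fun w => α w (P w)) w
        + α w (mlieBracket I P Z w) := by
    intro Z hZ
    funext q
    have h := hΩ P Z hP hZ q
    rw [hPΩ] at h
    simp only [zero_apply] at h
    linarith
  have hXα := ContMDiff.vfDeriv hX (hα P hP)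
  have hYα := ContMDiff.vfDeriv hY (hα P hP)
  have e1 : vfDeriv I P (vfDeriv I X (fun w => α w (Y w))) p
      = vfDeriv I (mlieBracket I P X) (fun w => α w (Y w)) p
        + (vfDeriv I X (vfDeriv I Y (fun w => α w (P w))) p
          + vfDeriv I X (fun w => α w (mlieBracket I P Y w)) p) := by
    rw [vfDeriv_mlieBracket hP hX (hα Y hY), h0 Y hY, vfDeriv_add (d hYα) (d (hα _ hPY))]
    ring
  have e2 : vfDeriv I P (vfDeriv I Y (fun w => α w (X w))) p
      = vfDeriv I (mlieBracket I P Y) (fun w => α w (X w)) p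
        + (vfDeriv I Y (vfDeriv I X (fun w => α w (P w))) p
          + vfDeriv I Y (fun w => α w (mlieBracket I P X w)) p) := by
    rw [vfDeriv_mlieBracket hP hY (hα X hX), h0 X hX, vfDeriv_add (d hXα) (d (hα _ hPX))]
    ring
  have e3 : vfDeriv I P (fun w => α w (mlieBracket I X Y w)) p
      = vfDeriv I (mlieBracket I X Y) (fun w => α w (P w)) p
        + α p (mlieBracket I P (mlieBracket I X Y) p) :=
    congrFun (h0 _ hXY) p
  have e4 := vfDeriv_mlieBracket hX hY (hα P hP) p
  -- The Jacobi identity, which matches `α([P, [X, Y]])` with the `α`-terms of `Ω([P, X], Y)` and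
  -- `Ω(X, [P, Y])`. The second derivatives of `α(P)` cancel by `e4`.
  have hjac : mlieBracket I P (mlieBracket I X Y) p
      = mlieBracket I (mlieBracket I P X) Y p + mlieBracket I X (mlieBracket I P Y) p := by
    have : IsManifold I (minSmoothness ℝ 3) M := .of_le (n := ∞) (by
      rw [minSmoothness_of_isRCLikeNormedField]
      exact WithTop.coe_le_coe.2 (le_top (a := (3 : ℕ∞))))
    exact leibniz_identity_mlieBracket_apply ((hP p).of_le minSmoothness_two_le_infty)
      ((hX p).of_le minSmoothness_two_le_infty) ((hY p).of_le minSmoothness_two_le_infty)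
  have hfun : (fun w => Ω w (X w) (Y w)) = fun w =>
      (fun w => vfDeriv I Y (fun w => α w (X w)) w + α w (mlieBracket I X Y w)) w
        - vfDeriv I X (fun w => α w (Y w)) w := by
    funext q
    rw [hΩ X Y hX hY q]
    ring
  have hYX := ContMDiff.vfDeriv hY (hα X hX)
  have hsum : ContMDiff I 𝓘(ℝ, ℝ) ∞
      (fun w => vfDeriv I Y (fun w => α w (X w)) w + α w (mlieBracket I X Y w)) :=
    hYX.add (hα _ hXY)
  rw [hfun, vfDeriv_sub (d hsum) (d (ContMDiff.vfDeriv hX (hα Y hY))),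
    vfDeriv_add (d hYX) (d (hα _ hXY)), hΩ _ _ hPX hY, hΩ _ _ hX hPY]
  rw [hjac, map_add] at e3
  linarith [e1, e2, e3, e4]

end ManifoldDerivations

/-! ### Smooth distributions of constant rank and extension of their local sections. -/

noncomputable section SmoothDistributions

open Filter VectorField Module

variable {E H M F : Type*} [NormedAddCommGroup E] [NormedSpace ℝ E] [FiniteDimensional ℝ E]
  [TopologicalSpace H] {I : ModelWithCorners ℝ E H} [TopologicalSpace M] [ChartedSpace H M]
  [IsManifold I ∞ M] [NormedAddCommGroup F] [NormedSpace ℝ F]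

/-- A vector field that is smooth near a point can be cut off to a smooth vector field. -/
theorem exists_cutoff_vectorField [T2Space M] {q : M} {N : Set M} (hN : N ∈ 𝓝 q)
    {Z : (u : M) → TangentSpace I u}
    (hZ : ∀ w ∈ N, ContMDiffAt I I.tangent ∞ (fun u => (⟨u, Z u⟩ : TangentBundle I M)) w) :
    ∃ χ : M → ℝ, (∀ᶠ w in 𝓝 q, χ w = 1) ∧ (∀ w ∉ N, χ w = 0) ∧
      IsSmoothVF I (fun w => χ w • Z w) := by
  obtain ⟨f, hf⟩ := (SmoothBumpFunction.nhds_basis_tsupport (I := I) q).mem_iff.1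
    (interior_mem_nhds.2 hN)
  refine ⟨f, f.eventuallyEq_one, fun w hw => ?_, ?_⟩
  · exact image_eq_zero_of_notMem_tsupport fun h => hw (interior_subset (hf.2 h))
  · exact ContMDiffOn.smul_section_of_tsupport (s := Z) (V := fun u : M => TangentSpace I u)
      f.contMDiff.contMDiffOn isOpen_interior hf.2
      fun w hw => (hZ w (interior_subset hw)).contMDiffWithinAt

/-- A family of subspaces of the tangent spaces, of constant dimension, that is locally the kernel
of a smooth family of linear maps into `F`. -/
def IsSmoothDistribution (F : Type*) [NormedAddCommGroup F] [NormedSpace ℝ F]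
    (𝒟 : (u : M) → Submodule ℝ (TangentSpace I u)) : Prop :=
  (∃ r, ∀ u, finrank ℝ (𝒟 u) = r) ∧ ∀ p : M, ∃ K : E → E →L[ℝ] F,
    (∀ᶠ x in 𝓝 (extChartAt I p p), ContDiffAt ℝ ∞ K x) ∧
    ∀ᶠ x in 𝓝 (extChartAt I p p), ∀ a : E, K x a = 0 ↔
      mfderiv 𝓘(ℝ, E) I (extChartAt I p).symm x a ∈ 𝒟 ((extChartAt I p).symm x)

variable [I.Boundaryless]

/-- A vector field given locally, in a chart, extends to a smooth vector field; if it has values in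
a distribution, then so has the extension. -/
theorem exists_vectorField_of_chart [T2Space M] {p : M} {x : E} (hx : x ∈ (extChartAt I p).target)
    {Z : E → E} (hZ : ∀ᶠ y in 𝓝 x, ContDiffAt ℝ ∞ Z y)
    {𝒟 : (u : M) → Submodule ℝ (TangentSpace I u)}
    (h𝒟 : ∀ᶠ y in 𝓝 x, mfderiv 𝓘(ℝ, E) I (extChartAt I p).symm y (Z y)
      ∈ 𝒟 ((extChartAt I p).symm y)) :
    ∃ X : (u : M) → TangentSpace I u, IsSmoothVF I X ∧ (∀ u, X u ∈ 𝒟 u) ∧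
      ∀ᶠ y in 𝓝 x, chartField p X y = Z y := by
  have : IsManifold I (∞ + 1) M := by simpa using ‹IsManifold I ∞ M›
  let e := extChartAt I p
  let Z' : (u : M) → TangentSpace I u := fun u => mfderiv 𝓘(ℝ, E) I e.symm (e u) (Z (e u))
  have hse : e.symm x ∈ e.source := e.map_target hx
  have hZ' : ∀ w ∈ e.source, Z' w = mpullback I 𝓘(ℝ, E) e Z w := by
    intro w hw
    have hi : (mfderiv I 𝓘(ℝ, E) e w).IsInvertible := isInvertible_mfderiv_extChartAt hw
    apply hi.injective
    refine Eq.trans ?_ (hi.self_apply_inverse (Z (e w))).symm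
    have := mfderiv_extChartAt_comp_symm (e.map_source hw) (Z (e w))
    rw [e.left_inv hw] at this
    exact this
  have hec : Tendsto e (𝓝 (e.symm x)) (𝓝 x) := by
    have := (continuousAt_extChartAt' (I := I) hse).tendsto
    rwa [e.right_inv hx] at this
  -- The cut-off is supported where the chart is defined, `Z` is smooth and its values lie in `𝒟`;
  -- elsewhere the extension is zero, which is in `𝒟` trivially.
  have hN : {w | w ∈ e.source ∧ ContDiffAt ℝ ∞ Z (e w) ∧
      mfderiv 𝓘(ℝ, E) I e.symm (e w) (Z (e w)) ∈ 𝒟 (e.symm (e w))} ∈ 𝓝 (e.symm x) := by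
    filter_upwards [(isOpen_extChartAt_source (I := I) p).mem_nhds hse, hec.eventually hZ,
      hec.eventually h𝒟] with w h1 h2 h3
    exact ⟨h1, h2, h3⟩
  obtain ⟨χ, hχ1, hχ0, hχ⟩ := exists_cutoff_vectorField (I := I) (Z := Z') hN (by
    intro w hw
    have hw' : w ∈ (chartAt H p).source := by rw [← extChartAt_source I]; exact hw.1
    have := ContMDiffAt.mpullback_vectorField_preimage (n := ∞) (m := ∞) (I := I)
      (I' := 𝓘(ℝ, E)) (f := e) (x₀ := w) (V := Z)
      (contMDiffAt_vectorSpace_iff_contDiffAt.2 hw.2.1)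
      (contMDiffAt_extChartAt' hw') (isInvertible_mfderiv_extChartAt hw.1) (by simp)
    refine this.congr_of_eventuallyEq ?_
    filter_upwards [(isOpen_extChartAt_source (I := I) p).mem_nhds hw.1] with v hv
    rw [hZ' v hv])
  refine ⟨fun w => χ w • Z' w, hχ, fun w => ?_, ?_⟩
  · change χ w • Z' w ∈ 𝒟 w
    by_cases hw : w ∈ {w | w ∈ e.source ∧ ContDiffAt ℝ ∞ Z (e w) ∧
      mfderiv 𝓘(ℝ, E) I e.symm (e w) (Z (e w)) ∈ 𝒟 (e.symm (e w))}
    · apply Submodule.smul_mem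
      have := hw.2.2
      rwa [e.left_inv hw.1] at this
    · rw [hχ0 w hw, zero_smul]
      exact zero_mem _
  · have hes : Tendsto e.symm (𝓝 x) (𝓝 (e.symm x)) :=
      (contMDiffAt_extChartAt_symm' hx).continuousAt
    filter_upwards [hes.eventually hχ1, (isOpen_extChartAt_target (I := I) p).mem_nhds hx]
      with y hy hyt
    apply (isInvertible_mfderiv_extChartAt_symm (I := I) hyt).injective
    rw [mfderiv_symm_chartField hyt, hy, one_smul]
    simp only [Z']
    rw [e.right_inv hyt]

theorem exists_vectorField_apply_eq [T2Space M] (p : M) (A : TangentSpace I p) :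
    ∃ X : (u : M) → TangentSpace I u, IsSmoothVF I X ∧ X p = A := by
  obtain ⟨X, hX, -, h⟩ := exists_vectorField_of_chart (mem_extChartAt_target (I := I) p)
    (Z := fun _ => A) (Eventually.of_forall fun y => contDiffAt_const) (𝒟 := fun _ => ⊤)
    (Eventually.of_forall fun y => Submodule.mem_top)
  refine ⟨X, hX, ?_⟩
  have := h.self_of_nhds
  rwa [chartField_self] at this

omit [FiniteDimensional ℝ E] in
theorem finrank_ker_of_distribution {𝒟 : (u : M) → Submodule ℝ (TangentSpace I u)} {p : M} {x : E}
    (hx : x ∈ (extChartAt I p).target) {T : E →L[ℝ] F} (hT : ∀ a : E, T a = 0 ↔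
      mfderiv 𝓘(ℝ, E) I (extChartAt I p).symm x a ∈ 𝒟 ((extChartAt I p).symm x)) :
    finrank ℝ (LinearMap.ker T.toLinearMap) = finrank ℝ (𝒟 ((extChartAt I p).symm x)) := by
  obtain ⟨e', he⟩ := isInvertible_mfderiv_extChartAt_symm (I := I) hx
  let e : E ≃L[ℝ] TangentSpace I ((extChartAt I p).symm x) := e'
  have : (LinearMap.ker T.toLinearMap)
      = (𝒟 ((extChartAt I p).symm x)).comap (e.toLinearEquiv : E →ₗ[ℝ] _) := by
    ext a
    rw [LinearMap.mem_ker, Submodule.mem_comap]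
    refine (hT a).trans ?_
    rw [← he]
    rfl
  rw [this, ← LinearEquiv.finrank_map_eq e.toLinearEquiv]
  exact congrArg (fun V : Submodule ℝ _ => finrank ℝ V)
    (Submodule.map_comap_eq_of_surjective e.surjective _)

omit [FiniteDimensional ℝ E] in
/-- In a chart, the linear maps defining a distribution have constant rank. -/
theorem eventually_finrank_ker_eq [FiniteDimensional ℝ F]
    {𝒟 : (u : M) → Submodule ℝ (TangentSpace I u)} {r : ℕ} (hr : ∀ u, finrank ℝ (𝒟 u) = r)
    {p : M} {K : E → E →L[ℝ] F}
    (hK𝒟 : ∀ᶠ x in 𝓝 (extChartAt I p p), ∀ a : E, K x a = 0 ↔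
      mfderiv 𝓘(ℝ, E) I (extChartAt I p).symm x a ∈ 𝒟 ((extChartAt I p).symm x)) :
    ∀ᶠ x in 𝓝 (extChartAt I p p), finrank ℝ (LinearMap.ker (K x).toLinearMap) = r := by
  filter_upwards [hK𝒟, extChartAt_target_mem_nhds (I := I) p] with x hx hxt
  rw [finrank_ker_of_distribution hxt hx, hr]

/-- Every vector of a smooth distribution extends to a smooth section. -/
theorem IsSmoothDistribution.exists_section [FiniteDimensional ℝ F] [T2Space M]
    {𝒟 : (u : M) → Submodule ℝ (TangentSpace I u)} (h : IsSmoothDistribution F 𝒟) {p : M}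
    {A : TangentSpace I p} (hA : A ∈ 𝒟 p) :
    ∃ X : (u : M) → TangentSpace I u, IsSmoothVF I X ∧ (∀ u, X u ∈ 𝒟 u) ∧ X p = A := by
  obtain ⟨⟨r, hr⟩, h⟩ := h
  obtain ⟨K, hK, hK𝒟⟩ := h p
  obtain ⟨J, hJ, hKJ⟩ := exists_contDiffAt_generalized_inverse hK (eventually_finrank_ker_eq hr hK𝒟)
  let a : E := A
  -- `1 - J K` takes values in `ker K` near the base point, and it fixes `a` at that point because
  -- `K a = 0` there.
  let Z : E → E := fun y => a - J y (K y a)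
  have hZ : ∀ᶠ y in 𝓝 (extChartAt I p p), ContDiffAt ℝ ∞ Z y := by
    filter_upwards [hK, hJ] with y hKy hJy
    exact contDiffAt_const.sub (hJy.clm_apply (hKy.clm_apply contDiffAt_const))
  obtain ⟨X, hX, hX𝒟, hXZ⟩ := exists_vectorField_of_chart (mem_extChartAt_target (I := I) p) hZ
    (𝒟 := 𝒟) (by
      filter_upwards [hKJ, hK𝒟] with y hy hy𝒟
      rw [← hy𝒟]
      simp only [Z, map_sub, hy, sub_self])
  refine ⟨X, hX, hX𝒟, ?_⟩
  have h0 : K (extChartAt I p p) a = 0 := by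
    rw [hK𝒟.self_of_nhds a]
    have h1 := mfderiv_extChartAt_symm_self (I := I) p a
    have h2 := extChartAt_to_inv (I := I) p
    generalize hT : mfderiv 𝓘(ℝ, E) I (extChartAt I p).symm (extChartAt I p p) a = T at h1
    clear hT
    revert T
    rw [h2]
    intro T hT
    rw [show T = A from hT]
    exact hA
  have h1 := hXZ.self_of_nhds
  rw [chartField_self] at h1
  rw [h1]
  simp only [Z, h0, map_zero, sub_zero]
  rfl

end SmoothDistributions

/-! ### Smooth local flows and the chain rule with variable parameter. -/

noncomputable section SmoothLocalFlows

open Filter VectorField Module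

variable {E H M F : Type*} [NormedAddCommGroup E] [NormedSpace ℝ E]
  [TopologicalSpace H] {I : ModelWithCorners ℝ E H} [TopologicalSpace M] [ChartedSpace H M]

variable (I) in
/-- A smooth local flow of the vector field `P`, defined on `(a, b) × U`. -/
structure IsSmoothLocalFlow (P : (u : M) → TangentSpace I u) (a b : ℝ) (U : Set M)
    (φ : ℝ → M → M) : Prop where
  neg : a < 0
  pos : 0 < b
  isOpen : IsOpen U
  contMDiffOn : ContMDiffOn (𝓘(ℝ, ℝ).prod I) I ∞ (fun p : ℝ × M => φ p.1 p.2) (Ioo a b ×ˢ U)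
  zero : ∀ u ∈ U, φ 0 u = u
  curve : ∀ u ∈ U, IsMIntegralCurveOn (I := I) (fun ε => φ ε u) P (Ioo a b)

namespace IsSmoothLocalFlow

variable {P : (u : M) → TangentSpace I u} {a b : ℝ} {U : Set M} {φ : ℝ → M → M}
  (h : IsSmoothLocalFlow I P a b U φ)
include h

theorem zero_mem : (0 : ℝ) ∈ Ioo a b := ⟨h.neg, h.pos⟩

theorem contMDiffAt {ε : ℝ} (hε : ε ∈ Ioo a b) {u : M} (hu : u ∈ U) :
    ContMDiffAt (𝓘(ℝ, ℝ).prod I) I ∞ (fun p : ℝ × M => φ p.1 p.2) (ε, u) :=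
  h.contMDiffOn.contMDiffAt ((isOpen_Ioo.prod h.isOpen).mem_nhds ⟨hε, hu⟩)

theorem contMDiffAt_map {ε : ℝ} (hε : ε ∈ Ioo a b) {u : M} (hu : u ∈ U) :
    ContMDiffAt I I ∞ (φ ε) u :=
  (h.contMDiffAt hε hu).comp u (contMDiffAt_const.prodMk contMDiffAt_id)

theorem hasMFDerivAt_curve {ε : ℝ} (hε : ε ∈ Ioo a b) {u : M} (hu : u ∈ U) :
    HasMFDerivAt 𝓘(ℝ, ℝ) I (fun ε => φ ε u) ε ((1 : ℝ →L[ℝ] ℝ).smulRight (P (φ ε u))) :=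
  (h.curve u hu ε hε).hasMFDerivAt (isOpen_Ioo.mem_nhds hε)

/-- The derivative of a flow along a curve, with a variable parameter. -/
theorem hasMFDerivAt_comp {c : ℝ → M} {e : ℝ → ℝ} {t : ℝ} {A : TangentSpace I (c t)} {e' : ℝ}
    (hc : HasMFDerivAt 𝓘(ℝ, ℝ) I c t ((1 : ℝ →L[ℝ] ℝ).smulRight A)) (he : HasDerivAt e e' t)
    (hcU : c t ∈ U) (het : e t ∈ Ioo a b) :
    HasMFDerivAt 𝓘(ℝ, ℝ) I (fun s => φ (e s) (c s)) t
      ((1 : ℝ →L[ℝ] ℝ).smulRight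
        (mfderiv I I (φ (e t)) (c t) A + e' • P (φ (e t) (c t)))) := by
  have hd : MDifferentiableAt (𝓘(ℝ, ℝ).prod I) I (fun p : ℝ × M => φ p.1 p.2) (e t, c t) :=
    (h.contMDiffAt het hcU).mdifferentiableAt (by simp)
  have hpair : HasMFDerivAt 𝓘(ℝ, ℝ) (𝓘(ℝ, ℝ).prod I) (fun s => (e s, c s)) t
      (((1 : ℝ →L[ℝ] ℝ).smulRight e').prod ((1 : ℝ →L[ℝ] ℝ).smulRight A)) :=
    he.hasFDerivAt.hasMFDerivAt.prodMk hc
  have hcomp := HasMFDerivAt.comp t hd.hasMFDerivAt hpair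
  have h1 := mfderiv_prod_eq_add_apply (v := ((e', A) : ℝ × E)) hd
  have h2 := congrArg (fun T : ℝ →L[ℝ] E => T e') (h.hasMFDerivAt_curve het hcU).mfderiv
  have h3 : (mfderiv (𝓘(ℝ, ℝ).prod I) I (fun p : ℝ × M => φ p.1 p.2) (e t, c t)
      ((e', A) : ℝ × E) : E) = HAdd.hAdd (α := E) (β := E) (mfderiv I I (φ (e t)) (c t) A)
        (e' • P (φ (e t) (c t))) := by
    refine h1.trans ?_
    rw [add_comm]
    exact congrArg (fun v : E => HAdd.hAdd (α := E) (β := E)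
      (mfderiv I I (φ (e t)) (c t) A) v) h2
  have h4 : ((mfderiv (𝓘(ℝ, ℝ).prod I) I (fun p : ℝ × M => φ p.1 p.2) (e t, c t)).comp
      (((1 : ℝ →L[ℝ] ℝ).smulRight e').prod ((1 : ℝ →L[ℝ] ℝ).smulRight A)) : ℝ →L[ℝ] E)
      = (1 : ℝ →L[ℝ] ℝ).smulRight
        (HAdd.hAdd (α := E) (β := E) (mfderiv I I (φ (e t)) (c t) A)
          (e' • P (φ (e t) (c t)))) := by
    apply ContinuousLinearMap.ext_ring
    rw [← h3]
    refine congrArg (fun v : ℝ × E => (mfderiv (𝓘(ℝ, ℝ).prod I) I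
      (fun p : ℝ × M => φ p.1 p.2) (e t, c t) v : E)) ?_ |>.trans (one_smul ℝ _).symm
    exact Prod.ext (one_smul ℝ e') (one_smul ℝ (A : E))
  exact hcomp.congr_mfderiv h4

end IsSmoothLocalFlow

end SmoothLocalFlows

/-! ### Transport of distributions by flows. -/

noncomputable section FlowTransport

open Filter VectorField Module

variable {E H M F : Type*} [NormedAddCommGroup E] [NormedSpace ℝ E]
  [TopologicalSpace H] {I : ModelWithCorners ℝ E H} [TopologicalSpace M] [ChartedSpace H M]
  [IsManifold I ∞ M] [NormedAddCommGroup F] [NormedSpace ℝ F]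

theorem mfderiv_extChartAt_symm_mem_iff [I.Boundaryless]
    {𝒟 : (u : M) → Submodule ℝ (TangentSpace I u)} {p q : M} (hq : q ∈ (extChartAt I p).source)
    (V : TangentSpace I q) :
    mfderiv 𝓘(ℝ, E) I (extChartAt I p).symm (extChartAt I p q)
      (mfderiv I 𝓘(ℝ, E) (extChartAt I p) q V) ∈ 𝒟 ((extChartAt I p).symm (extChartAt I p q)) ↔
      V ∈ 𝒟 q := by
  have h1 := mfderiv_extChartAt_symm_comp hq V
  have h2 := (extChartAt I p).left_inv hq
  generalize mfderiv 𝓘(ℝ, E) I (extChartAt I p).symm (extChartAt I p q)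
    (mfderiv I 𝓘(ℝ, E) (extChartAt I p) q V) = T at h1
  revert T
  rw [h2]
  rintro T rfl
  rfl

namespace IsSmoothLocalFlow

variable {P : (u : M) → TangentSpace I u} {a b : ℝ} {U : Set M} {φ : ℝ → M → M}

variable (I) in
/-- A local flow, in the charts at `u` (initial point) and `p` (end point). -/
def chartFlow (φ : ℝ → M → M) (u p : M) (z : ℝ × E) : E :=
  extChartAt I p (φ z.1 ((extChartAt I u).symm z.2))

variable [I.Boundaryless]

theorem contDiffAt_chartFlow (h : IsSmoothLocalFlow I P a b U φ) {u p : M} {ε : ℝ} {x : E}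
    (hε : ε ∈ Ioo a b) (hx : x ∈ (extChartAt I u).target) (hU : (extChartAt I u).symm x ∈ U)
    (hp : φ ε ((extChartAt I u).symm x) ∈ (extChartAt I p).source) :
    ContDiffAt ℝ ∞ (chartFlow I φ u p) (ε, x) := by
  apply contMDiffAt_iff_contDiffAt.1
  have h1 : ContMDiffAt 𝓘(ℝ, ℝ × E) (𝓘(ℝ, ℝ).prod I) ∞
      (fun z : ℝ × E => (z.1, (extChartAt I u).symm z.2)) (ε, x) :=
    contDiff_fst.contDiffAt.contMDiffAt.prodMk
      ((contMDiffAt_extChartAt_symm' (I := I) hx).comp (ε, x) contDiff_snd.contDiffAt.contMDiffAt)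
  have h2 := (h.contMDiffAt hε hU).comp (ε, x) h1
  have hp' : φ ε ((extChartAt I u).symm x) ∈ (chartAt H p).source := by
    rwa [← extChartAt_source I]
  exact (contMDiffAt_extChartAt' (I := I) (n := ∞) hp').comp (ε, x) h2

/-- Links the chart derivative, for which the linearized flow equation is available, with the
intrinsic derivative of `φ ε`. The variables `w` and `B` free the statement from the chart
expressions of the initial point and vector. -/
theorem fderiv_chartFlow (h : IsSmoothLocalFlow I P a b U φ) {u p : M} {ε : ℝ} {x : E}
    (hε : ε ∈ Ioo a b) (hx : x ∈ (extChartAt I u).target) (hU : (extChartAt I u).symm x ∈ U)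
    (hp : φ ε ((extChartAt I u).symm x) ∈ (extChartAt I p).source) (s : ℝ) (A : E)
    {w : M} (hw : (extChartAt I u).symm x = w) {B : TangentSpace I w}
    (hB : (mfderiv 𝓘(ℝ, E) I (extChartAt I u).symm x A : E) = B) :
    fderiv ℝ (chartFlow I φ u p) (ε, x) (s, A)
      = mfderiv I 𝓘(ℝ, E) (extChartAt I p) (φ ε w) (mfderiv I I (φ ε) w B + s • P (φ ε w)) := by
  subst hw
  obtain rfl : _ = B := hB
  -- Both sides are computed as the velocity of the same test curve, whose initial point and
  -- parameter move linearly with velocities `A` and `s`.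
  obtain ⟨y, hy0, hy⟩ : ∃ y : ℝ → E, y 0 = x ∧ HasDerivAt y A 0 :=
    ⟨fun t => x + t • A, by simp, by
      simpa using ((hasDerivAt_id (0 : ℝ)).smul_const A).const_add x⟩
  obtain ⟨e, he0, he⟩ : ∃ e : ℝ → ℝ, e 0 = ε ∧ HasDerivAt e s 0 :=
    ⟨fun t => ε + t * s, by simp, by
      simpa using ((hasDerivAt_id (0 : ℝ)).mul_const s).const_add ε⟩
  subst hy0 he0
  have hsymm := ((contMDiffAt_extChartAt_symm' (I := I) hx).mdifferentiableAt
    (by simp)).hasMFDerivAt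
  have hc := HasMFDerivAt.comp (0 : ℝ) hsymm hy.hasFDerivAt.hasMFDerivAt
  have hc' : HasMFDerivAt 𝓘(ℝ, ℝ) I (fun t => (extChartAt I u).symm (y t)) 0
      ((1 : ℝ →L[ℝ] ℝ).smulRight (mfderiv 𝓘(ℝ, E) I (extChartAt I u).symm (y 0) A)) := by
    have h4 : ((mfderiv 𝓘(ℝ, E) I (extChartAt I u).symm (y 0)).comp
        ((1 : ℝ →L[ℝ] ℝ).smulRight A) : ℝ →L[ℝ] E) = (1 : ℝ →L[ℝ] ℝ).smulRight
          (mfderiv 𝓘(ℝ, E) I (extChartAt I u).symm (y 0) A : E) := by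
      apply ContinuousLinearMap.ext_ring
      exact (congrArg (fun v : E => (mfderiv 𝓘(ℝ, E) I (extChartAt I u).symm (y 0) v : E))
        (one_smul ℝ A)).trans (one_smul ℝ _).symm
    exact hc.congr_mfderiv h4
  have hφ := h.hasMFDerivAt_comp hc' he hU hε
  have hp' : φ (e 0) ((extChartAt I u).symm (y 0)) ∈ (chartAt H p).source := by
    rwa [← extChartAt_source I]
  have hep : MDifferentiableAt I 𝓘(ℝ, E) (extChartAt I p)
      (φ (e 0) ((extChartAt I u).symm (y 0))) := mdifferentiableAt_extChartAt hp'
  have hchain' : HasFDerivAt (fun t => extChartAt I p (φ (e t) ((extChartAt I u).symm (y t))))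
      ((mfderiv I 𝓘(ℝ, E) (extChartAt I p) (φ (e 0) ((extChartAt I u).symm (y 0))) :
        E →L[ℝ] E).comp ((1 : ℝ →L[ℝ] ℝ).smulRight (mfderiv I I (φ (e 0))
          ((extChartAt I u).symm (y 0)) (mfderiv 𝓘(ℝ, E) I (extChartAt I u).symm (y 0) A) +
            s • P (φ (e 0) ((extChartAt I u).symm (y 0))) : E))) 0 :=
    (HasMFDerivAt.comp (0 : ℝ) hep.hasMFDerivAt hφ).hasFDerivAt
  have hd := ((h.contDiffAt_chartFlow hε hx hU hp).differentiableAt (by simp)).hasFDerivAt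
  have hd' := (hd.comp_hasDerivAt (0 : ℝ) (he.prodMk hy)).hasFDerivAt
  have h5 := congrArg (fun T : ℝ →L[ℝ] E => T 1) (hd'.unique hchain')
  refine ((one_smul ℝ _).symm.trans h5).trans ?_
  exact congrArg (fun v : E => (mfderiv I 𝓘(ℝ, E) (extChartAt I p)
      (φ (e 0) ((extChartAt I u).symm (y 0))) v : E)) (one_smul ℝ _)

/-- **Transport of a distribution by a flow.** If brackets with `P` preserve the sections of the
distribution `𝒟`, and `[P, X]` is in `𝒟` along a flow line, then the difference between the
pushforward of a tangent vector and `X` either is in `𝒟` all along the flow line, or nowhere. -/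
theorem mem_distribution [FiniteDimensional ℝ E] [FiniteDimensional ℝ F] [T2Space M]
    (h : IsSmoothLocalFlow I P a b U φ) (hP : IsSmoothVF I P)
    {𝒟 : (u : M) → Submodule ℝ (TangentSpace I u)} (h𝒟 : IsSmoothDistribution F 𝒟)
    (hbr : ∀ Z : (u : M) → TangentSpace I u, IsSmoothVF I Z → (∀ w, Z w ∈ 𝒟 w) →
      ∀ w, mlieBracket I P Z w ∈ 𝒟 w)
    {u : M} (hu : u ∈ U) (A : TangentSpace I u) {X : (u : M) → TangentSpace I u}
    (hX : IsSmoothVF I X) (hPX : ∀ ε ∈ Ioo a b, mlieBracket I P X (φ ε u) ∈ 𝒟 (φ ε u))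
    {ε₁ ε₂ : ℝ} (h₁ : ε₁ ∈ Ioo a b) (h₂ : ε₂ ∈ Ioo a b) :
    mfderiv I I (φ ε₁) u A - X (φ ε₁ u) ∈ 𝒟 (φ ε₁ u) ↔
      mfderiv I I (φ ε₂) u A - X (φ ε₂ u) ∈ 𝒟 (φ ε₂ u) := by
  -- The interval is connected, so it suffices that membership is locally constant in the parameter.
  refine (isPreconnected_Ioo (a := a) (b := b)).induction₂
    (fun ε₁ ε₂ => mfderiv I I (φ ε₁) u A - X (φ ε₁ u) ∈ 𝒟 (φ ε₁ u) ↔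
      mfderiv I I (φ ε₂) u A - X (φ ε₂ u) ∈ 𝒟 (φ ε₂ u)) ?_
    (fun _ _ _ _ _ _ h h' => h.trans h') (fun _ _ _ _ h => h.symm) h₁ h₂
  intro ε₀ hε₀
  apply Filter.Eventually.filter_mono nhdsWithin_le_nhds
  let p := φ ε₀ u
  let e := extChartAt I p
  let xu := extChartAt I u u
  have hxu : xu ∈ (extChartAt I u).target := mem_extChartAt_target u
  have hxu' : (extChartAt I u).symm xu = u := extChartAt_to_inv u
  obtain ⟨⟨r, hr⟩, hloc⟩ := h𝒟
  obtain ⟨K, hK, hK𝒟⟩ := hloc p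
  let Pc : E → E := chartField p P
  let Xc : E → E := chartField p X
  let c : ℝ → E := fun ε => e (φ ε u)
  let A' : E := A
  let Z : ℝ → E := fun ε => fderiv ℝ (chartFlow I φ u p) (ε, xu) (0, A') - Xc (c ε)
  have hcφ : ContinuousAt (fun ε => φ ε u) ε₀ := (h.hasMFDerivAt_curve hε₀ hu).continuousAt
  have hsrc : ∀ᶠ ε in 𝓝 ε₀, φ ε u ∈ e.source :=
    hcφ.eventually (extChartAt_source_mem_nhds (I := I) p)
  have hIoo : ∀ᶠ ε in 𝓝 ε₀, ε ∈ Ioo a b := isOpen_Ioo.mem_nhds hε₀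
  have hcc : Tendsto c (𝓝 ε₀) (𝓝 (e p)) :=
    Tendsto.comp (continuousAt_extChartAt (I := I) p) hcφ
  have hflow : ∀ z : ℝ × E, z.1 ∈ Ioo a b → z.2 ∈ (extChartAt I u).target →
      (extChartAt I u).symm z.2 ∈ U → φ z.1 ((extChartAt I u).symm z.2) ∈ e.source →
      fderiv ℝ (chartFlow I φ u p) z (1, 0) = Pc (chartFlow I φ u p z) := by
    intro z h1 h2 h3 h4
    have h5 := h.fderiv_chartFlow h1 h2 h3 h4 1 0 rfl (B := (0 : E)) (map_zero _)
    refine h5.trans (Eq.trans ?_ (chartField_apply h4 P).symm)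
    rw [one_smul]
    refine congrArg (fun v : E => (mfderiv I 𝓘(ℝ, E) (extChartAt I p)
      (φ z.1 ((extChartAt I u).symm z.2)) v : E)) ?_
    exact (congrArg (fun v : E => HAdd.hAdd (α := E) (β := E) v
      (P (φ z.1 ((extChartAt I u).symm z.2)))) (map_zero _)).trans (zero_add (M := E) _)
  have hZ : ∀ᶠ ε in 𝓝 ε₀, Z ε
      = mfderiv I 𝓘(ℝ, E) e (φ ε u) (mfderiv I I (φ ε) u A - X (φ ε u)) := by
    filter_upwards [hsrc, hIoo] with ε hs hε
    have h1 := h.fderiv_chartFlow hε hxu (by rwa [hxu']) (p := p) (by rwa [hxu']) 0 A' hxu'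
      (B := A) (mfderiv_extChartAt_symm_self (E := E) (I := I) u A')
    have h1' : fderiv ℝ (chartFlow I φ u p) (ε, xu) (0, A') = (mfderiv I 𝓘(ℝ, E) e (φ ε u)
        (mfderiv I I (φ ε) u A) : E) := by
      rwa [zero_smul, add_zero] at h1
    exact (congrArg₂ (fun v w : E => v - w) h1' (chartField_apply hs X)).trans
      (map_sub (mfderiv I 𝓘(ℝ, E) e (φ ε u) : E →L[ℝ] E) (mfderiv I I (φ ε) u A : E)
        (X (φ ε u) : E)).symm
  have hZK : ∀ᶠ ε in 𝓝 ε₀, (K (c ε) (Z ε) = 0 ↔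
      mfderiv I I (φ ε) u A - X (φ ε u) ∈ 𝒟 (φ ε u)) := by
    filter_upwards [hZ, hsrc, hcc.eventually hK𝒟] with ε hZε hs hKε
    rw [hKε (Z ε), hZε]
    exact mfderiv_extChartAt_symm_mem_iff hs _
  have hPd : ContDiffAt ℝ ∞ Pc (e p) := contDiffAt_chartField (mem_extChartAt_target p) (hP _)
  have hcflow : ∀ ε, chartFlow I φ u p (ε, xu) = c ε := by
    intro ε
    simp only [chartFlow, c, hxu', e]
  have hcd : ∀ᶠ ε in 𝓝 ε₀, HasDerivAt c (Pc (c ε)) ε := by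
    filter_upwards [hsrc, hIoo] with ε hs hε
    have h1 := ((h.contDiffAt_chartFlow hε hxu (by rwa [hxu']) (p := p)
      (by rwa [hxu'])).differentiableAt (by simp)).hasFDerivAt
    have h2 := h1.comp_hasDerivAt ε ((hasDerivAt_id ε).prodMk (hasDerivAt_const ε xu))
    rw [hflow (ε, xu) hε hxu (by rwa [hxu']) (by rwa [hxu']), hcflow] at h2
    exact h2.congr_of_eventuallyEq (Eventually.of_forall fun s => (hcflow s).symm)
  -- The pushed vector satisfies the linearized flow equation, and the derivative of `Xc` along the
  -- curve differs from `DPc Xc` by the bracket. So `Z` satisfies the equation with `-[P, X]` as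
  -- inhomogeneity, which lies in the distribution.
  have hZd : ∀ᶠ ε in 𝓝 ε₀, HasDerivAt Z
      (fderiv ℝ Pc (c ε) (Z ε) + -lieBracket ℝ Pc Xc (c ε)) ε := by
    filter_upwards [hsrc, hIoo, hcd] with ε hs hε hcε
    have ht : c ε ∈ e.target := e.map_source hs
    have hsm := h.contDiffAt_chartFlow hε hxu (by rwa [hxu']) (p := p) (by rwa [hxu'])
    have hev : ∀ᶠ z in 𝓝 (ε, xu),
        fderiv ℝ (chartFlow I φ u p) z (1, 0) = Pc (chartFlow I φ u p z) := by
      have t2 : Tendsto (fun z : ℝ × E => (extChartAt I u).symm z.2) (𝓝 (ε, xu)) (𝓝 u) := by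
        have := ((contMDiffAt_extChartAt_symm' (I := I) hxu).continuousAt.tendsto.comp
          (continuousAt_snd (p := (ε, xu))).tendsto)
        rwa [hxu'] at this
      have t3 : Tendsto (fun z : ℝ × E => φ z.1 ((extChartAt I u).symm z.2)) (𝓝 (ε, xu))
          (𝓝 (φ ε u)) :=
        (h.contMDiffAt hε hu).continuousAt.tendsto.comp (continuousAt_fst.tendsto.prodMk_nhds t2)
      filter_upwards [continuousAt_fst.tendsto.eventually (isOpen_Ioo.mem_nhds hε),
        continuousAt_snd.tendsto.eventually ((isOpen_extChartAt_target (I := I) u).mem_nhds hxu),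
        t2.eventually (h.isOpen.mem_nhds hu),
        t3.eventually ((isOpen_extChartAt_source (I := I) p).mem_nhds hs)] with z z1 z2 z3 z4
      exact hflow z z1 z2 z3 z4
    have hPε : DifferentiableAt ℝ Pc (c ε) :=
      (contDiffAt_chartField ht (hP _)).differentiableAt (by simp)
    have hXε : DifferentiableAt ℝ Xc (c ε) :=
      (contDiffAt_chartField ht (hX _)).differentiableAt (by simp)
    have h1 := hasDerivAt_fderiv_flow (P := Pc) (hsm.of_le (by simpa using minSmoothness_two_le_infty))
      (by rwa [hcflow]) hev A'
    have h2 := hXε.hasFDerivAt.comp_hasDerivAt ε hcε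
    have h3 := h1.sub h2
    rw [hcflow] at h3
    refine (h3.congr_deriv ?_).congr_of_eventuallyEq EventuallyEq.rfl
    have h4 : fderiv ℝ Pc (c ε) (Z ε) = fderiv ℝ Pc (c ε)
        (fderiv ℝ (chartFlow I φ u p) (ε, xu) (0, A')) - fderiv ℝ Pc (c ε) (Xc (c ε)) :=
      map_sub _ _ _
    rw [h4, lieBracket]
    abel
  have hw : ∀ᶠ ε in 𝓝 ε₀, K (c ε) (-lieBracket ℝ Pc Xc (c ε)) = 0 := by
    filter_upwards [hsrc, hIoo, hcc.eventually hK𝒟] with ε hs hε hKε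
    have ht : c ε ∈ e.target := e.map_source hs
    rw [map_neg, neg_eq_zero, hKε, ← chartField_mlieBracket ht hP hX, mfderiv_symm_chartField ht]
    have := hPX ε hε
    rwa [← e.left_inv hs] at this
  -- The bracket hypothesis concerns global sections; a local section agrees near the point with a
  -- global one, and the bracket sees only its germ.
  have hbr' : ∀ᶠ x in 𝓝 (e p), ∀ Z : E → E, (∀ᶠ y in 𝓝 x, ContDiffAt ℝ ∞ Z y) →
      (∀ᶠ y in 𝓝 x, K y (Z y) = 0) → K x (lieBracket ℝ Pc Z x) = 0 := by
    filter_upwards [hK𝒟.eventually_nhds, extChartAt_target_mem_nhds (I := I) p]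
      with x hx hxt Z hZ hZ0
    obtain ⟨Y, hY, hY𝒟, hYZ⟩ := exists_vectorField_of_chart hxt hZ (𝒟 := 𝒟) (by
      filter_upwards [hx, hZ0] with y hy hy0
      exact (hy _).1 hy0)
    have h1 : lieBracket ℝ Pc (chartField p Y) x = lieBracket ℝ Pc Z x :=
      Filter.EventuallyEq.lieBracket_vectorField_eq Filter.EventuallyEq.rfl hYZ
    rw [← h1, hx.self_of_nhds, ← chartField_mlieBracket hxt hP hY, mfderiv_symm_chartField hxt]
    exact hbr Y hY hY𝒟 _
  -- If `K Z` vanishes at `ε₀`, the differential equation keeps it zero nearby; if not, continuity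
  -- keeps it nonzero.
  by_cases h0 : K (c ε₀) (Z ε₀) = 0
  · have := eventually_mem_ker_of_linearized_flow hK (eventually_finrank_ker_eq hr hK𝒟)
      (hPd.of_le (by simp)) hbr' (c := c) (Z := Z) rfl hcd hZd hw h0
    filter_upwards [this, hZK] with ε h1 h2
    exact iff_of_true (hZK.self_of_nhds.1 h0) (h2.1 h1)
  · have hcont : ContinuousAt (fun ε => K (c ε) (Z ε)) ε₀ := by
      have h1 : ContinuousAt (fun ε => K (c ε)) ε₀ :=
        ContinuousAt.comp (f := c) (g := K) hK.self_of_nhds.continuousAt hcd.self_of_nhds.continuousAt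
      exact h1.clm_apply hZd.self_of_nhds.continuousAt
    filter_upwards [hcont.eventually_ne h0, hZK] with ε h1 h2
    exact iff_of_false (fun h3 => h0 (hZK.self_of_nhds.2 h3)) (fun h3 => h1 (h2.2 h3))

end IsSmoothLocalFlow

end FlowTransport

/-! ### Flow maps are injective local diffeomorphisms. -/

noncomputable section FlowDiffeomorphisms

open Filter VectorField Module

variable {E H M : Type*} [NormedAddCommGroup E] [NormedSpace ℝ E] [FiniteDimensional ℝ E]
  [TopologicalSpace H] {I : ModelWithCorners ℝ E H} [TopologicalSpace M] [ChartedSpace H M]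
  [IsManifold I ∞ M] [I.Boundaryless]

theorem isInvertible_of_injective {E : Type*} [NormedAddCommGroup E] [NormedSpace ℝ E]
    [FiniteDimensional ℝ E] (T : E →L[ℝ] E) (hT : Function.Injective T) : T.IsInvertible :=
  ⟨(LinearEquiv.ofInjectiveEndo T.toLinearMap hT).toContinuousLinearEquiv, rfl⟩

omit [FiniteDimensional ℝ E] in
-- Allows transport to be applied to the zero distribution, which yields injectivity of the
-- derivative of a flow without an inverse flow, for which a local flow need not have room.
theorem isSmoothDistribution_bot :
    IsSmoothDistribution E (fun u : M => (⊥ : Submodule ℝ (TangentSpace I u))) := by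
  refine ⟨⟨0, fun u => finrank_bot ℝ E⟩, fun p => ⟨fun _ => .id ℝ E, ?_, ?_⟩⟩
  · exact Eventually.of_forall fun x => contDiffAt_const
  · filter_upwards [extChartAt_target_mem_nhds (I := I) p] with x hx a
    constructor
    · intro h
      have h' : a = 0 := h
      rw [h']
      exact (map_zero (mfderiv 𝓘(ℝ, E) I (extChartAt I p).symm x))
    · intro h
      exact (isInvertible_mfderiv_extChartAt_symm (I := I) hx).injective
        (h.trans (map_zero (mfderiv 𝓘(ℝ, E) I (extChartAt I p).symm x)).symm)

/-- The inverse function theorem, on manifolds. -/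
theorem exists_local_inverse_of_isInvertible_mfderiv {f : M → M} {u : M}
    (hf : ContMDiffAt I I ∞ f u) (hf' : (mfderiv I I f u).IsInvertible) :
    ∃ g : M → M, ContMDiffAt I I ∞ g (f u) ∧ g (f u) = u ∧ ∀ᶠ w in 𝓝 (f u), f (g w) = w := by
  let F : E → E := writtenInExtChartAt I I u f
  have hFu : F (extChartAt I u u) = extChartAt I (f u) (f u) := by
    simp [F, writtenInExtChartAt]
  have hF : ContDiffAt ℝ ∞ F (extChartAt I u u) := by
    have := (contMDiffAt_iff.1 hf).2
    rwa [I.range_eq_univ, contDiffWithinAt_univ] at this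
  obtain ⟨T, hT⟩ : ∃ T : E ≃L[ℝ] E, (T : E →L[ℝ] E) = mfderiv I I f u := hf'
  have hd : HasFDerivAt F ((T : E ≃L[ℝ] E) : E →L[ℝ] E) (extChartAt I u u) := by
    have h1 : HasFDerivWithinAt F (T : E →L[ℝ] E) (range I) (extChartAt I u u) := by
      rw [hT]
      exact (hf.mdifferentiableAt (by simp)).hasMFDerivAt.2
    rwa [I.range_eq_univ, hasFDerivWithinAt_univ] at h1
  have hs := hF.hasStrictFDerivAt' hd (by simp)
  let G : E → E := hs.localInverse F T (extChartAt I u u)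
  have hG : ContDiffAt ℝ ∞ G (extChartAt I (f u) (f u)) := by
    rw [← hFu]
    exact hF.to_localInverse hd (by simp)
  have hGu : G (extChartAt I (f u) (f u)) = extChartAt I u u := by
    rw [← hFu]
    exact hs.localInverse_apply_image
  have hG' : Tendsto G (𝓝 (extChartAt I (f u) (f u))) (𝓝 (extChartAt I u u)) := by
    have := hG.continuousAt.tendsto
    rwa [hGu] at this
  have he : Tendsto (extChartAt I (f u)) (𝓝 (f u)) (𝓝 (extChartAt I (f u) (f u))) :=
    continuousAt_extChartAt (I := I) (f u)
  have hes : Tendsto (extChartAt I u).symm (𝓝 (extChartAt I u u)) (𝓝 u) := by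
    have := (contMDiffAt_extChartAt_symm' (mem_extChartAt_target (I := I) u)).continuousAt.tendsto
    rwa [extChartAt_to_inv] at this
  refine ⟨fun w => (extChartAt I u).symm (G (extChartAt I (f u) w)), ?_, ?_, ?_⟩
  · have h1 : ContMDiffAt 𝓘(ℝ, E) I ∞ (extChartAt I u).symm (G (extChartAt I (f u) (f u))) := by
      rw [hGu]
      exact contMDiffAt_extChartAt_symm' (mem_extChartAt_target u)
    exact h1.comp (f u) (hG.contMDiffAt.comp (f u) (contMDiffAt_extChartAt (n := ∞)))
  · simp only [hGu, extChartAt_to_inv]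
  · have h1 := hs.eventually_right_inverse
    rw [hFu] at h1
    have hgu : Tendsto (fun w => (extChartAt I u).symm (G (extChartAt I (f u) w))) (𝓝 (f u))
        (𝓝 u) := hes.comp (hG'.comp he)
    filter_upwards [he.eventually h1, extChartAt_source_mem_nhds (I := I) (f u),
      (hf.continuousAt.tendsto.comp hgu).eventually (extChartAt_source_mem_nhds (I := I) (f u))]
      with w hw1 hw2 hw3
    exact (extChartAt I (f u)).injOn hw3 hw2 hw1

theorem isOpen_image_of_isInvertible_mfderiv {f : M → M} {U : Set M} (hU : IsOpen U)
    (hf : ∀ u ∈ U, ContMDiffAt I I ∞ f u) (hf' : ∀ u ∈ U, (mfderiv I I f u).IsInvertible) :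
    IsOpen (f '' U) := by
  rw [isOpen_iff_mem_nhds]
  rintro _ ⟨u, hu, rfl⟩
  obtain ⟨g, hg, hgu, hfg⟩ := exists_local_inverse_of_isInvertible_mfderiv (hf u hu) (hf' u hu)
  have h1 : ∀ᶠ w in 𝓝 (f u), g w ∈ U :=
    hg.continuousAt.eventually (by rw [hgu]; exact hU.mem_nhds hu)
  filter_upwards [h1, hfg] with w h2 h3
  exact ⟨g w, h2, h3⟩

/-- The inverse function theorem supplies a smooth right inverse near `f u` with values in `U`; any
left inverse on `U` must agree with it there. -/
theorem contMDiffAt_of_leftInvOn {f g : M → M} {U : Set M} (hU : IsOpen U)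
    (hf : ∀ u ∈ U, ContMDiffAt I I ∞ f u) (hf' : ∀ u ∈ U, (mfderiv I I f u).IsInvertible)
    (hgf : LeftInvOn g f U) {u : M} (hu : u ∈ U) : ContMDiffAt I I ∞ g (f u) := by
  obtain ⟨g', hg, hgu, hfg⟩ := exists_local_inverse_of_isInvertible_mfderiv (hf u hu) (hf' u hu)
  have h1 : ∀ᶠ w in 𝓝 (f u), g' w ∈ U :=
    hg.continuousAt.eventually (by rw [hgu]; exact hU.mem_nhds hu)
  refine hg.congr_of_eventuallyEq ?_
  filter_upwards [h1, hfg] with w h2 h3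
  rw [← hgf h2, h3]

omit [FiniteDimensional ℝ E] [IsManifold I ∞ M] [I.Boundaryless] in
/-- The derivative of the inverse of a local diffeomorphism. -/
theorem mfderiv_leftInv_apply {f g : M → M} {u : M} (hf : MDifferentiableAt I I f u)
    (hg : MDifferentiableAt I I g (f u)) (hgf : ∀ᶠ w in 𝓝 u, g (f w) = w)
    (A : TangentSpace I u) : (mfderiv I I g (f u) (mfderiv I I f u A) : E) = A := by
  have h1 := mfderiv_comp u hg hf
  have h2 : g ∘ f =ᶠ[𝓝 u] id := hgf
  have h3 : HasMFDerivAt I I (g ∘ f) u (ContinuousLinearMap.id ℝ E) :=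
    (hasMFDerivAt_id u).congr_of_eventuallyEq h2
  rw [h3.mfderiv] at h1
  exact (congrArg (fun T : E →L[ℝ] E => T A) h1).symm

omit [FiniteDimensional ℝ E] [IsManifold I ∞ M] [I.Boundaryless] in
theorem isInvertible_mfderiv_leftInv {f g : M → M} {u : M} (hf : MDifferentiableAt I I f u)
    (hf' : (mfderiv I I f u).IsInvertible)
    (hg : MDifferentiableAt I I g (f u)) (hgf : ∀ᶠ w in 𝓝 u, g (f w) = w) :
    (mfderiv I I g (f u)).IsInvertible := by
  obtain ⟨T, hT⟩ := hf'
  refine ⟨(T.symm : E ≃L[ℝ] E), ?_⟩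
  refine ContinuousLinearMap.ext fun A : E => ?_
  have h := mfderiv_leftInv_apply hf hg hgf (T.symm A)
  rw [← hT] at h
  exact (h.symm.trans (congrArg (fun v : E => (mfderiv I I g (f u) v : E)) (T.apply_symm_apply A)))

namespace IsSmoothLocalFlow

variable {P : (u : M) → TangentSpace I u} {a b : ℝ} {U : Set M} {φ : ℝ → M → M}

omit [FiniteDimensional ℝ E] [I.Boundaryless] [IsManifold I ∞ M] in
theorem mfderiv_zero (h : IsSmoothLocalFlow I P a b U φ) {u : M} (hu : u ∈ U)
    (A : TangentSpace I u) : (mfderiv I I (φ 0) u A : E) = A := by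
  have h2 : φ 0 =ᶠ[𝓝 u] id := by
    filter_upwards [h.isOpen.mem_nhds hu] with w hw
    exact h.zero w hw
  have h3 : HasMFDerivAt I I (φ 0) u (ContinuousLinearMap.id ℝ E) :=
    (hasMFDerivAt_id u).congr_of_eventuallyEq h2
  rw [h3.mfderiv]
  rfl

omit [FiniteDimensional ℝ E] [I.Boundaryless] in
theorem isSmoothVF_zero : IsSmoothVF I (fun _ => 0 : (u : M) → TangentSpace I u) :=
  Bundle.contMDiff_zeroSection ℝ (TangentSpace I : M → Type _)

/-- The maps of a smooth flow are local diffeomorphisms. -/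
theorem isInvertible_mfderiv [T2Space M] (h : IsSmoothLocalFlow I P a b U φ)
    (hP : IsSmoothVF I P) {u : M} (hu : u ∈ U) {ε : ℝ} (hε : ε ∈ Ioo a b) :
    (mfderiv I I (φ ε) u).IsInvertible := by
  have hinj : Function.Injective (mfderiv I I (φ ε) u : E →L[ℝ] E) := by
    rw [injective_iff_map_eq_zero]
    intro A hA
    -- Transport with zero distribution and `X = 0`: the image of `A` vanishes at `ε` if and only if
    -- it vanishes at `0`, where it is `A` itself.
    have h1 := h.mem_distribution hP isSmoothDistribution_bot (by
      intro Z _ hZ w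
      have : Z = 0 := funext hZ
      rw [this, mlieBracket_zero_right]
      exact Submodule.zero_mem _) hu (A : TangentSpace I u) isSmoothVF_zero (by
      intro ε _
      have : (fun _ => 0 : (u : M) → TangentSpace I u) = 0 := rfl
      rw [this, mlieBracket_zero_right]
      exact Submodule.zero_mem _) hε h.zero_mem
    have h2 := h1.1 (by
      refine (sub_zero (G := E) _).trans ?_
      exact hA)
    have h3 : (mfderiv I I (φ 0) u A : E) = 0 := (sub_zero (G := E) _).symm.trans h2
    rwa [h.mfderiv_zero hu] at h3
  exact isInvertible_of_injective (E := E) (mfderiv I I (φ ε) u) hinj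

omit [FiniteDimensional ℝ E] in
-- Two flow lines that meet at the parameter `ε` are integral curves of the same field, so they
-- agree on all of `(a, b)`, in particular at `0`.
theorem injOn [T2Space M] (h : IsSmoothLocalFlow I P a b U φ) (hP : IsSmoothVF I P) {ε : ℝ}
    (hε : ε ∈ Ioo a b) : InjOn (φ ε) U := by
  intro u hu w hw huw
  have h1 := isMIntegralCurveOn_Ioo_eqOn_of_contMDiff_boundaryless hε
    (hP.of_le (by simp)) (h.curve u hu) (h.curve w hw) huw
  have h2 : φ 0 u = φ 0 w := h1 h.zero_mem
  rwa [h.zero u hu, h.zero w hw] at h2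

theorem isOpen_image [T2Space M] (h : IsSmoothLocalFlow I P a b U φ) (hP : IsSmoothVF I P) {ε : ℝ}
    (hε : ε ∈ Ioo a b) : IsOpen (φ ε '' U) :=
  isOpen_image_of_isInvertible_mfderiv h.isOpen (fun _ hu => h.contMDiffAt_map hε hu)
    fun _ hu => h.isInvertible_mfderiv hP hu hε

end IsSmoothLocalFlow

end FlowDiffeomorphisms

/-! ### Regular zero sets, their tangent vectors and their invariance under flows. -/

noncomputable section ZeroSets

open Filter VectorField Module

/-- A proper range would be annihilated by a nonzero functional on `ι → ℝ`, whose coordinates are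
the coefficients of a linear relation among the `γ i`. -/
theorem range_pi_eq_top_of_linearIndependent {E ι : Type*} [NormedAddCommGroup E] [NormedSpace ℝ E]
    [Fintype ι] {γ : ι → E →L[ℝ] ℝ} (h : LinearIndependent ℝ γ) :
    (ContinuousLinearMap.pi γ).range = ⊤ := by
  classical
  by_contra hne
  obtain ⟨c, hc0, hc⟩ := Submodule.exists_le_ker_of_lt_top _ (lt_top_iff_ne_top.2 hne)
  have hcs : ∀ v : ι → ℝ, c v = ∑ i, v i * c (Pi.single i 1) := by
    intro v
    conv_lhs => rw [← Finset.univ_sum_single v]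
    rw [map_sum]
    refine Finset.sum_congr rfl fun i _ => ?_
    rw [← smul_eq_mul, ← map_smul, ← Pi.single_smul]
    simp
  have hsum : ∑ i, c (Pi.single i 1) • γ i = 0 := by
    ext A
    have h1 : c (ContinuousLinearMap.pi γ A) = 0 := hc ⟨A, rfl⟩
    rw [hcs] at h1
    simpa [mul_comm] using h1
  have h2 := Fintype.linearIndependent_iff.1 h _ hsum
  apply hc0
  refine LinearMap.ext fun v => ?_
  simp [hcs v, h2]

/-- Near `x₀` the function `g` is bounded by a multiple of `f`, and `f` is `o(t)` along the line `x₀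
+ t A`; so `g` is `o(t)` too. No curve inside the zero set is needed. -/
theorem eq_zero_of_hasStrictFDerivAt_of_zeroSet {E F : Type*} [NormedAddCommGroup E]
    [NormedSpace ℝ E] [NormedAddCommGroup F] [NormedSpace ℝ F] [CompleteSpace E] [CompleteSpace F]
    {f : E → F} {g : E → ℝ} {f' : E →L[ℝ] F} {g' : E →L[ℝ] ℝ} {x₀ : E}
    (hf : HasStrictFDerivAt f f' x₀) (hf' : f'.range = ⊤) (hg : HasStrictFDerivAt g g' x₀)
    (h0 : f x₀ = 0) (hfg : ∀ᶠ x in 𝓝 x₀, f x = 0 → g x = 0) {A : E} (hA : f' A = 0) :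
    g' A = 0 := by
  obtain ⟨C, hC⟩ := eventually_norm_le_of_eq_zero hf hf' hg h0 hfg
  have hl : HasDerivAt (fun t : ℝ => x₀ + t • A) A 0 := by
    simpa using ((hasDerivAt_id (0 : ℝ)).smul_const A).const_add x₀
  have hl0 : x₀ + (0 : ℝ) • A = x₀ := by simp
  have h1 : HasDerivAt (fun t : ℝ => f (x₀ + t • A)) 0 0 := by
    rw [← hA]
    exact HasFDerivAt.comp_hasDerivAt (0 : ℝ) (by rw [hl0]; exact hf.hasFDerivAt) hl
  have h2 : HasDerivAt (fun t : ℝ => g (x₀ + t • A)) (g' A) 0 :=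
    HasFDerivAt.comp_hasDerivAt (0 : ℝ) (by rw [hl0]; exact hg.hasFDerivAt) hl
  have hg0 : g x₀ = 0 := hfg.self_of_nhds h0
  have h3 : HasDerivAt (fun t : ℝ => g (x₀ + t • A)) 0 0 := by
    rw [hasDerivAt_iff_isLittleO] at h1 ⊢
    simp only [hl0, hg0, h0, sub_zero, smul_zero] at h1 ⊢
    refine Asymptotics.IsBigO.trans_isLittleO ?_ h1
    refine Asymptotics.IsBigO.of_bound C ?_
    have := hl.continuousAt.tendsto
    rw [hl0] at this
    exact this.eventually hC
  exact h2.unique h3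

variable {E H M : Type*} [NormedAddCommGroup E] [NormedSpace ℝ E] [FiniteDimensional ℝ E]
  [TopologicalSpace H] {I : ModelWithCorners ℝ E H} [TopologicalSpace M] [ChartedSpace H M]
  [IsManifold I ∞ M] [I.Boundaryless]

omit [FiniteDimensional ℝ E] in
theorem hasStrictFDerivAt_comp_extChartAt_symm {f : M → ℝ} {p : M}
    (hf : ContMDiffAt I 𝓘(ℝ, ℝ) ∞ f p) :
    HasStrictFDerivAt (f ∘ (extChartAt I p).symm) (mfderiv I 𝓘(ℝ, ℝ) f p : E →L[ℝ] ℝ)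
      (extChartAt I p p) := by
  have h1 : ContDiffAt ℝ ∞ (f ∘ (extChartAt I p).symm) (extChartAt I p p) :=
    contDiffAt_comp_extChartAt_symm (mem_extChartAt_target p) (by rwa [extChartAt_to_inv])
  have h2 : (mfderiv I 𝓘(ℝ, ℝ) f p : E →L[ℝ] ℝ)
      = fderiv ℝ (f ∘ (extChartAt I p).symm) (extChartAt I p p) := by
    refine ContinuousLinearMap.ext fun A : E => ?_
    exact vfDeriv_eq_fderiv (hf.mdifferentiableAt (by simp)) (fun _ => A)
  rw [h2]
  exact h1.hasStrictFDerivAt (by simp)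

/-- A function that vanishes on the zero set of independent functions has a differential that
vanishes on the tangent space of the zero set. -/
theorem mfderiv_eq_zero_of_zeroSet {ι : Type*} [Fintype ι] {γ : ι → M → ℝ} {f : M → ℝ} {p : M}
    (hγ : ∀ i, ContMDiffAt I 𝓘(ℝ, ℝ) ∞ (γ i) p)
    (hli : LinearIndependent (M := E →L[ℝ] ℝ) ℝ (fun i => mfderiv I 𝓘(ℝ, ℝ) (γ i) p))
    (h0 : ∀ i, γ i p = 0) (hf : ContMDiffAt I 𝓘(ℝ, ℝ) ∞ f p)
    (hγf : ∀ᶠ w in 𝓝 p, (∀ i, γ i w = 0) → f w = 0) {A : TangentSpace I p}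
    (hA : ∀ i, (mfderiv I 𝓘(ℝ, ℝ) (γ i) p A : ℝ) = 0) :
    (mfderiv I 𝓘(ℝ, ℝ) f p A : ℝ) = 0 := by
  have hes : Tendsto (extChartAt I p).symm (𝓝 (extChartAt I p p)) (𝓝 p) := by
    have := (contMDiffAt_extChartAt_symm' (mem_extChartAt_target (I := I) p)).continuousAt.tendsto
    rwa [extChartAt_to_inv] at this
  refine eq_zero_of_hasStrictFDerivAt_of_zeroSet (E := E)
    (hasStrictFDerivAt_pi.2 fun i => hasStrictFDerivAt_comp_extChartAt_symm (hγ i))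
    (range_pi_eq_top_of_linearIndependent hli) (hasStrictFDerivAt_comp_extChartAt_symm hf) ?_ ?_
    (funext hA)
  · funext i
    simp [h0]
  · filter_upwards [hes.eventually hγf] with x hx h
    exact hx fun i => congrFun h i

/-- A closed set that is locally the common zero set of independent functions, with differentials
that vanish on `P` along the set, is invariant under the flow of `P`. -/
theorem IsMIntegralCurveOn.mem_zeroSet_iff {P : (u : M) → TangentSpace I u} (hP : IsSmoothVF I P)
    {S : Set M} (hS : IsClosed S)
    (hγ : ∀ p ∈ S, ∃ (k : ℕ) (γ : Fin k → M → ℝ), (∀ i, ContMDiff I 𝓘(ℝ, ℝ) ∞ (γ i)) ∧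
      LinearIndependent (M := E →L[ℝ] ℝ) ℝ (fun i => mfderiv I 𝓘(ℝ, ℝ) (γ i) p) ∧
      (∀ i, ∀ w ∈ S, γ i w = 0 ∧ vfDeriv I P (γ i) w = 0) ∧
      ∀ᶠ w in 𝓝 p, (∀ i, γ i w = 0) → w ∈ S)
    {c : ℝ → M} {a b : ℝ} (hc : IsMIntegralCurveOn (I := I) c P (Ioo a b)) {s t : ℝ}
    (hs : s ∈ Ioo a b) (ht : t ∈ Ioo a b) : c s ∈ S ↔ c t ∈ S := by
  refine (isPreconnected_Ioo (a := a) (b := b)).induction₂ (fun s t => c s ∈ S ↔ c t ∈ S) ?_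
    (fun _ _ _ _ _ _ h h' => h.trans h') (fun _ _ _ _ h => h.symm) hs ht
  intro t₀ ht₀
  apply Filter.Eventually.filter_mono nhdsWithin_le_nhds
  have hd : ∀ t ∈ Ioo a b, HasMFDerivAt 𝓘(ℝ, ℝ) I c t ((1 : ℝ →L[ℝ] ℝ).smulRight (P (c t))) :=
    fun t ht => (hc t ht).hasMFDerivAt (isOpen_Ioo.mem_nhds ht)
  have hcont : ContinuousAt c t₀ := (hd t₀ ht₀).continuousAt
  by_cases h0 : c t₀ ∈ S
  swap
  · filter_upwards [hcont.eventually (hS.isOpen_compl.mem_nhds h0)] with t h1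
    exact iff_of_false h0 h1
  obtain ⟨k, γ, hγs, hli, hγ0, hγS⟩ := hγ _ h0
  have hPγ : ∀ i, ContMDiff I 𝓘(ℝ, ℝ) ∞ (vfDeriv I P (γ i)) := fun i =>
    ContMDiff.vfDeriv hP (hγs i)
  have hes : Tendsto (extChartAt I (c t₀)).symm (𝓝 (extChartAt I (c t₀) (c t₀))) (𝓝 (c t₀)) := by
    have := (contMDiffAt_extChartAt_symm'
      (mem_extChartAt_target (I := I) (c t₀))).continuousAt.tendsto
    rwa [extChartAt_to_inv] at this
  -- The functions `P γ i` vanish on `S`, which contains the local common zero set of the `γ i`, so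
  -- they are bounded by a multiple of `γ`.
  obtain ⟨C, hC⟩ := eventually_norm_le_of_eq_zero (E := E)
    (hasStrictFDerivAt_pi.2 fun i => hasStrictFDerivAt_comp_extChartAt_symm (hγs i (c t₀)))
    (range_pi_eq_top_of_linearIndependent hli)
    (hasStrictFDerivAt_pi.2 fun i => hasStrictFDerivAt_comp_extChartAt_symm (hPγ i (c t₀)))
    (by funext i; simp [(hγ0 i _ h0).1])
    (by
      filter_upwards [hes.eventually hγS] with x hx h
      funext i
      exact (hγ0 i _ (hx fun i => congrFun h i)).2)
  have hy : ∀ᶠ t in 𝓝 t₀, HasDerivAt (fun t i => γ i (c t)) (fun i => vfDeriv I P (γ i) (c t)) t := by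
    filter_upwards [isOpen_Ioo.mem_nhds ht₀] with t ht
    refine hasDerivAt_pi.2 fun i => ?_
    have h1 := HasMFDerivAt.comp t ((hγs i (c t)).mdifferentiableAt (by simp)).hasMFDerivAt (hd t ht)
    have h2 : HasFDerivAt (fun t => γ i (c t)) ((mfderiv I 𝓘(ℝ, ℝ) (γ i) (c t) : E →L[ℝ] ℝ).comp
      ((1 : ℝ →L[ℝ] ℝ).smulRight (P (c t) : E))) t := h1.hasFDerivAt
    rw [hasDerivAt_iff_hasFDerivAt]
    refine h2.congr_fderiv ?_
    apply ContinuousLinearMap.ext_ring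
    refine Eq.trans ?_ (one_smul ℝ _).symm
    exact congrArg (fun v : E => (mfderiv I 𝓘(ℝ, ℝ) (γ i) (c t) v : ℝ)) (one_smul ℝ (P (c t) : E))
  -- Along the curve the derivative of `γ` is `P γ`, so this bound is a Gronwall inequality: `γ`
  -- stays zero near `t₀`.
  have h1 := eventually_eq_zero_of_norm_deriv_le (C := C) hy (by
    have he : Tendsto (fun t => extChartAt I (c t₀) (c t)) (𝓝 t₀)
        (𝓝 (extChartAt I (c t₀) (c t₀))) :=
      Tendsto.comp (continuousAt_extChartAt (I := I) (c t₀)) hcont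
    filter_upwards [he.eventually hC, hcont.eventually
      (extChartAt_source_mem_nhds (I := I) (c t₀))] with t h1 h2
    simpa only [Function.comp_apply, (extChartAt I (c t₀)).left_inv h2] using h1) (funext fun i => (hγ0 i _ h0).1)
  filter_upwards [h1, hcont.eventually hγS] with t h2 h3
  exact iff_of_true h0 (h3 fun i => congrFun h2 i)

end ZeroSets

/-! ### Charts of the tangent bundle. -/

noncomputable section TangentBundleCharts

open Filter VectorField Module Bundle

variable {E H M : Type*} [NormedAddCommGroup E] [NormedSpace ℝ E]
  [TopologicalSpace H] {I : ModelWithCorners ℝ E H} [TopologicalSpace M] [ChartedSpace H M]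
  [IsManifold I ∞ M]

/-- Points over different base points are separated in the base, points of one fibre within a
trivialization. The Hausdorff property of `TQ` is needed for cut-offs and for uniqueness of integral
curves. -/
theorem t2Space_totalSpace {B F : Type*} [TopologicalSpace B] [TopologicalSpace F] [T2Space B]
    [T2Space F] (V : B → Type*) [∀ b, TopologicalSpace (V b)] [TopologicalSpace (TotalSpace F V)]
    [FiberBundle F V] : T2Space (TotalSpace F V) := by
  refine ⟨fun x y hxy => ?_⟩
  by_cases h : x.proj = y.proj
  · let e := trivializationAt F V x.proj
    have hx : x ∈ e.source := FiberBundle.mem_trivializationAt_proj_source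
    have hy : y ∈ e.source := by
      rw [e.mem_source, ← h]
      exact FiberBundle.mem_baseSet_trivializationAt' x.proj
    have hne : e x ≠ e y := fun h' => hxy (e.injOn hx hy h')
    obtain ⟨s, t, hs, ht, hxs, hyt, hst⟩ := t2_separation hne
    refine ⟨e.source ∩ e ⁻¹' s, e.source ∩ e ⁻¹' t, ?_, ?_, ⟨hx, hxs⟩, ⟨hy, hyt⟩, ?_⟩
    · exact e.toOpenPartialHomeomorph.isOpen_inter_preimage hs
    · exact e.toOpenPartialHomeomorph.isOpen_inter_preimage ht
    · exact (hst.preimage e).mono inter_subset_right inter_subset_right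
  · obtain ⟨s, t, hs, ht, hxs, hyt, hst⟩ := t2_separation h
    exact ⟨_, _, hs.preimage (FiberBundle.continuous_proj F V),
      ht.preimage (FiberBundle.continuous_proj F V), hxs, hyt, hst.preimage _⟩

instance [T2Space M] : T2Space (TangentBundle I M) := t2Space_totalSpace (F := E) (TangentSpace I)

theorem mem_extChartAt_tangent_target {u : TangentBundle I M} {z : E × E} :
    z ∈ (extChartAt I.tangent u).target ↔ z.1 ∈ (extChartAt I u.1).target := by
  rw [FiberBundle.extChartAt_target]
  simp only [mem_prod, mem_inter_iff, mem_univ, and_true, and_iff_left_iff_imp]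
  intro h
  have := (extChartAt I u.1).map_target h
  rwa [extChartAt_source] at this

theorem extChartAt_tangent_fst (u w : TangentBundle I M) :
    (extChartAt I.tangent u w).1 = extChartAt I u.1 w.1 := rfl

variable [I.Boundaryless]

/-- The charts of the tangent bundle are the derivatives of the charts of the manifold. -/
theorem extChartAt_tangent_symm_apply {u : TangentBundle I M} {x : E}
    (hx : x ∈ (extChartAt I u.1).target) (y : E) :
    (extChartAt I.tangent u).symm (x, y) = (⟨(extChartAt I u.1).symm x,
      mfderiv 𝓘(ℝ, E) I (extChartAt I u.1).symm x y⟩ : TangentBundle I M) := by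
  have hs := (extChartAt I u.1).map_target hx
  rw [extChartAt_source] at hs
  have h1 : (extChartAt I.tangent u).symm (x, y)
      = (trivializationAt E (TangentSpace I) u.1).toPartialEquiv.symm
        ((extChartAt I u.1).symm x, y) := by
    rw [FiberBundle.extChartAt]
    rfl
  have : IsManifold I 1 M := .of_le (n := ∞) (by simp)
  have h2 := TangentBundle.symmL_trivializationAt (I := I) hs
  rw [(extChartAt I u.1).right_inv hx, I.range_eq_univ, mfderivWithin_univ] at h2
  rw [h1, ← h2]
  refine ((trivializationAt E (TangentSpace I) u.1).mk_symm hs y).symm.trans ?_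
  exact congrArg (fun v => (⟨(extChartAt I u.1).symm x, v⟩ : TangentBundle I M))
    ((trivializationAt E (TangentSpace I) u.1).symmL_apply (R := ℝ) hs y).symm

theorem extChartAt_tangent_self (u : TangentBundle I M) :
    extChartAt I.tangent u u = (extChartAt I u.1 u.1, u.2) := by
  have h1 : ∀ q v, q = u.1 → (v : E) = u.2 → (⟨q, v⟩ : TangentBundle I M) = u := by
    rintro q v rfl rfl
    rfl
  have h2 : ∀ y : E, y = u.2 → (extChartAt I.tangent u).symm (extChartAt I u.1 u.1, y) = u := by
    intro y hy
    rw [extChartAt_tangent_symm_apply (mem_extChartAt_target (I := I) u.1) y]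
    exact h1 _ _ (extChartAt_to_inv u.1) ((mfderiv_extChartAt_symm_self u.1 y).trans hy)
  exact (congrArg (extChartAt I.tangent u) (h2 u.2 rfl)).symm.trans
    ((extChartAt I.tangent u).right_inv
      (mem_extChartAt_tangent_target.2 (mem_extChartAt_target u.1)))

theorem mfderiv_proj_extChartAt_symm {u : TangentBundle I M} {z : E × E}
    (hz : z ∈ (extChartAt I.tangent u).target) (A : E × E) :
    (mfderiv I.tangent I (fun w : TangentBundle I M => w.1) ((extChartAt I.tangent u).symm z)
      (mfderiv 𝓘(ℝ, E × E) I.tangent (extChartAt I.tangent u).symm z A) : E)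
      = mfderiv 𝓘(ℝ, E) I (extChartAt I u.1).symm z.1 A.1 := by
  have hx : z.1 ∈ (extChartAt I u.1).target := mem_extChartAt_tangent_target.1 hz
  have hp : MDifferentiableAt I.tangent I (fun w : TangentBundle I M => w.1)
      ((extChartAt I.tangent u).symm z) :=
    (contMDiff_proj (TangentSpace I : M → Type _) (n := ∞)).mdifferentiable (by simp) _
  have h1 := mfderiv_comp z hp
    ((contMDiffAt_extChartAt_symm' (I := I.tangent) hz).mdifferentiableAt (by simp))
  have h2 := mfderiv_comp (I := 𝓘(ℝ, E × E)) z (f := (Prod.fst : E × E → E))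
    ((contMDiffAt_extChartAt_symm' (I := I) hx).mdifferentiableAt (by simp))
    (differentiableAt_fst.mdifferentiableAt)
  have h3 : (fun w : TangentBundle I M => w.1) ∘ (extChartAt I.tangent u).symm
      =ᶠ[𝓝 z] (extChartAt I u.1).symm ∘ Prod.fst := by
    filter_upwards [(isOpen_extChartAt_target (I := I.tangent) u).mem_nhds hz] with z' hz'
    rw [Function.comp_apply, ← Prod.mk.eta (p := z'),
      extChartAt_tangent_symm_apply (mem_extChartAt_tangent_target.1 hz')]
    rfl
  have h4 := h3.mfderiv_eq (I := 𝓘(ℝ, E × E)) (I' := I)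
  have h5 : (mfderiv 𝓘(ℝ, E × E) 𝓘(ℝ, E) (Prod.fst : E × E → E) z A : E) = A.1 := by
    rw [mfderiv_eq_fderiv, fderiv_fst]
    rfl
  have h6 := congrArg (fun T : E × E →L[ℝ] E => T A) (h1.symm.trans (h4.trans h2))
  refine h6.trans ?_
  exact congrArg (fun v : E => (mfderiv 𝓘(ℝ, E) I (extChartAt I u.1).symm z.1 v : E)) h5

/-- In the identification of `T_u(TQ)` with a product by the chart at `u`, the bundle projection is
the first projection, so vertical vectors are the pairs `(0, w)`. -/
theorem mfderiv_proj_apply (u : TangentBundle I M) (A : TangentSpace I.tangent u) :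
    (mfderiv I.tangent I (fun w : TangentBundle I M => w.1) u A : E) = (A : E × E).1 := by
  have h := mfderiv_proj_extChartAt_symm (mem_extChartAt_target (I := I.tangent) u) (A : E × E)
  have h1 := mfderiv_extChartAt_symm_self (I := I.tangent) u (A : E × E)
  rw [extChartAt_tangent_fst, mfderiv_extChartAt_symm_self] at h
  have h2 : ∀ (w : TangentBundle I M) (B : TangentSpace I.tangent w), w = u → (B : E × E) = A →
      (mfderiv I.tangent I (fun w : TangentBundle I M => w.1) u A : E)
        = mfderiv I.tangent I (fun w : TangentBundle I M => w.1) w B := by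
    rintro w B rfl rfl
    rfl
  exact (h2 _ _ (extChartAt_to_inv u) h1).trans h

end TangentBundleCharts

/-! ### Coordinate expressions of the fibre derivative, energy, `θ_L` and `Ω_L`. -/

noncomputable section LagrangianForms

open Filter VectorField Module Bundle

variable {D : ℕ} {Q : Type*} [TopologicalSpace Q] [ChartedSpace (CoordSpace D) Q]
  [IsManifold (𝓡 D) ∞ Q]

/-- The Lagrangian, in the chart at `u`. -/
def chartLagrangian (L : VelPhase D Q → ℝ) (u : VelPhase D Q) :
    CoordSpace D × CoordSpace D → ℝ :=
  L ∘ (extChartAt (velModel D) u).symm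

variable {L : VelPhase D Q → ℝ}

theorem contDiffAt_chartLagrangian (hL : ContMDiff (velModel D) 𝓘(ℝ, ℝ) ∞ L) {u : VelPhase D Q}
    {z : CoordSpace D × CoordSpace D} (hz : z ∈ (extChartAt (velModel D) u).target) :
    ContDiffAt ℝ ∞ (chartLagrangian L u) z :=
  contDiffAt_comp_extChartAt_symm hz (hL _)

theorem extChartAt_symm_self_mk (q : Q) (v w : CoordSpace D) :
    (extChartAt (velModel D) (⟨q, v⟩ : VelPhase D Q)).symm (extChartAt (𝓡 D) q q, w)
      = (⟨q, w⟩ : VelPhase D Q) := by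
  have h1 : ∀ (q' : Q) (v' : CoordSpace D), q' = q → v' = w →
      (⟨q', v'⟩ : VelPhase D Q) = ⟨q, w⟩ := by
    rintro q' v' rfl rfl
    rfl
  exact (extChartAt_tangent_symm_apply (u := (⟨q, v⟩ : VelPhase D Q)) (mem_extChartAt_target q)
    w).trans (h1 _ _ (extChartAt_to_inv q) (mfderiv_extChartAt_symm_self q w))

theorem contDiff_fibre (hL : ContMDiff (velModel D) 𝓘(ℝ, ℝ) ∞ L) (q : Q) :
    ContDiff ℝ ∞ (fun w : CoordSpace D => L ⟨q, w⟩) := by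
  have h1 : (fun w : CoordSpace D => L ⟨q, w⟩)
      = chartLagrangian L ⟨q, (0 : CoordSpace D)⟩ ∘ fun w => (extChartAt (𝓡 D) q q, w) := by
    funext w
    exact congrArg L (extChartAt_symm_self_mk q 0 w).symm
  rw [h1, contDiff_iff_contDiffAt]
  intro w
  exact (contDiffAt_chartLagrangian hL (mem_extChartAt_tangent_target.2
    (mem_extChartAt_target q))).comp w (contDiffAt_const.prodMk contDiffAt_id)

/-- The inverse chart of `TQ` is linear on fibres, given there by the derivative of the inverse base
chart, so this is the chain rule along a fibre. -/
theorem fibreDer_extChartAt_symm (hL : ContMDiff (velModel D) 𝓘(ℝ, ℝ) ∞ L) {u : VelPhase D Q}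
    {z : CoordSpace D × CoordSpace D} (hz : z ∈ (extChartAt (velModel D) u).target)
    (a : CoordSpace D) :
    fibreDer L ((extChartAt (velModel D) u).symm z)
      (mfderiv 𝓘(ℝ, CoordSpace D) (𝓡 D) (extChartAt (𝓡 D) u.1).symm z.1 a)
      = fderiv ℝ (chartLagrangian L u) z (0, a) := by
  have hx := mem_extChartAt_tangent_target.1 hz
  let q := (extChartAt (𝓡 D) u.1).symm z.1
  let B : CoordSpace D →L[ℝ] CoordSpace D :=
    mfderiv 𝓘(ℝ, CoordSpace D) (𝓡 D) (extChartAt (𝓡 D) u.1).symm z.1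
  have h1 : ∀ y, (extChartAt (velModel D) u).symm (z.1, y) = (⟨q, B y⟩ : VelPhase D Q) :=
    extChartAt_tangent_symm_apply hx
  have h2 : (chartLagrangian L u ∘ fun y => (z.1, y)) = (fun w : CoordSpace D => L ⟨q, w⟩) ∘ B := by
    funext y
    exact congrArg L (h1 y)
  have h3 : HasFDerivAt (chartLagrangian L u ∘ fun y => (z.1, y))
      ((fderiv ℝ (chartLagrangian L u) z).comp (.inr ℝ _ _)) z.2 :=
    ((contDiffAt_chartLagrangian hL hz).differentiableAt (by simp)).hasFDerivAt.comp z.2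
      (hasFDerivAt_prodMk_right z.1 z.2)
  have h4 : HasFDerivAt ((fun w : CoordSpace D => L ⟨q, w⟩) ∘ B)
      ((fderiv ℝ (fun w : CoordSpace D => L ⟨q, w⟩) (B z.2)).comp B) z.2 :=
    ((contDiff_fibre hL q).differentiable (by simp) _).hasFDerivAt.comp z.2 B.hasFDerivAt
  rw [← h2] at h4
  have h5 := congrArg (fun T : CoordSpace D →L[ℝ] ℝ => T a) (h3.unique h4)
  have h6 : fibreDer L ((extChartAt (velModel D) u).symm z)
      = fderiv ℝ (fun w : CoordSpace D => L ⟨q, w⟩) (B z.2) := by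
    rw [← Prod.mk.eta (p := z), h1]
    rfl
  rw [h6]
  exact h5.symm

theorem fibreDer_apply (hL : ContMDiff (velModel D) 𝓘(ℝ, ℝ) ∞ L) (u : VelPhase D Q)
    (w a : CoordSpace D) :
    fibreDer L ⟨u.1, w⟩ a = fderiv ℝ (chartLagrangian L u) (extChartAt (𝓡 D) u.1 u.1, w) (0, a) := by
  have h := fibreDer_extChartAt_symm hL (u := u) (z := (extChartAt (𝓡 D) u.1 u.1, w))
    (mem_extChartAt_tangent_target.2 (mem_extChartAt_target u.1)) a
  rw [← h]
  refine Eq.trans ?_ (congrArg _ (mfderiv_extChartAt_symm_self u.1 a)).symm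
  rw [← extChartAt_symm_self_mk u.1 u.2 w]

/-- The restriction of a covector on `ℝ^D × ℝ^D` to the second factor, pulled back by the first
projection. -/
def verticalLift (D : ℕ) : (CoordSpace D × CoordSpace D →L[ℝ] ℝ) →L[ℝ]
    (CoordSpace D × CoordSpace D →L[ℝ] ℝ) :=
  (ContinuousLinearMap.compL ℝ (CoordSpace D × CoordSpace D) (CoordSpace D × CoordSpace D) ℝ).flip
    ((ContinuousLinearMap.inr ℝ _ _).comp (ContinuousLinearMap.fst ℝ _ _))

theorem verticalLift_apply (T : CoordSpace D × CoordSpace D →L[ℝ] ℝ)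
    (A : CoordSpace D × CoordSpace D) : verticalLift D T A = T (0, A.1) := rfl

theorem thetaL_chart (hL : ContMDiff (velModel D) 𝓘(ℝ, ℝ) ∞ L) (u : VelPhase D Q) :
    (fun x => (thetaL L ((extChartAt (velModel D) u).symm x)).comp
      (mfderiv 𝓘(ℝ, CoordSpace D × CoordSpace D) (velModel D) (extChartAt (velModel D) u).symm x) :
      CoordSpace D × CoordSpace D → (CoordSpace D × CoordSpace D →L[ℝ] ℝ))
      =ᶠ[𝓝 (extChartAt (velModel D) u u)]
    fun x => verticalLift D (fderiv ℝ (chartLagrangian L u) x) := by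
  filter_upwards [extChartAt_target_mem_nhds (I := velModel D) u] with z hz
  refine ContinuousLinearMap.ext fun A => ?_
  rw [verticalLift_apply, ← fibreDer_extChartAt_symm hL hz]
  exact congrArg (fibreDer L ((extChartAt (velModel D) u).symm z))
    (mfderiv_proj_extChartAt_symm hz A)

theorem contDiffAt_verticalLift_fderiv (hL : ContMDiff (velModel D) 𝓘(ℝ, ℝ) ∞ L) {u : VelPhase D Q}
    {z : CoordSpace D × CoordSpace D} (hz : z ∈ (extChartAt (velModel D) u).target) :
    ContDiffAt ℝ ∞ (fun x => verticalLift D (fderiv ℝ (chartLagrangian L u) x)) z :=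
  (verticalLift D).contDiff.contDiffAt.comp z
    ((contDiffAt_chartLagrangian hL hz).fderiv_right (m := ∞) (by simp))

/-- In the chart, `θ_L` is a fixed linear map applied to the differential of the Lagrangian; hence
`Ω_L` is an antisymmetrized second derivative. -/
theorem omegaL_apply (hL : ContMDiff (velModel D) 𝓘(ℝ, ℝ) ∞ L) (u : VelPhase D Q)
    (A B : CoordSpace D × CoordSpace D) :
    omegaL L u A B
      = fderiv ℝ (fderiv ℝ (chartLagrangian L u)) (extChartAt (velModel D) u u) B (0, A.1)
        - fderiv ℝ (fderiv ℝ (chartLagrangian L u)) (extChartAt (velModel D) u u) A (0, B.1) := by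
  have hd : HasFDerivAt (fderiv ℝ (chartLagrangian L u))
      (fderiv ℝ (fderiv ℝ (chartLagrangian L u)) (extChartAt (velModel D) u u))
      (extChartAt (velModel D) u u) :=
    (((contDiffAt_chartLagrangian hL (mem_extChartAt_target u)).fderiv_right (m := ∞)
      (by simp)).differentiableAt (by simp)).hasFDerivAt
  have h1 := (verticalLift D).hasFDerivAt.comp _ hd
  have h2 : ∀ A B : CoordSpace D × CoordSpace D, fderiv ℝ
      (fun x => (thetaL L ((extChartAt (velModel D) u).symm x)).comp
        (mfderiv 𝓘(ℝ, CoordSpace D × CoordSpace D) (velModel D) (extChartAt (velModel D) u).symm x) :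
        CoordSpace D × CoordSpace D → (CoordSpace D × CoordSpace D →L[ℝ] ℝ))
      (extChartAt (velModel D) u u) A B =
      fderiv ℝ (fderiv ℝ (chartLagrangian L u)) (extChartAt (velModel D) u u) A (0, B.1) := by
    intro A B
    rw [(thetaL_chart hL u).fderiv_eq]
    exact congrArg (fun T : CoordSpace D × CoordSpace D →L[ℝ] (CoordSpace D × CoordSpace D →L[ℝ] ℝ)
      => T A B) h1.fderiv
  have h3 := h2 A B
  have h4 := h2 B A
  rw [← h3, ← h4]
  exact neg_sub _ _

theorem isSymmSndFDerivAt_chartLagrangian (hL : ContMDiff (velModel D) 𝓘(ℝ, ℝ) ∞ L)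
    (u : VelPhase D Q) :
    IsSymmSndFDerivAt ℝ (chartLagrangian L u) (extChartAt (velModel D) u u) :=
  (contDiffAt_chartLagrangian hL (mem_extChartAt_target u)).isSymmSndFDerivAt
    minSmoothness_two_le_infty

theorem fibreHess_apply (hL : ContMDiff (velModel D) 𝓘(ℝ, ℝ) ∞ L) (u : VelPhase D Q)
    (a b : CoordSpace D) :
    fibreHess L u a b = fderiv ℝ (fderiv ℝ (chartLagrangian L u)) (extChartAt (velModel D) u u)
      (0, a) (0, b) := by
  have h1 : (fun w : CoordSpace D => fibreDer L ⟨u.1, w⟩) = fun w =>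
      (ContinuousLinearMap.compL ℝ (CoordSpace D) (CoordSpace D × CoordSpace D) ℝ).flip
        (.inr ℝ _ _) (fderiv ℝ (chartLagrangian L u) (extChartAt (𝓡 D) u.1 u.1, w)) := by
    funext w
    refine ContinuousLinearMap.ext fun a => ?_
    exact fibreDer_apply hL u w a
  have hd : HasFDerivAt (fderiv ℝ (chartLagrangian L u))
      (fderiv ℝ (fderiv ℝ (chartLagrangian L u)) (extChartAt (velModel D) u u))
      (extChartAt (velModel D) u u) :=
    (((contDiffAt_chartLagrangian hL (mem_extChartAt_target u)).fderiv_right (m := ∞)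
      (by simp)).differentiableAt (by simp)).hasFDerivAt
  have h2 : ∀ v : CoordSpace D, v = u.2 →
      fderiv ℝ (fun w : CoordSpace D => fibreDer L ⟨u.1, w⟩) v a b
        = fderiv ℝ (fderiv ℝ (chartLagrangian L u)) (extChartAt (velModel D) u u) (0, a) (0, b) := by
    intro v hv
    have h3 : extChartAt (velModel D) u u = (extChartAt (𝓡 D) u.1 u.1, v) := by
      rw [hv]
      exact extChartAt_tangent_self u
    rw [h3] at hd ⊢
    have h4 := (((ContinuousLinearMap.compL ℝ (CoordSpace D) (CoordSpace D × CoordSpace D)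
      ℝ).flip (.inr ℝ _ _)).hasFDerivAt.comp _ hd).comp v
        (hasFDerivAt_prodMk_right (extChartAt (𝓡 D) u.1 u.1) v)
    rw [h1]
    exact congrArg (fun T : CoordSpace D →L[ℝ] (CoordSpace D →L[ℝ] ℝ) => T a b) h4.fderiv
  exact h2 u.2 rfl

theorem energy_extChartAt_symm (hL : ContMDiff (velModel D) 𝓘(ℝ, ℝ) ∞ L) {u : VelPhase D Q}
    {z : CoordSpace D × CoordSpace D} (hz : z ∈ (extChartAt (velModel D) u).target) :
    energy L ((extChartAt (velModel D) u).symm z)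
      = fderiv ℝ (chartLagrangian L u) z (0, z.2) - chartLagrangian L u z := by
  rw [← fibreDer_extChartAt_symm hL hz]
  have h1 : ((extChartAt (velModel D) u).symm z : VelPhase D Q) = ⟨(extChartAt (𝓡 D) u.1).symm z.1,
      mfderiv 𝓘(ℝ, CoordSpace D) (𝓡 D) (extChartAt (𝓡 D) u.1).symm z.1 z.2⟩ :=
    extChartAt_tangent_symm_apply (mem_extChartAt_tangent_target.1 hz) z.2
  have h2 : (((extChartAt (velModel D) u).symm z).2 : CoordSpace D)
      = mfderiv 𝓘(ℝ, CoordSpace D) (𝓡 D) (extChartAt (𝓡 D) u.1).symm z.1 z.2 := by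
    rw [h1]
  rw [← h2]
  rfl

theorem energy_chart (hL : ContMDiff (velModel D) 𝓘(ℝ, ℝ) ∞ L) (u : VelPhase D Q) :
    energy L ∘ (extChartAt (velModel D) u).symm =ᶠ[𝓝 (extChartAt (velModel D) u u)]
      fun z => fderiv ℝ (chartLagrangian L u) z (0, z.2) - chartLagrangian L u z := by
  filter_upwards [extChartAt_target_mem_nhds (I := velModel D) u] with z hz
  exact energy_extChartAt_symm hL hz

theorem contMDiff_energy (hL : ContMDiff (velModel D) 𝓘(ℝ, ℝ) ∞ L) :
    ContMDiff (velModel D) 𝓘(ℝ, ℝ) ∞ (energy L) := by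
  intro u
  apply contMDiffAt_of_contDiffAt_extChartAt
  have h1 := contDiffAt_chartLagrangian hL (mem_extChartAt_target u)
  refine ContDiffAt.congr_of_eventuallyEq ?_ (energy_chart hL u)
  exact ((h1.fderiv_right (m := ∞) (by simp)).clm_apply
    (contDiffAt_const.prodMk contDiffAt_snd)).sub h1

theorem dFun_energy_apply (hL : ContMDiff (velModel D) 𝓘(ℝ, ℝ) ∞ L) (u : VelPhase D Q)
    (A : CoordSpace D × CoordSpace D) :
    dFun (energy L) u A
      = fderiv ℝ (fderiv ℝ (chartLagrangian L u)) (extChartAt (velModel D) u u) A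
          (0, (extChartAt (velModel D) u u).2)
        + fderiv ℝ (chartLagrangian L u) (extChartAt (velModel D) u u) (0, A.2)
        - fderiv ℝ (chartLagrangian L u) (extChartAt (velModel D) u u) A := by
  have h1 := contDiffAt_chartLagrangian hL (mem_extChartAt_target u)
  have hd := ((h1.fderiv_right (m := ∞) (by simp)).differentiableAt (by simp)).hasFDerivAt
  have h2 := (hasStrictFDerivAt_comp_extChartAt_symm (contMDiff_energy hL u)).hasFDerivAt
  obtain ⟨T, hT⟩ : ∃ T : CoordSpace D × CoordSpace D →L[ℝ] ℝ, T = dFun (energy L) u := ⟨_, rfl⟩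
  have h3 : HasFDerivAt (fun z => fderiv ℝ (chartLagrangian L u) z (0, z.2)
      - chartLagrangian L u z) T (extChartAt (velModel D) u u) := by
    rw [hT]
    exact h2.congr_of_eventuallyEq (energy_chart hL u).symm
  have h4 : HasFDerivAt (fun z : CoordSpace D × CoordSpace D => ((0 : CoordSpace D), z.2))
      ((0 : CoordSpace D × CoordSpace D →L[ℝ] CoordSpace D).prod (.snd ℝ _ _))
      (extChartAt (velModel D) u u) :=
    (hasFDerivAt_const _ _).prodMk hasFDerivAt_snd
  have h7 : HasFDerivAt (chartLagrangian L u) (fderiv ℝ (chartLagrangian L u)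
      (extChartAt (velModel D) u u)) (extChartAt (velModel D) u u) :=
    (h1.differentiableAt (by simp)).hasFDerivAt
  have h5 := (hd.clm_apply h4).sub h7
  have h6 := congrArg (fun T : CoordSpace D × CoordSpace D →L[ℝ] ℝ => T A) (h3.unique h5)
  rw [hT] at h6
  refine h6.trans ?_
  simp [add_comm]

theorem omegaL_antisymm (hL : ContMDiff (velModel D) 𝓘(ℝ, ℝ) ∞ L) (u : VelPhase D Q)
    (A B : TangentSpace (velModel D) u) : omegaL L u A B = -omegaL L u B A := by
  have h1 := omegaL_apply hL u A B
  have h2 := omegaL_apply hL u B A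
  rw [h1, h2]
  ring

theorem fibreHess_symm (hL : ContMDiff (velModel D) 𝓘(ℝ, ℝ) ∞ L) (u : VelPhase D Q)
    (a b : CoordSpace D) : fibreHess L u a b = fibreHess L u b a := by
  rw [fibreHess_apply hL, fibreHess_apply hL]
  exact isSymmSndFDerivAt_chartLagrangian hL u _ _

theorem projT_apply (u : VelPhase D Q) (A : TangentSpace (velModel D) u) :
    projT u A = (A : CoordSpace D × CoordSpace D).1 :=
  mfderiv_proj_apply u A

/-- One of the two second-derivative terms sees only the horizontal part of the vertical argument
and drops out. This identity is the link between `ker Ω_L` and the kernel of the Hessian. -/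
theorem omegaL_vertical (hL : ContMDiff (velModel D) 𝓘(ℝ, ℝ) ∞ L) (u : VelPhase D Q)
    (A : TangentSpace (velModel D) u) (w : CoordSpace D) :
    omegaL L u A ((0, w) : CoordSpace D × CoordSpace D) = fibreHess L u w (projT u A) := by
  rw [projT_apply, fibreHess_apply hL]
  refine (omegaL_apply hL u A (0, w)).trans ?_
  have : (((0 : CoordSpace D), (0 : CoordSpace D))) = 0 := rfl
  rw [this, map_zero, sub_zero]

/-- In the fibre derivative of `v ∂L/∂v - L` the first derivatives of `L` cancel. -/
theorem dFun_energy_vertical (hL : ContMDiff (velModel D) 𝓘(ℝ, ℝ) ∞ L) (u : VelPhase D Q)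
    (w : CoordSpace D) :
    dFun (energy L) u ((0, w) : CoordSpace D × CoordSpace D) = fibreHess L u w u.2 := by
  refine (dFun_energy_apply hL u (0, w)).trans ?_
  have h1 : (extChartAt (velModel D) u u).2 = (u.2 : CoordSpace D) :=
    congrArg Prod.snd (extChartAt_tangent_self u)
  rw [add_sub_cancel_right, h1]
  exact (fibreHess_apply hL u w u.2).symm

theorem contMDiff_thetaL (hL : ContMDiff (velModel D) 𝓘(ℝ, ℝ) ∞ L) {Y : VelField D Q}
    (hY : IsSmoothVF (velModel D) Y) :
    ContMDiff (velModel D) 𝓘(ℝ, ℝ) ∞ (fun u => thetaL L u (Y u)) := by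
  intro u
  apply contMDiffAt_of_contDiffAt_extChartAt
  have hu := mem_extChartAt_target (I := velModel D) u
  refine ContDiffAt.congr_of_eventuallyEq ((contDiffAt_verticalLift_fderiv hL hu).clm_apply
    (contDiffAt_chartField hu (hY _))) ?_
  filter_upwards [thetaL_chart hL u, extChartAt_target_mem_nhds (I := velModel D) u] with z hz ht
  rw [← hz]
  exact congrArg (thetaL L ((extChartAt (velModel D) u).symm z)) (mfderiv_symm_chartField ht Y).symm

theorem omegaL_cartan (hL : ContMDiff (velModel D) 𝓘(ℝ, ℝ) ∞ L) {X Y : VelField D Q}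
    (hX : IsSmoothVF (velModel D) X) (hY : IsSmoothVF (velModel D) Y) (u : VelPhase D Q) :
    omegaL L u (X u) (Y u) = -(vfDeriv (velModel D) X (fun w => thetaL L w (Y w)) u
      - vfDeriv (velModel D) Y (fun w => thetaL L w (X w)) u
      - thetaL L u (mlieBracket (velModel D) X Y u)) := by
  rw [← extDer_apply_eq hX hY _ rfl ?_ ((contMDiff_thetaL hL hX u).mdifferentiableAt (by simp))
    ((contMDiff_thetaL hL hY u).mdifferentiableAt (by simp))]
  · rfl
  · exact (((contDiffAt_verticalLift_fderiv hL (mem_extChartAt_target u)).differentiableAt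
      (by simp)).congr_of_eventuallyEq (thetaL_chart hL u))

/-- Cartan's formula expresses `Ω_L` on smooth fields by derivatives of smooth functions, so the
chartwise definition of `extDer`, whose chart moves with the point, need not be examined. -/
theorem contMDiff_omegaL (hL : ContMDiff (velModel D) 𝓘(ℝ, ℝ) ∞ L) {X Y : VelField D Q}
    (hX : IsSmoothVF (velModel D) X) (hY : IsSmoothVF (velModel D) Y) :
    ContMDiff (velModel D) 𝓘(ℝ, ℝ) ∞ (fun u => omegaL L u (X u) (Y u)) := by
  have h1 : (fun u => omegaL L u (X u) (Y u)) = fun u =>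
      -(vfDeriv (velModel D) X (fun w => thetaL L w (Y w)) u
      - vfDeriv (velModel D) Y (fun w => thetaL L w (X w)) u
      - thetaL L u (mlieBracket (velModel D) X Y u)) :=
    funext (omegaL_cartan hL hX hY)
  rw [h1]
  exact (((ContMDiff.vfDeriv hX (contMDiff_thetaL hL hY)).sub
    (ContMDiff.vfDeriv hY (contMDiff_thetaL hL hX))).sub
    (contMDiff_thetaL hL (hX.mlieBracket hY))).neg

end LagrangianForms

/-! ### The kernels of `Ω_L` and of the Hessian as smooth distributions. -/

noncomputable section LagrangianKernels

open Filter VectorField Module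

section LinearAlgebra

variable {E : Type*} [NormedAddCommGroup E] [NormedSpace ℝ E] [FiniteDimensional ℝ E]
  {Ω : E × E →L[ℝ] E × E →L[ℝ] ℝ} {M : E →L[ℝ] E →L[ℝ] ℝ} {N : ℕ}

omit [FiniteDimensional ℝ E] in
-- The vertical part of the kernel of `Ω` is exactly `0 × ker M`.
theorem finrank_ker_inf_ker_fst (hΩ : ∀ A B, Ω A B = -Ω B A)
    (hM : ∀ A w, Ω A (0, w) = M w A.1) (hN : finrank ℝ (LinearMap.ker M.toLinearMap) = N) :
    finrank ℝ ↥(LinearMap.ker Ω.toLinearMap ⊓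
      LinearMap.ker (ContinuousLinearMap.fst ℝ E E).toLinearMap) = N := by
  have h : LinearMap.ker Ω.toLinearMap ⊓ LinearMap.ker (ContinuousLinearMap.fst ℝ E E).toLinearMap
      = (LinearMap.ker M.toLinearMap).map (LinearMap.inr ℝ E E) := by
    ext ⟨x, w⟩
    simp only [Submodule.mem_inf, LinearMap.mem_ker, Submodule.mem_map, LinearMap.inr_apply]
    constructor
    · rintro ⟨h1, h2⟩
      obtain rfl : x = 0 := h2
      refine ⟨w, ?_, rfl⟩
      ext a
      have h3 : Ω (0, w) (a, 0) = 0 := congrArg (fun T : E × E →L[ℝ] ℝ => T (a, 0)) h1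
      rw [hΩ, hM, neg_eq_zero] at h3
      exact h3
    · rintro ⟨w', h1, h2⟩
      obtain ⟨rfl, rfl⟩ := Prod.mk.inj h2
      refine ⟨?_, rfl⟩
      refine ContinuousLinearMap.ext fun A => ?_
      have h3 : M w' A.1 = 0 := congrArg (fun T : E →L[ℝ] ℝ => T A.1) h1
      exact (hΩ _ _).trans (by rw [hM, h3, neg_zero]; rfl)
  rw [h, ← hN]
  exact (Submodule.equivMapOfInjective (LinearMap.inr ℝ E E) LinearMap.inr_injective
    _).finrank_eq.symm

/-- The first projection maps `ker Ω` into `ker M` with a kernel of dimension `N`. As `ker Ω` has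
dimension `2 N`, the image has the dimension of `ker M`, so it is all of it. -/
theorem exists_mem_ker_fst_eq (hΩ : ∀ A B, Ω A B = -Ω B A)
    (hM : ∀ A w, Ω A (0, w) = M w A.1) (hMs : ∀ a b, M a b = M b a)
    (hN : finrank ℝ (LinearMap.ker M.toLinearMap) = N)
    (hN2 : finrank ℝ (LinearMap.ker Ω.toLinearMap) = 2 * N) {z : E} (hz : M z = 0) :
    ∃ K : E × E, Ω K = 0 ∧ K.1 = z := by
  let κ := LinearMap.ker Ω.toLinearMap
  let f : κ →ₗ[ℝ] E := (LinearMap.fst ℝ E E).domRestrict κ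
  have h1 := LinearMap.finrank_range_add_finrank_ker f
  have h2 : finrank ℝ (LinearMap.ker f) = N := by
    rw [← finrank_ker_inf_ker_fst hΩ hM hN]
    have h3 : LinearMap.ker f = Submodule.comap κ.subtype (LinearMap.ker Ω.toLinearMap ⊓
      LinearMap.ker (ContinuousLinearMap.fst ℝ E E).toLinearMap) := by
      ext x
      constructor
      · intro hx
        exact ⟨x.2, hx⟩
      · intro hx
        exact hx.2
    rw [h3]
    exact (Submodule.comapSubtypeEquivOfLe inf_le_left).finrank_eq
  have h3 : LinearMap.range f ≤ LinearMap.ker M.toLinearMap := by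
    rintro _ ⟨⟨K, hK⟩, rfl⟩
    refine ContinuousLinearMap.ext fun w => ?_
    have h4 : Ω K (0, w) = 0 := congrArg (fun T : E × E →L[ℝ] ℝ => T (0, w)) hK
    rw [hM, hMs] at h4
    exact h4
  have h4 : LinearMap.range f = LinearMap.ker M.toLinearMap := by
    apply Submodule.eq_of_le_of_finrank_eq h3
    rw [hN]
    have : finrank ℝ κ = 2 * N := hN2
    omega
  have h5 : z ∈ LinearMap.range f := by
    rw [h4]
    exact hz
  obtain ⟨⟨K, hK⟩, h6⟩ := h5
  exact ⟨K, hK, h6⟩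

end LinearAlgebra

section TwoForms

variable {E H M : Type*} [NormedAddCommGroup E] [NormedSpace ℝ E] [FiniteDimensional ℝ E]
  [TopologicalSpace H] {I : ModelWithCorners ℝ E H} [I.Boundaryless] [TopologicalSpace M]
  [T2Space M] [ChartedSpace H M] [IsManifold I ∞ M]

/-- A two-form, in the chart at `p`. -/
def chartTwoForm (Ω : (u : M) → TangentSpace I u →L[ℝ] TangentSpace I u →L[ℝ] ℝ) (p : M)
    (x : E) : E →L[ℝ] E →L[ℝ] ℝ :=
  ContinuousLinearMap.bilinearComp (E := E) (F := E) (E' := E) (F' := E)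
    (Ω ((extChartAt I p).symm x))
    (mfderiv 𝓘(ℝ, E) I (extChartAt I p).symm x) (mfderiv 𝓘(ℝ, E) I (extChartAt I p).symm x)

theorem exists_vectorField_chart_const {p : M} {x : E} (hx : x ∈ (extChartAt I p).target) (a : E) :
    ∃ Y : (u : M) → TangentSpace I u, IsSmoothVF I Y ∧
      ∀ᶠ y in 𝓝 x, Y ((extChartAt I p).symm y) = mfderiv 𝓘(ℝ, E) I (extChartAt I p).symm y a := by
  obtain ⟨Y, hY, -, hYa⟩ := exists_vectorField_of_chart hx (Z := fun _ => a)
    (𝒟 := fun u : M => (⊤ : Submodule ℝ (TangentSpace I u)))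
    (Eventually.of_forall fun _ => contDiffAt_const) (Eventually.of_forall fun _ => trivial)
  refine ⟨Y, hY, ?_⟩
  filter_upwards [hYa, (isOpen_extChartAt_target (I := I) p).mem_nhds hx] with y hy ht
  exact (mfderiv_symm_chartField ht Y).symm.trans
    (congrArg (fun v : E => (mfderiv 𝓘(ℝ, E) I (extChartAt I p).symm y v : E)) hy)

/-- Each matrix entry is the value of `Ω` on two global smooth fields that are constant in the chart
near the given point. -/
theorem contDiffAt_chartTwoForm {Ω : (u : M) → TangentSpace I u →L[ℝ] TangentSpace I u →L[ℝ] ℝ}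
    (hΩ : ∀ X Y : (u : M) → TangentSpace I u, IsSmoothVF I X → IsSmoothVF I Y →
      ContMDiff I 𝓘(ℝ, ℝ) ∞ (fun u => Ω u (X u) (Y u))) {p : M} {x : E}
    (hx : x ∈ (extChartAt I p).target) : ContDiffAt ℝ ∞ (chartTwoForm Ω p) x := by
  have h1 : ContDiffOn ℝ ∞ (chartTwoForm Ω p) (extChartAt I p).target := by
    rw [contDiffOn_clm_apply]
    intro a
    rw [contDiffOn_clm_apply]
    intro b y hy
    obtain ⟨X, hX, hXa⟩ := exists_vectorField_chart_const hy a
    obtain ⟨Y, hY, hYb⟩ := exists_vectorField_chart_const hy b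
    refine ContDiffAt.contDiffWithinAt ?_
    refine (contDiffAt_comp_extChartAt_symm hy (hΩ X Y hX hY _)).congr_of_eventuallyEq ?_
    filter_upwards [hXa, hYb] with z hz hz'
    simp only [Function.comp_apply, hz, hz']
    rfl
  exact h1.contDiffAt ((isOpen_extChartAt_target (I := I) p).mem_nhds hx)

omit [FiniteDimensional ℝ E] [T2Space M] in
theorem chartTwoForm_eq_zero_iff
    (Ω : (u : M) → TangentSpace I u →L[ℝ] TangentSpace I u →L[ℝ] ℝ) {p : M} {x : E}
    (hx : x ∈ (extChartAt I p).target) (a : E) : chartTwoForm Ω p x a = 0 ↔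
      Ω ((extChartAt I p).symm x) (mfderiv 𝓘(ℝ, E) I (extChartAt I p).symm x a) = 0 := by
  constructor
  · intro h
    refine ContinuousLinearMap.ext fun B => ?_
    obtain ⟨b, rfl⟩ := (isInvertible_mfderiv_extChartAt_symm (I := I) hx).surjective B
    exact congrArg (fun T : E →L[ℝ] ℝ => T b) h
  · intro h
    refine ContinuousLinearMap.ext fun b => ?_
    exact congrArg (fun T : E →L[ℝ] ℝ => T (mfderiv 𝓘(ℝ, E) I (extChartAt I p).symm x b)) h

end TwoForms

variable {D : ℕ} {Q : Type*} [TopologicalSpace Q] [ChartedSpace (CoordSpace D) Q]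
  [IsManifold (𝓡 D) ∞ Q] {L : VelPhase D Q → ℝ} {N₀ : ℕ}

theorem smoothField_iff {X : VelField D Q} : SmoothField X ↔ IsSmoothVF (velModel D) X :=
  contMDiffOn_univ

theorem projT_mfderiv_eq_zero_iff {p : VelPhase D Q} {z : CoordSpace D × CoordSpace D}
    (hz : z ∈ (extChartAt (velModel D) p).target) (A : CoordSpace D × CoordSpace D) :
    projT ((extChartAt (velModel D) p).symm z)
      (mfderiv 𝓘(ℝ, CoordSpace D × CoordSpace D) (velModel D) (extChartAt (velModel D) p).symm z A)
        = 0 ↔ A.1 = 0 := by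
  have h1 := mfderiv_proj_extChartAt_symm hz A
  have hi := isInvertible_mfderiv_extChartAt_symm (I := 𝓡 D) (mem_extChartAt_tangent_target.1 hz)
  refine Iff.trans (Eq.congr_left h1) ?_
  constructor
  · intro h
    exact hi.injective (h.trans (map_zero (mfderiv 𝓘(ℝ, CoordSpace D) (𝓡 D)
      (extChartAt (𝓡 D) p.1).symm z.1)).symm)
  · intro h
    rw [h]
    exact map_zero (mfderiv 𝓘(ℝ, CoordSpace D) (𝓡 D) (extChartAt (𝓡 D) p.1).symm z.1)

variable (D Q) in
/-- The vertical distribution on the tangent bundle. -/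
def verticalSpace (u : VelPhase D Q) : Submodule ℝ (TangentSpace (velModel D) u) :=
  LinearMap.ker (projT u).toLinearMap

theorem isSmoothDistribution_verticalSpace :
    IsSmoothDistribution (CoordSpace D) (verticalSpace D Q) := by
  refine ⟨⟨finrank ℝ (LinearMap.ker (LinearMap.fst ℝ (CoordSpace D) (CoordSpace D))),
    fun u => ?_⟩, fun p => ⟨fun _ => .fst ℝ _ _, Eventually.of_forall fun x => contDiffAt_const, ?_⟩⟩
  · have h1 : verticalSpace D Q u = LinearMap.ker (LinearMap.fst ℝ (CoordSpace D) (CoordSpace D)) := by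
      ext A
      exact Eq.congr_left (projT_apply u A)
    rw [← h1]
    rfl
  · filter_upwards [extChartAt_target_mem_nhds (I := velModel D) p] with z hz A
    exact (projT_mfderiv_eq_zero_iff hz A).symm

/-- The vertical vectors in the kernel of `Ω_L`. -/
def verticalKer (L : VelPhase D Q → ℝ) (u : VelPhase D Q) :
    Submodule ℝ (TangentSpace (velModel D) u) :=
  kerOmega L u ⊓ verticalSpace D Q u

theorem omegaL_vertical' (hL : ContMDiff (velModel D) 𝓘(ℝ, ℝ) ∞ L) (u : VelPhase D Q)
    (A : CoordSpace D × CoordSpace D) (w : CoordSpace D) :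
    omegaL L u A ((0, w) : CoordSpace D × CoordSpace D) = fibreHess L u w A.1 :=
  (omegaL_vertical hL u A w).trans (congrArg (fibreHess L u w) (projT_apply u A))

namespace IsSingularLagrangian

variable [T2Space Q] (h : IsSingularLagrangian L N₀)
include h

theorem isSmoothDistribution_kerOmega :
    IsSmoothDistribution (CoordSpace D × CoordSpace D →L[ℝ] ℝ) (kerOmega L) := by
  refine ⟨⟨2 * N₀, h.finrank_kerOmega⟩, fun p => ⟨chartTwoForm (omegaL L) p, ?_, ?_⟩⟩
  · filter_upwards [extChartAt_target_mem_nhds (I := velModel D) p] with z hz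
    exact contDiffAt_chartTwoForm (fun X Y hX hY => contMDiff_omegaL h.smooth hX hY) hz
  · filter_upwards [extChartAt_target_mem_nhds (I := velModel D) p] with z hz A
    exact chartTwoForm_eq_zero_iff (omegaL L) hz A

omit [T2Space Q] in
theorem finrank_verticalKer (u : VelPhase D Q) : finrank ℝ (verticalKer L u) = N₀ := by
  have h1 : verticalKer L u = LinearMap.ker (omegaL L u).toLinearMap ⊓
      LinearMap.ker (ContinuousLinearMap.fst ℝ (CoordSpace D) (CoordSpace D)).toLinearMap := by
    ext A
    exact and_congr Iff.rfl (Eq.congr_left (projT_apply u A))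
  have h2 := finrank_ker_inf_ker_fst (E := CoordSpace D) (Ω := omegaL L u)
    (omegaL_antisymm h.smooth u) (omegaL_vertical' h.smooth u) (h.finrank_kerHess u)
  exact (congrArg (fun S : Submodule ℝ (CoordSpace D × CoordSpace D) => finrank ℝ S) h1).trans h2

/-- It is the kernel of the pair formed by `Ω_L` and the first projection, of constant rank because
`ker M` has constant dimension. -/
theorem isSmoothDistribution_verticalKer :
    IsSmoothDistribution ((CoordSpace D × CoordSpace D →L[ℝ] ℝ) × CoordSpace D)
      (verticalKer L) := by
  refine ⟨⟨N₀, h.finrank_verticalKer⟩, fun p =>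
    ⟨fun x => (chartTwoForm (omegaL L) p x).prod (.fst ℝ _ _), ?_, ?_⟩⟩
  · filter_upwards [extChartAt_target_mem_nhds (I := velModel D) p] with z hz
    have h1 := contDiffAt_chartTwoForm (fun X Y hX hY => contMDiff_omegaL h.smooth hX hY) hz
    have h2 : (fun x => (chartTwoForm (omegaL L) p x).prod (.fst ℝ _ _)) = fun x =>
        (ContinuousLinearMap.inl ℝ (CoordSpace D × CoordSpace D →L[ℝ] ℝ) (CoordSpace D)).comp
          (chartTwoForm (omegaL L) p x)
        + (ContinuousLinearMap.inr ℝ (CoordSpace D × CoordSpace D →L[ℝ] ℝ) (CoordSpace D)).comp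
          (.fst ℝ (CoordSpace D) (CoordSpace D)) := by
      funext x
      refine ContinuousLinearMap.ext fun A => ?_
      simp
    rw [h2]
    exact (contDiffAt_const.clm_comp h1).add contDiffAt_const
  · filter_upwards [extChartAt_target_mem_nhds (I := velModel D) p] with z hz A
    have h1 := chartTwoForm_eq_zero_iff (omegaL L) hz A
    have h2 := projT_mfderiv_eq_zero_iff hz A
    refine Prod.mk_eq_zero.trans ?_
    exact and_congr h1 h2.symm

end IsSingularLagrangian

end LagrangianKernels

/-! ### The constraint surface and the tangency of `𝒢` to it. -/

noncomputable section ConstraintSurface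

open Filter VectorField Module

variable {D : ℕ} {Q : Type*} [TopologicalSpace Q] [ChartedSpace (CoordSpace D) Q]
  [IsManifold (𝓡 D) ∞ Q] {L : VelPhase D Q → ℝ} {N₀ : ℕ}

theorem projT_mem_kerHess_iff (hL : ContMDiff (velModel D) 𝓘(ℝ, ℝ) ∞ L) {u : VelPhase D Q}
    {A : TangentSpace (velModel D) u} : projT u A ∈ kerHess L u ↔
      ∀ w, omegaL L u A ((0, w) : CoordSpace D × CoordSpace D) = 0 := by
  constructor
  · intro hA w
    rw [omegaL_vertical hL, fibreHess_symm hL]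
    exact congrArg (fun T : CoordSpace D →L[ℝ] ℝ => T w) hA
  · intro hA
    refine ContinuousLinearMap.ext fun w => ?_
    have := hA w
    rw [omegaL_vertical hL, fibreHess_symm hL] at this
    exact this

theorem eq_mk_of_projT_eq_zero {u : VelPhase D Q} {V : TangentSpace (velModel D) u}
    (hV : projT u V = 0) : ∃ w : CoordSpace D, V = ((0, w) : CoordSpace D × CoordSpace D) := by
  rw [projT_apply] at hV
  exact ⟨(V : CoordSpace D × CoordSpace D).2, Prod.ext hV rfl⟩

theorem projT_mk (u : VelPhase D Q) (A : CoordSpace D × CoordSpace D) : projT u A = A.1 :=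
  projT_apply u A

theorem exists_projT_eq (u : VelPhase D Q) :
    ∃ Γ : TangentSpace (velModel D) u, projT u Γ = u.2 :=
  ⟨((u.2, 0) : CoordSpace D × CoordSpace D), projT_mk u _⟩

theorem omegaL_left_eq_zero {u : VelPhase D Q} {K : TangentSpace (velModel D) u}
    (hK : K ∈ kerOmega L u) (A : TangentSpace (velModel D) u) : omegaL L u K A = 0 :=
  congrArg (fun T : CoordSpace D × CoordSpace D →L[ℝ] ℝ => T A) hK

theorem omegaL_right_eq_zero (hL : ContMDiff (velModel D) 𝓘(ℝ, ℝ) ∞ L) {u : VelPhase D Q}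
    {K : TangentSpace (velModel D) u} (hK : K ∈ kerOmega L u) (A : TangentSpace (velModel D) u) :
    omegaL L u A K = 0 := by
  rw [omegaL_antisymm hL, omegaL_left_eq_zero hK, neg_zero]

/-- Both sides equal the Hessian evaluated on `V` and the velocity: `β[Γ]` of a second-order field
kills vertical vectors. -/
theorem dFun_energy_eq_omegaL (hL : ContMDiff (velModel D) 𝓘(ℝ, ℝ) ∞ L) {u : VelPhase D Q}
    {Γ V : TangentSpace (velModel D) u} (hΓ : projT u Γ = u.2) (hV : projT u V = 0) :
    dFun (energy L) u V = omegaL L u Γ V := by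
  obtain ⟨w, rfl⟩ := eq_mk_of_projT_eq_zero hV
  rw [omegaL_vertical hL, hΓ]
  exact dFun_energy_vertical hL u w

theorem dFun_energy_eq_zero_of_mem_verticalKer (hL : ContMDiff (velModel D) 𝓘(ℝ, ℝ) ∞ L)
    {u : VelPhase D Q} {V : TangentSpace (velModel D) u} (hV : V ∈ verticalKer L u) :
    dFun (energy L) u V = 0 := by
  obtain ⟨Γ, hΓ⟩ := exists_projT_eq u
  rw [dFun_energy_eq_omegaL hL hΓ hV.2, omegaL_right_eq_zero hL hV.1]

/-- Brackets of vertical vector fields are vertical. -/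
theorem mlieBracket_mem_verticalSpace {G V : VelField D Q} (hG : IsSmoothVF (velModel D) G)
    (hV : IsSmoothVF (velModel D) V) (hGv : ∀ u, projT u (G u) = 0) (hVv : ∀ u, projT u (V u) = 0)
    (u : VelPhase D Q) : projT u (mlieBracket (velModel D) G V u) = 0 := by
  have hu := mem_extChartAt_target (I := velModel D) u
  have key : ∀ X : VelField D Q, IsSmoothVF (velModel D) X → (∀ u, projT u (X u) = 0) →
      ∀ A, (fderiv ℝ (chartField u X) (extChartAt (velModel D) u u) A).1 = 0 := by
    intro X hX hXv A
    have h1 : (fun z => (chartField u X z).1) =ᶠ[𝓝 (extChartAt (velModel D) u u)] fun _ => 0 := by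
      filter_upwards [extChartAt_target_mem_nhds (I := velModel D) u] with z hz
      have h2 := (projT_mfderiv_eq_zero_iff hz (chartField u X z)).1
      apply h2
      rw [mfderiv_symm_chartField hz]
      exact hXv _
    have hd : DifferentiableAt ℝ (chartField u X) (extChartAt (velModel D) u u) :=
      (contDiffAt_chartField hu (hX _)).differentiableAt (by simp)
    have h3 := h1.fderiv_eq (𝕜 := ℝ)
    rw [hd.hasFDerivAt.fst.fderiv] at h3
    have h4 := congrArg (fun T : CoordSpace D × CoordSpace D →L[ℝ] CoordSpace D => T A) h3
    simpa using h4
  rw [projT_apply, ← chartField_self u (mlieBracket (velModel D) G V),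
    chartField_mlieBracket hu hG hV, lieBracket]
  refine (sub_eq_zero.2 ?_)
  rw [key V hV hVv, key G hG hGv]

theorem vfDeriv_omegaL (hL : ContMDiff (velModel D) 𝓘(ℝ, ℝ) ∞ L) {P X Y : VelField D Q}
    (hP : IsSmoothVF (velModel D) P) (hX : IsSmoothVF (velModel D) X)
    (hY : IsSmoothVF (velModel D) Y) (hPΩ : ∀ u, P u ∈ kerOmega L u) (u : VelPhase D Q) :
    vfDeriv (velModel D) P (fun w => omegaL L w (X w) (Y w)) u
      = omegaL L u (mlieBracket (velModel D) P X u) (Y u)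
        + omegaL L u (X u) (mlieBracket (velModel D) P Y u) :=
  vfDeriv_twoForm_of_mem_ker (fun _ => contMDiff_thetaL hL)
    (fun _ _ hX hY p => omegaL_cartan hL hX hY p) hP hX hY hPΩ u

theorem contMDiff_dFun_energy (hL : ContMDiff (velModel D) 𝓘(ℝ, ℝ) ∞ L) {X : VelField D Q}
    (hX : IsSmoothVF (velModel D) X) :
    ContMDiff (velModel D) 𝓘(ℝ, ℝ) ∞ (fun u => dFun (energy L) u (X u)) :=
  ContMDiff.vfDeriv hX (contMDiff_energy hL)

theorem contMDiff_betaForm (hL : ContMDiff (velModel D) 𝓘(ℝ, ℝ) ∞ L) {X Y : VelField D Q}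
    (hX : IsSmoothVF (velModel D) X) (hY : IsSmoothVF (velModel D) Y) :
    ContMDiff (velModel D) 𝓘(ℝ, ℝ) ∞ (fun u => betaForm L X u (Y u)) :=
  (contMDiff_dFun_energy hL hY).sub (contMDiff_omegaL hL hX hY)

theorem exists_vertical_section [T2Space Q] {u : VelPhase D Q} {V : TangentSpace (velModel D) u}
    (hV : projT u V = 0) : ∃ X : VelField D Q, IsSmoothVF (velModel D) X ∧
      (∀ u, projT u (X u) = 0) ∧ X u = V :=
  isSmoothDistribution_verticalSpace.exists_section (p := u) hV

theorem IsConstraintFun.contMDiff (hL : ContMDiff (velModel D) 𝓘(ℝ, ℝ) ∞ L) {γ : VelPhase D Q → ℝ}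
    (hγ : IsConstraintFun L γ) : ContMDiff (velModel D) 𝓘(ℝ, ℝ) ∞ γ := by
  obtain ⟨Γ, C, hΓ, hC, -, -, rfl⟩ := hγ
  exact contMDiff_betaForm hL (smoothField_iff.1 hΓ) (smoothField_iff.1 hC)

theorem IsConstraintFun.eq_zero {γ : VelPhase D Q → ℝ} (hγ : IsConstraintFun L γ)
    {u : VelPhase D Q} (hu : u ∈ firstConstraintSet L) : γ u = 0 := by
  obtain ⟨Γ, C, -, -, h1, h2, rfl⟩ := hγ
  exact hu _ _ (h1 u) (h2 u)

namespace IsSingularLagrangian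

variable (h : IsSingularLagrangian L N₀)
include h

/-- `ker Ω_L` projects onto `ker M`, so the horizontal part of `A` can be matched by a kernel vector
`K`; what remains is vertical. -/
theorem exists_kerOmega_add_vertical {u : VelPhase D Q} {A : TangentSpace (velModel D) u}
    (hA : projT u A ∈ kerHess L u) : ∃ K V : TangentSpace (velModel D) u,
      K ∈ kerOmega L u ∧ projT u V = 0 ∧ A = K + V := by
  obtain ⟨K, hK, hKA⟩ := exists_mem_ker_fst_eq (E := CoordSpace D) (Ω := omegaL L u)
    (omegaL_antisymm h.smooth u) (omegaL_vertical' h.smooth u) (fibreHess_symm h.smooth u)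
    (h.finrank_kerHess u) (h.finrank_kerOmega u) hA
  let K' : TangentSpace (velModel D) u := K
  refine ⟨K', A - K', hK, ?_, (add_sub_cancel _ _).symm⟩
  rw [map_sub, sub_eq_zero, ← hKA]
  exact (projT_mk u K).symm

theorem projT_mem_kerHess {u : VelPhase D Q} {K : TangentSpace (velModel D) u}
    (hK : K ∈ kerOmega L u) : projT u K ∈ kerHess L u := by
  rw [projT_mem_kerHess_iff h.smooth]
  intro w
  exact omegaL_left_eq_zero hK _

/-- Split `C` into a kernel and a vertical part: `β[Γ]` kills the vertical part, and on the kernel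
part it reduces to `dE`. This removes `Γ` from the description of the surface. -/
theorem mem_firstConstraintSet_iff {u : VelPhase D Q} :
    u ∈ firstConstraintSet L ↔ ∀ K ∈ kerOmega L u, dFun (energy L) u K = 0 := by
  constructor
  · intro hu K hK
    obtain ⟨Γ, hΓ⟩ := exists_projT_eq u
    have h2 := hu Γ K hΓ (h.projT_mem_kerHess hK)
    rwa [omegaL_right_eq_zero h.smooth hK, sub_zero] at h2
  · intro hu Γ C hΓ hC
    obtain ⟨K, V, hK, hV, rfl⟩ := h.exists_kerOmega_add_vertical hC
    rw [map_add, map_add, hu K hK, dFun_energy_eq_omegaL h.smooth hΓ hV,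
      omegaL_right_eq_zero h.smooth hK, sub_self]

variable [T2Space Q]

theorem isClosed_firstConstraintSet : IsClosed (firstConstraintSet L) := by
  rw [← isOpen_compl_iff, isOpen_iff_mem_nhds]
  intro u hu
  have h1 : ¬ ∀ K ∈ kerOmega L u, dFun (energy L) u K = 0 := fun h' =>
    hu (h.mem_firstConstraintSet_iff.2 h')
  push Not at h1
  obtain ⟨K, hK, hne⟩ := h1
  obtain ⟨X, hX, hXκ, rfl⟩ := h.isSmoothDistribution_kerOmega.exists_section hK
  filter_upwards [(contMDiff_dFun_energy h.smooth hX).continuous.continuousAt.eventually_ne hne]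
    with w hw hwS
  exact hw (h.mem_firstConstraintSet_iff.1 hwS _ (hXκ w))

omit h in
-- The condition on `C` means that `Ω_L(C, V) = 0` for all vertical `V`. Differentiating along `G`
-- moves the bracket onto `C`, since `G` preserves `Ω_L` and `[G, V]` is again vertical.
theorem mlieBracket_projT_mem_kerHess (hL : ContMDiff (velModel D) 𝓘(ℝ, ℝ) ∞ L)
    {G C : VelField D Q} (hG : IsSmoothVF (velModel D) G) (hC : IsSmoothVF (velModel D) C)
    (hGκ : ∀ u, G u ∈ verticalKer L u) (hCM : ∀ u, projT u (C u) ∈ kerHess L u)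
    (u : VelPhase D Q) : projT u (mlieBracket (velModel D) G C u) ∈ kerHess L u := by
  have hz : ∀ (w : VelPhase D Q) (V : TangentSpace (velModel D) w), projT w V = 0 →
      omegaL L w (C w) V = 0 := by
    intro w V hV
    obtain ⟨a, rfl⟩ := eq_mk_of_projT_eq_zero hV
    exact (projT_mem_kerHess_iff hL).1 (hCM w) a
  rw [projT_mem_kerHess_iff hL]
  intro a
  obtain ⟨V, hV, hVv, hVa⟩ := exists_vertical_section (u := u)
    (V := ((0, a) : CoordSpace D × CoordSpace D)) (projT_mk u _)
  have h1 := vfDeriv_omegaL hL hG hC hV (fun w => (hGκ w).1) u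
  have h2 : (fun w => omegaL L w (C w) (V w)) = fun _ => 0 := funext fun w => hz w _ (hVv w)
  rw [h2, vfDeriv_const, hz u _ (mlieBracket_mem_verticalSpace hG hV (fun w => (hGκ w).2) hVv u),
    add_zero, hVa] at h1
  exact h1.symm

/-- The vector fields in `𝒢` annihilate the constraint functions on the constraint surface. -/
theorem vfDeriv_constraintFun_eq_zero {G : VelField D Q} (hG : IsSmoothVF (velModel D) G)
    (hGκ : ∀ u, G u ∈ verticalKer L u) {γ : VelPhase D Q → ℝ} (hγ : IsConstraintFun L γ)
    {u : VelPhase D Q} (hu : u ∈ firstConstraintSet L) : vfDeriv (velModel D) G γ u = 0 := by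
  obtain ⟨Γ, C, hΓ, hC, hΓ2, hCM, rfl⟩ := hγ
  rw [smoothField_iff] at hΓ hC
  have hE := contMDiff_energy h.smooth
  have hGE : ∀ w, vfDeriv (velModel D) G (energy L) w = 0 := fun w =>
    dFun_energy_eq_zero_of_mem_verticalKer h.smooth (hGκ w)
  have hGE' : vfDeriv (velModel D) G (energy L) = fun _ => 0 := funext hGE
  have hbr : ∀ Y : VelField D Q, IsSmoothVF (velModel D) Y →
      vfDeriv (velModel D) G (vfDeriv (velModel D) Y (energy L)) u
        = vfDeriv (velModel D) (mlieBracket (velModel D) G Y) (energy L) u := by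
    intro Y hY
    rw [vfDeriv_mlieBracket hG hY hE, hGE', vfDeriv_const, sub_zero]
  -- Differentiate `Y E = Ω_L(Γ, Y)`, valid for vertical `Y`, along `G`. As `G E = 0` and `[G, Y]`
  -- is vertical, the `[G, Y]` terms on the two sides cancel.
  have hvert : ∀ V : TangentSpace (velModel D) u, projT u V = 0 →
      omegaL L u (mlieBracket (velModel D) G Γ u) V = 0 := by
    intro V hV
    obtain ⟨Y, hY, hYv, rfl⟩ := exists_vertical_section hV
    have h1 := vfDeriv_omegaL h.smooth hG hΓ hY (fun w => (hGκ w).1) u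
    have h2 : (fun w => omegaL L w (Γ w) (Y w)) = vfDeriv (velModel D) Y (energy L) :=
      funext fun w => (dFun_energy_eq_omegaL h.smooth (hΓ2 w) (hYv w)).symm
    have h3 := dFun_energy_eq_omegaL h.smooth (hΓ2 u)
      (mlieBracket_mem_verticalSpace hG hY (fun w => (hGκ w).2) hYv u)
    have h4 : vfDeriv (velModel D) (mlieBracket (velModel D) G Y) (energy L) u
        = omegaL L u (Γ u) (mlieBracket (velModel D) G Y u) := h3
    rw [h2, hbr Y hY, h4] at h1
    linarith
  have hd : ∀ {f : VelPhase D Q → ℝ}, ContMDiff (velModel D) 𝓘(ℝ, ℝ) ∞ f →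
      MDifferentiableAt (velModel D) 𝓘(ℝ, ℝ) f u := fun hf => (hf u).mdifferentiableAt (by simp)
  have h1 : vfDeriv (velModel D) G (fun u => betaForm L Γ u (C u)) u
      = vfDeriv (velModel D) G (vfDeriv (velModel D) C (energy L)) u
        - vfDeriv (velModel D) G (fun w => omegaL L w (Γ w) (C w)) u :=
    vfDeriv_sub (hd (ContMDiff.vfDeriv hC hE)) (hd (contMDiff_omegaL h.smooth hΓ hC))
  -- The derivative `G γ` equals `β[Γ]([G, C]) - Ω_L([G, Γ], C)`. The first term vanishes on the
  -- surface because `[G, C]` again projects to `ker M`; the second by splitting `C` and using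
  -- `hvert`.
  have h2 := hu _ _ (hΓ2 u) (mlieBracket_projT_mem_kerHess h.smooth hG hC hGκ hCM u)
  have h3 : omegaL L u (mlieBracket (velModel D) G Γ u) (C u) = 0 := by
    obtain ⟨K, V, hK, hV, hKV⟩ := h.exists_kerOmega_add_vertical (hCM u)
    rw [hKV, map_add, omegaL_right_eq_zero h.smooth hK, hvert V hV, add_zero]
  rw [h1, hbr C hC, vfDeriv_omegaL h.smooth hG hΓ hC (fun w => (hGκ w).1), h3, zero_add]
  exact h2

/-- The vector fields in `𝒢` are tangent to the constraint surface. -/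
theorem vfDeriv_eq_zero_of_eq_zero_on {G : VelField D Q} (hG : IsSmoothVF (velModel D) G)
    (hGκ : ∀ u, G u ∈ verticalKer L u) {f : VelPhase D Q → ℝ}
    (hf : ContMDiff (velModel D) 𝓘(ℝ, ℝ) ∞ f) (hfS : ∀ u ∈ firstConstraintSet L, f u = 0)
    {u : VelPhase D Q} (hu : u ∈ firstConstraintSet L) : vfDeriv (velModel D) G f u = 0 := by
  obtain ⟨k, γ, hγ, hli, hS⟩ := h.regular u hu
  refine mfderiv_eq_zero_of_zeroSet (fun i => (hγ i).contMDiff h.smooth u) hli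
    (fun i => (hγ i).eq_zero hu) (hf u) ?_ fun i => h.vfDeriv_constraintFun_eq_zero hG hGκ (hγ i) hu
  filter_upwards [hS] with w hw h0
  exact hfS w (hw h0)

end IsSingularLagrangian

end ConstraintSurface

/-! ### Brackets of symmetries and of `𝒢` with solutions; tangency of symmetries. -/

noncomputable section SymmetryTransport

open Filter VectorField Module

variable {D : ℕ} {Q : Type*} [TopologicalSpace Q] [ChartedSpace (CoordSpace D) Q]
  [IsManifold (𝓡 D) ∞ Q] {L : VelPhase D Q → ℝ} {N₀ : ℕ}

theorem isGField_iff {G : VelField D Q} :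
    IsGField L G ↔ IsSmoothVF (velModel D) G ∧ ∀ u, G u ∈ verticalKer L u :=
  and_congr smoothField_iff (forall_congr' fun _ => and_comm)

variable [T2Space Q]

theorem mem_kerOmega_of_forall {u : VelPhase D Q} {A : TangentSpace (velModel D) u}
    (h : ∀ Y : VelField D Q, IsSmoothVF (velModel D) Y → omegaL L u A (Y u) = 0) :
    A ∈ kerOmega L u := by
  refine ContinuousLinearMap.ext fun B => ?_
  obtain ⟨Y, hY, rfl⟩ := exists_vectorField_apply_eq u B
  exact h Y hY

/-- `ker Ω_L` is involutive. -/
theorem mlieBracket_mem_kerOmega (hL : ContMDiff (velModel D) 𝓘(ℝ, ℝ) ∞ L) {P Z : VelField D Q}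
    (hP : IsSmoothVF (velModel D) P) (hPκ : ∀ u, P u ∈ kerOmega L u)
    (hZ : IsSmoothVF (velModel D) Z) (hZκ : ∀ u, Z u ∈ kerOmega L u) (u : VelPhase D Q) :
    mlieBracket (velModel D) P Z u ∈ kerOmega L u := by
  refine mem_kerOmega_of_forall fun Y hY => ?_
  have h1 := vfDeriv_omegaL hL hP hZ hY hPκ u
  have h2 : (fun w => omegaL L w (Z w) (Y w)) = fun _ => 0 :=
    funext fun w => omegaL_left_eq_zero (hZκ w) _
  rw [h2, vfDeriv_const, omegaL_left_eq_zero (hZκ u), add_zero] at h1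
  exact h1.symm

omit [T2Space Q] in
/-- The Lie derivative of the constraint one-form along a vector field in `ker Ω_L`. -/
theorem lieForm_betaForm (hL : ContMDiff (velModel D) 𝓘(ℝ, ℝ) ∞ L) {P X Y : VelField D Q}
    (hP : IsSmoothVF (velModel D) P) (hPκ : ∀ u, P u ∈ kerOmega L u)
    (hX : IsSmoothVF (velModel D) X) (hY : IsSmoothVF (velModel D) Y) (u : VelPhase D Q) :
    lieForm P (betaForm L X) Y u = vfDeriv (velModel D) Y (vfDeriv (velModel D) P (energy L)) u
      - omegaL L u (mlieBracket (velModel D) P X u) (Y u) := by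
  have hE := contMDiff_energy hL
  have hd : ∀ {f : VelPhase D Q → ℝ}, ContMDiff (velModel D) 𝓘(ℝ, ℝ) ∞ f →
      MDifferentiableAt (velModel D) 𝓘(ℝ, ℝ) f u := fun hf => (hf u).mdifferentiableAt (by simp)
  have h1 : vfDeriv (velModel D) P (fun u => betaForm L X u (Y u)) u
      = vfDeriv (velModel D) P (vfDeriv (velModel D) Y (energy L)) u
        - vfDeriv (velModel D) P (fun w => omegaL L w (X w) (Y w)) u :=
    vfDeriv_sub (hd (ContMDiff.vfDeriv hY hE)) (hd (contMDiff_omegaL hL hX hY))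
  have h2 := vfDeriv_omegaL hL hP hX hY hPκ u
  have h3 := vfDeriv_mlieBracket hP hY hE u
  have h4 : lieForm P (betaForm L X) Y u = vfDeriv (velModel D) P (fun u => betaForm L X u (Y u)) u
      - (vfDeriv (velModel D) (mlieBracket (velModel D) P Y) (energy L) u
        - omegaL L u (X u) (mlieBracket (velModel D) P Y u)) := rfl
  linarith

variable {W : Set (VelPhase D Q)} {β₀ : VelForm D Q}

omit [T2Space Q] in
theorem isSol_univ_iff {X : VelField D Q} : IsSol L W β₀ univ X ↔
    IsSmoothVF (velModel D) X ∧ ∀ u ∈ W, betaForm L X u = β₀ u := by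
  rw [← smoothField_iff, IsSol]
  simp only [univ_inter]

omit [T2Space Q] in
theorem IsSym.isSmoothVF {P : VelField D Q} (hP : IsSym L W β₀ P) : IsSmoothVF (velModel D) P :=
  smoothField_iff.1 hP.1.1

omit [T2Space Q] in
theorem IsSym.mem_kerOmega {P : VelField D Q} (hP : IsSym L W β₀ P) (u : VelPhase D Q) :
    P u ∈ kerOmega L u := hP.1.2.1 u

/-- The infinitesimal form of the symmetry condition: since `Ω_L(X, P) = 0`, the term `d(P E)`
occurs on both sides, and only `i_{[P,X]} Ω_L = 0` remains. -/
theorem IsSym.mlieBracket_mem_kerOmega (hL : ContMDiff (velModel D) 𝓘(ℝ, ℝ) ∞ L)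
    {P X : VelField D Q} (hP : IsSym L W β₀ P) (hX : IsSol L W β₀ univ X) {u : VelPhase D Q}
    (hu : u ∈ W) : mlieBracket (velModel D) P X u ∈ kerOmega L u := by
  refine mem_kerOmega_of_forall fun Y hY => ?_
  have h1 := hP.2 X hX Y (smoothField_iff.2 hY) u hu
  have hXs := (isSol_univ_iff.1 hX).1
  rw [lieForm_betaForm hL hP.isSmoothVF hP.mem_kerOmega hXs hY] at h1
  have h2 : (fun w => betaForm L X w (P w)) = vfDeriv (velModel D) P (energy L) := by
    funext w
    have h3 : betaForm L X w (P w) = dFun (energy L) w (P w) - omegaL L w (X w) (P w) := rfl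
    rw [h3, omegaL_right_eq_zero hL (hP.mem_kerOmega w), sub_zero]
    rfl
  rw [h2] at h1
  have h4 : vfDeriv (velModel D) Y (vfDeriv (velModel D) P (energy L)) u
      = dFun (vfDeriv (velModel D) P (energy L)) u (Y u) := rfl
  linarith

theorem IsSym.mlieBracket_mem_verticalKer (hL : ContMDiff (velModel D) 𝓘(ℝ, ℝ) ∞ L)
    {P G : VelField D Q} (hP : IsSym L W β₀ P) (hG : IsSmoothVF (velModel D) G)
    (hGκ : ∀ u, G u ∈ verticalKer L u) (u : VelPhase D Q) :
    mlieBracket (velModel D) P G u ∈ verticalKer L u := by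
  refine ⟨_root_.mlieBracket_mem_kerOmega hL hP.isSmoothVF hP.mem_kerOmega hG
    (fun w => (hGκ w).1) u, ?_⟩
  have h1 : projT u (mlieBracket (velModel D) G P u) = 0 := hP.1.2.2 G (isGField_iff.2 ⟨hG, hGκ⟩) u
  have h2 : projT u (mlieBracket (velModel D) P G u) = 0 := by
    rw [mlieBracket_swap_apply, map_neg, h1, neg_zero]
  exact h2

namespace IsSingularLagrangian

variable (h : IsSingularLagrangian L N₀)
include h

/-- As `G E = 0`, the Lie derivative of `β[X]` along `G` is `-i_{[G,X]} Ω_L`. It vanishes on `W`: by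
the assumption on `β₀` if `W` is everything, and by tangency of `G` if `β[X]` vanishes on the
constraint surface. -/
theorem mlieBracket_mem_verticalKer (hW : IsConstraintData L W β₀) {G X : VelField D Q}
    (hG : IsSmoothVF (velModel D) G) (hGκ : ∀ u, G u ∈ verticalKer L u)
    (hX : IsSolBar L W β₀ univ X) {u : VelPhase D Q} (hu : u ∈ W) :
    mlieBracket (velModel D) G X u ∈ verticalKer L u := by
  have hG' : IsGField L G := isGField_iff.2 ⟨hG, hGκ⟩
  obtain ⟨hXs, hXβ⟩ := isSol_univ_iff.1 hX.1
  refine ⟨mem_kerOmega_of_forall fun Y hY => ?_, hX.2 G hG' u ⟨mem_univ u, hu⟩⟩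
  have h1 := lieForm_betaForm h.smooth hG (fun w => (hGκ w).1) hXs hY u
  have h2 : vfDeriv (velModel D) G (energy L) = fun _ => 0 :=
    funext fun w => dFun_energy_eq_zero_of_mem_verticalKer h.smooth (hGκ w)
  have h3 : lieForm G (betaForm L X) Y u = 0 := by
    rcases hW with ⟨rfl, hβ⟩ | ⟨rfl, -, hβ⟩
    · have hβX : ∀ w ∈ firstConstraintSet L, betaForm L X w = 0 := fun w hw =>
        (hXβ w hw).trans (hβ w)
      have h4 : lieForm G (betaForm L X) Y u
          = vfDeriv (velModel D) G (fun w => betaForm L X w (Y w)) u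
            - betaForm L X u (mlieBracket (velModel D) G Y u) := rfl
      have h5 := h.vfDeriv_eq_zero_of_eq_zero_on hG hGκ
        (contMDiff_betaForm h.smooth hXs hY) (fun w hw => by rw [hβX w hw]; rfl) hu
      have h6 : betaForm L X u (mlieBracket (velModel D) G Y u) = 0 := by
        rw [hβX u hu]
        rfl
      rw [h4, h5, h6, sub_zero]
    · have h4 : betaForm L X = β₀ := funext fun w => hXβ w (mem_univ w)
      rw [h4]
      exact hβ G Y hG' (smoothField_iff.2 hY) u
  rw [h3, h2, vfDeriv_const] at h1
  linarith

omit [T2Space Q] in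
-- The kernel has dimension `2 N₀ < 2 D`, so `Ω_L` is nowhere zero; the perturbation argument for
-- tangency needs this.
theorem exists_notMem_kerOmega (u : VelPhase D Q) :
    ∃ V : TangentSpace (velModel D) u, V ∉ kerOmega L u := by
  by_contra! hc
  have h1 : kerOmega L u = (⊤ : Submodule ℝ (CoordSpace D × CoordSpace D)) :=
    Submodule.eq_top_iff'.2 hc
  have h2 := h.finrank_kerOmega u
  have h3 : Module.finrank ℝ (⊤ : Submodule ℝ (CoordSpace D × CoordSpace D)) = 2 * N₀ :=
    (congrArg (fun S : Submodule ℝ (CoordSpace D × CoordSpace D) => finrank ℝ S) h1).symm.trans h2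
  rw [finrank_top, finrank_prod, finrank_euclideanSpace_fin] at h3
  have := h.lt_dim
  omega

/-- The representatives of `Sym` are tangent to the constraint surface. -/
theorem _root_.IsSym.vfDeriv_eq_zero_of_eq_zero_on {P X : VelField D Q}
    (hP : IsSym L (firstConstraintSet L) β₀ P) (hX : IsSol L (firstConstraintSet L) β₀ univ X)
    {f : VelPhase D Q → ℝ} (hf : ContMDiff (velModel D) 𝓘(ℝ, ℝ) ∞ f)
    (hfS : ∀ u ∈ firstConstraintSet L, f u = 0) {u : VelPhase D Q}
    (hu : u ∈ firstConstraintSet L) : vfDeriv (velModel D) P f u = 0 := by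
  obtain ⟨V₀, hV₀⟩ := h.exists_notMem_kerOmega u
  obtain ⟨V, hV, rfl⟩ := exists_vectorField_apply_eq u V₀
  obtain ⟨hXs, hXβ⟩ := isSol_univ_iff.1 hX
  have hfV : IsSmoothVF (velModel D) (f • V) := hf.smul_section hV
  -- A perturbation that vanishes on the surface does not affect the solution property. Comparing
  -- `[P, X]` with `[P, X + f V]` leaves `(P f) V + f [P, V]` in `ker Ω_L`, and `V` is not in it at
  -- `u`.
  have hX' : IsSol L (firstConstraintSet L) β₀ univ (X + f • V) := by
    refine isSol_univ_iff.2 ⟨hXs.add_section hfV, fun w hw => ?_⟩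
    rw [← hXβ w hw, betaForm, betaForm, Pi.add_apply, Pi.smul_apply', hfS w hw, zero_smul, add_zero]
  have hd : ∀ {Y : VelField D Q}, IsSmoothVF (velModel D) Y → MDifferentiableAt (velModel D)
      (velModel D).tangent (fun w => (⟨w, Y w⟩ : TangentBundle (velModel D) (VelPhase D Q))) u :=
    fun hY => (hY u).mdifferentiableAt (by simp)
  have h1 := hP.mlieBracket_mem_kerOmega h.smooth hX hu
  have h2 := hP.mlieBracket_mem_kerOmega h.smooth hX' hu
  rw [mlieBracket_add_right (hd hXs) (hd hfV), Submodule.add_mem_iff_right _ h1,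
    mlieBracket_smul_right ((hf u).mdifferentiableAt (by simp)) (hd hV), hfS u hu, zero_smul,
    add_zero] at h2
  by_contra hne
  exact hV₀ ((Submodule.smul_mem_iff _ hne).1 h2)

end IsSingularLagrangian

end SymmetryTransport

/-! ### Integrated consequences along the flow of a symmetry. -/

noncomputable section SymmetryFlows

open Filter VectorField Module

variable {D : ℕ} {Q : Type*} [TopologicalSpace Q] [T2Space Q] [ChartedSpace (CoordSpace D) Q]
  [IsManifold (𝓡 D) ∞ Q] {L : VelPhase D Q → ℝ} {N₀ : ℕ} {W : Set (VelPhase D Q)}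
  {β₀ : VelForm D Q} {P X : VelField D Q} {a b : ℝ} {U : Set (VelPhase D Q)}
  {φ : ℝ → VelPhase D Q → VelPhase D Q}

omit [T2Space Q] in
theorem IsLocalFlow.isSmoothLocalFlow (hφ : IsLocalFlow P a b U φ) :
    IsSmoothLocalFlow (velModel D) P a b U φ :=
  ⟨hφ.1, hφ.2.1, hφ.2.2.1, hφ.2.2.2.1, fun u hu => (hφ.2.2.2.2 u hu).1,
    fun u hu => (hφ.2.2.2.2 u hu).2⟩

namespace IsSingularLagrangian

variable (h : IsSingularLagrangian L N₀) (hP : IsSym L W β₀ P)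
  (hφ : IsSmoothLocalFlow (velModel D) P a b U φ)
include h hP hφ

/-- The set `W` is invariant under the flow of a symmetry. -/
theorem flow_mem_iff (hW : IsConstraintData L W β₀) (hX : IsSol L W β₀ univ X) {u : VelPhase D Q}
    (hu : u ∈ U) {ε : ℝ} (hε : ε ∈ Ioo a b) : φ ε u ∈ W ↔ u ∈ W := by
  rcases hW with ⟨rfl, -⟩ | ⟨rfl, -⟩
  · have h1 := (hφ.curve u hu).mem_zeroSet_iff hP.isSmoothVF h.isClosed_firstConstraintSet ?_
      hε hφ.zero_mem
    · simpa only [hφ.zero u hu] using h1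
    · intro p hp
      obtain ⟨k, γ, hγ, hli, hS⟩ := h.regular p hp
      exact ⟨k, γ, fun i => (hγ i).contMDiff h.smooth, hli, fun i w hw => ⟨(hγ i).eq_zero hw,
        hP.vfDeriv_eq_zero_of_eq_zero_on h hX ((hγ i).contMDiff h.smooth)
          (fun _ => (hγ i).eq_zero) hw⟩, hS⟩
  · exact iff_of_true (mem_univ _) (mem_univ _)

/-- Transport of `ker Ω_L`: the difference is zero at parameter `0`, and the flow line stays in `W`,
where `[P, X]` lies in `ker Ω_L`. -/
theorem mfderiv_flow_sub_mem_kerOmega (hW : IsConstraintData L W β₀) (hX : IsSol L W β₀ univ X)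
    {u : VelPhase D Q} (hu : u ∈ U) (huW : u ∈ W) {ε : ℝ} (hε : ε ∈ Ioo a b) :
    mfderiv (velModel D) (velModel D) (φ ε) u (X u) - X (φ ε u) ∈ kerOmega L (φ ε u) := by
  refine (hφ.mem_distribution hP.isSmoothVF h.isSmoothDistribution_kerOmega
    (fun Z hZ hZκ w => mlieBracket_mem_kerOmega h.smooth hP.isSmoothVF hP.mem_kerOmega hZ hZκ w)
    hu (X u) (isSol_univ_iff.1 hX).1
    (fun s hs => hP.mlieBracket_mem_kerOmega h.smooth hX
      ((h.flow_mem_iff hP hφ hW hX hu hs).2 huW)) hε hφ.zero_mem).2 ?_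
  have h1 : (X (φ 0 u) : CoordSpace D × CoordSpace D) = X u := by rw [hφ.zero u hu]
  have h2 : (mfderiv (velModel D) (velModel D) (φ 0) u (X u) - X (φ 0 u) :
      TangentSpace (velModel D) (φ 0 u)) = (0 : CoordSpace D × CoordSpace D) :=
    sub_eq_zero.2 ((hφ.mfderiv_zero hu (X u)).trans h1.symm)
  rw [h2]
  exact Submodule.zero_mem _

/-- Transport of `verticalKer` with comparison field zero, so that no condition on `W` enters. -/
theorem mfderiv_flow_mem_verticalKer_iff {u : VelPhase D Q} (hu : u ∈ U)
    (A : TangentSpace (velModel D) u) {ε : ℝ} (hε : ε ∈ Ioo a b) :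
    mfderiv (velModel D) (velModel D) (φ ε) u A ∈ verticalKer L (φ ε u) ↔ A ∈ verticalKer L u := by
  have h1 := hφ.mem_distribution hP.isSmoothVF h.isSmoothDistribution_verticalKer
    (fun Z hZ hZκ w => hP.mlieBracket_mem_verticalKer h.smooth hZ hZκ w) hu A
    IsSmoothLocalFlow.isSmoothVF_zero (by
      intro s _
      have : (fun _ => 0 : VelField D Q) = 0 := rfl
      rw [this, mlieBracket_zero_right]
      exact Submodule.zero_mem _) hε hφ.zero_mem
  rw [sub_zero, sub_zero] at h1
  rw [h1]
  have h2 : ∀ (w : VelPhase D Q) (B : TangentSpace (velModel D) w), w = u →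
      (B : CoordSpace D × CoordSpace D) = A → (B ∈ verticalKer L w ↔ A ∈ verticalKer L u) := by
    rintro w B rfl rfl
    rfl
  exact h2 _ _ (hφ.zero u hu) (hφ.mfderiv_zero hu A)

end IsSingularLagrangian

end SymmetryFlows

/-! ### Pushforwards of second-order Euler-Lagrange fields. -/

noncomputable section SymmetryPushforward

open Filter VectorField Module

theorem Set.InjOn.exists_leftInvOn {α β : Type*} [Nonempty α] {f : α → β} {s : Set α}
    (hf : InjOn f s) : ∃ g : β → α, LeftInvOn g f s :=
  ⟨Function.invFunOn f s, hf.leftInvOn_invFunOn⟩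

section Pullback

variable {E H M : Type*} [NormedAddCommGroup E] [NormedSpace ℝ E]
  [TopologicalSpace H] {I : ModelWithCorners ℝ E H} [TopologicalSpace M] [ChartedSpace H M]

/-- The pullback by the inverse of a local diffeomorphism is the pushforward. -/
theorem mpullback_leftInv_apply {f g : M → M} {u : M} (hf : MDifferentiableAt I I f u)
    (hf' : (mfderiv I I f u).IsInvertible) (hg : MDifferentiableAt I I g (f u))
    (hgf : ∀ᶠ w in 𝓝 u, g (f w) = w) (Z : (u : M) → TangentSpace I u) :
    mpullback I I g Z (f u) = mfderiv I I f u (Z u) := by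
  have hi := isInvertible_mfderiv_leftInv hf hf' hg hgf
  apply hi.injective
  refine (hi.self_apply_inverse (Z (g (f u)))).trans ?_
  have h1 : (Z (g (f u)) : E) = Z u := by rw [hgf.self_of_nhds]
  exact h1.trans (mfderiv_leftInv_apply hf hg hgf (Z u)).symm

end Pullback

variable {D : ℕ} {Q : Type*} [TopologicalSpace Q] [T2Space Q] [ChartedSpace (CoordSpace D) Q]
  [IsManifold (𝓡 D) ∞ Q] {L : VelPhase D Q → ℝ} {N₀ : ℕ} {W : Set (VelPhase D Q)}
  {β₀ : VelForm D Q} {P X : VelField D Q} {a b : ℝ} {U : Set (VelPhase D Q)}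
  {φ : ℝ → VelPhase D Q → VelPhase D Q}

namespace IsSingularLagrangian

variable (h : IsSingularLagrangian L N₀) (hP : IsSym L W β₀ P)
  (hφ : IsSmoothLocalFlow (velModel D) P a b U φ)
include h hP hφ

/-- The flow of a symmetry pulls back the elements of `𝒢`, near each point, to elements of `𝒢`. -/
theorem exists_pullback_mem_verticalKer {ε : ℝ} (hε : ε ∈ Ioo a b) {u : VelPhase D Q} (hu : u ∈ U)
    {G : VelField D Q} (hG : IsSmoothVF (velModel D) G) (hGκ : ∀ w, G w ∈ verticalKer L w) :
    ∃ G' : VelField D Q, IsSmoothVF (velModel D) G' ∧ (∀ w, G' w ∈ verticalKer L w) ∧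
      ∀ᶠ w in 𝓝 u, mfderiv (velModel D) (velModel D) (φ ε) w (G' w) = G (φ ε w) := by
  have : IsManifold (velModel D) (∞ + 1) (VelPhase D Q) := by
    simpa using (inferInstance : IsManifold (velModel D) ∞ (VelPhase D Q))
  let Z : VelField D Q := mpullback (velModel D) (velModel D) (φ ε) G
  have hZ : ∀ w ∈ U, mfderiv (velModel D) (velModel D) (φ ε) w (Z w) = G (φ ε w) := fun w hw =>
    (hφ.isInvertible_mfderiv hP.isSmoothVF hw hε).self_apply_inverse _
  have hZs : ∀ w ∈ U, ContMDiffAt (velModel D) (velModel D).tangent ∞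
      (fun u => (⟨u, Z u⟩ : TangentBundle (velModel D) (VelPhase D Q))) w := fun w hw =>
    ContMDiffAt.mpullback_vectorField_preimage (n := ∞) (hG _) (hφ.contMDiffAt_map hε hw)
      (hφ.isInvertible_mfderiv hP.isSmoothVF hw hε) (by simp)
  obtain ⟨χ, hχ1, hχ0, hχ⟩ := exists_cutoff_vectorField (hφ.isOpen.mem_nhds hu) hZs
  refine ⟨fun w => χ w • Z w, hχ, fun w => ?_, ?_⟩
  · by_cases hw : w ∈ U
    · refine Submodule.smul_mem _ _ ((h.mfderiv_flow_mem_verticalKer_iff hP hφ hw _ hε).1 ?_)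
      rw [hZ w hw]
      exact hGκ _
    · have h0 : χ w • Z w = 0 := by rw [hχ0 w hw, zero_smul]
      exact (congrArg (· ∈ verticalKer L w) h0).mpr (Submodule.zero_mem _)
  · filter_upwards [hχ1, hφ.isOpen.mem_nhds hu] with w h1 hw
    rw [h1, one_smul, hZ w hw]

/-- The added multiple of `P` anticipates a time-dependent parameter: `P` lies in `ker Ω_L` and its
brackets with `𝒢` are vertical, so both defining conditions survive. -/
theorem exists_isSolBar_pushforward (hW : IsConstraintData L W β₀) (hX : IsSolBar L W β₀ univ X)
    {ε : ℝ} (hε : ε ∈ Ioo a b) (s : ℝ) : ∃ Y, IsSolBar L W β₀ (φ ε '' U) Y ∧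
      ∀ u ∈ U, Y (φ ε u) = push (φ ε) u (X u) + s • P (φ ε u) := by
  -- A left inverse of `φ ε` on `U` needs some default value off the image; for empty `U` the
  -- conditions are void.
  rcases U.eq_empty_or_nonempty with rfl | ⟨u₀, -⟩
  · refine ⟨X, ?_, by simp⟩
    simp only [image_empty]
    exact ⟨⟨hX.1.1.mono (empty_subset _), by simp⟩, by simp⟩
  have : Nonempty (VelPhase D Q) := ⟨u₀⟩
  have : IsManifold (velModel D) (∞ + 1) (VelPhase D Q) := by
    simpa using (inferInstance : IsManifold (velModel D) ∞ (VelPhase D Q))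
  have : IsManifold (velModel D) (minSmoothness ℝ 2) (VelPhase D Q) :=
    .of_le minSmoothness_two_le_infty
  obtain ⟨ψ, hψ⟩ := (hφ.injOn hP.isSmoothVF hε).exists_leftInvOn
  obtain ⟨hXs, hXβ⟩ := isSol_univ_iff.1 hX.1
  have hf : ∀ u ∈ U, ContMDiffAt (velModel D) (velModel D) ∞ (φ ε) u := fun u hu =>
    hφ.contMDiffAt_map hε hu
  have hf' : ∀ u ∈ U, (mfderiv (velModel D) (velModel D) (φ ε) u).IsInvertible := fun u hu =>
    hφ.isInvertible_mfderiv hP.isSmoothVF hu hε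
  have hψs : ∀ u ∈ U, ContMDiffAt (velModel D) (velModel D) ∞ ψ (φ ε u) := fun u hu =>
    contMDiffAt_of_leftInvOn hφ.isOpen hf hf' hψ hu
  have hψφ : ∀ u ∈ U, ∀ᶠ w in 𝓝 u, ψ (φ ε w) = w := fun u hu => by
    filter_upwards [hφ.isOpen.mem_nhds hu] with w hw
    exact hψ hw
  have hfd : ∀ u ∈ U, MDifferentiableAt (velModel D) (velModel D) (φ ε) u := fun u hu =>
    (hf u hu).mdifferentiableAt (by simp)
  have hψd : ∀ u ∈ U, MDifferentiableAt (velModel D) (velModel D) ψ (φ ε u) := fun u hu =>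
    (hψs u hu).mdifferentiableAt (by simp)
  have hpush : ∀ Z : VelField D Q, ∀ u ∈ U, mpullback (velModel D) (velModel D) ψ Z (φ ε u)
      = mfderiv (velModel D) (velModel D) (φ ε) u (Z u) := fun Z u hu =>
    mpullback_leftInv_apply (hfd u hu) (hf' u hu) (hψd u hu) (hψφ u hu) Z
  let Y₀ : VelField D Q := mpullback (velModel D) (velModel D) ψ X
  have hY₀s : ∀ u ∈ U, ContMDiffAt (velModel D) (velModel D).tangent ∞
      (fun w => (⟨w, Y₀ w⟩ : TangentBundle (velModel D) (VelPhase D Q))) (φ ε u) := fun u hu =>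
    ContMDiffAt.mpullback_vectorField_preimage (n := ∞) (hXs _) (hψs u hu)
      (isInvertible_mfderiv_leftInv (hfd u hu) (hf' u hu) (hψd u hu) (hψφ u hu)) (by simp)
  have hsP : IsSmoothVF (velModel D) (s • P) := contMDiff_const.smul_section hP.isSmoothVF
  have hY : ∀ u ∈ U, (Y₀ + s • P) (φ ε u) = push (φ ε) u (X u) + s • P (φ ε u) := fun u hu =>
    congrArg (· + s • P (φ ε u)) (hpush X u hu)
  refine ⟨Y₀ + s • P, ⟨⟨?_, ?_⟩, ?_⟩, hY⟩
  · rintro _ ⟨u, hu, rfl⟩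
    exact ((hY₀s u hu).add_section (hsP _)).contMDiffWithinAt
  · rintro _ ⟨⟨u, hu, rfl⟩, hw⟩
    have huW := (h.flow_mem_iff hP hφ hW hX.1 hu hε).1 hw
    have h1 := h.mfderiv_flow_sub_mem_kerOmega hP hφ hW hX.1 hu huW hε
    -- The new field differs from `X` by an element of `ker Ω_L` at a point of `W`, so `β` does not
    -- distinguish them.
    have h2 : (Y₀ + s • P) (φ ε u) - X (φ ε u) ∈ kerOmega L (φ ε u) := by
      rw [hY u hu, add_sub_right_comm]
      exact Submodule.add_mem _ h1 (Submodule.smul_mem _ _ (hP.mem_kerOmega _))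
    have h3 : omegaL L (φ ε u) ((Y₀ + s • P) (φ ε u)) = omegaL L (φ ε u) (X (φ ε u)) := by
      rw [← sub_eq_zero, ← map_sub]
      exact h2
    rw [← hXβ _ hw, betaForm, betaForm, h3]
  · rintro G hG _ ⟨⟨u, hu, rfl⟩, hw⟩
    have huW := (h.flow_mem_iff hP hφ hW hX.1 hu hε).1 hw
    obtain ⟨hGs, hGκ⟩ := isGField_iff.1 hG
    obtain ⟨G', hG's, hG'κ, hG'⟩ := h.exists_pullback_mem_verticalKer hP hφ hε hu hGs hGκ
    have hev : G =ᶠ[𝓝 (φ ε u)] mpullback (velModel D) (velModel D) ψ G' := by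
      have hψt : Tendsto ψ (𝓝 (φ ε u)) (𝓝 u) := by
        have := (hψs u hu).continuousAt.tendsto
        rwa [hψ hu] at this
      filter_upwards [(hφ.isOpen_image hP.isSmoothVF hε).mem_nhds (mem_image_of_mem _ hu),
        hψt.eventually hG']
      rintro _ ⟨w, hwU, rfl⟩ h1
      rw [hψ hwU] at h1
      rw [hpush G' w hwU, h1]
    -- Near `φ ε u`, the field `G` is the pushforward of `G'`, so naturality gives the bracket as
    -- the pushforward of `[G', X]`.
    have h1 : mlieBracket (velModel D) G Y₀ (φ ε u)
        = mfderiv (velModel D) (velModel D) (φ ε) u (mlieBracket (velModel D) G' X u) := by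
      have e1 : mlieBracket (velModel D) G Y₀ (φ ε u)
          = mlieBracket (velModel D) (mpullback (velModel D) (velModel D) ψ G') Y₀ (φ ε u) :=
        Filter.EventuallyEq.mlieBracket_vectorField_eq hev Filter.EventuallyEq.rfl
      have e2 := mpullback_mlieBracket (n := ∞) ((hG's (ψ (φ ε u))).mdifferentiableAt (by simp))
        ((hXs _).mdifferentiableAt (by simp)) (hψs u hu) minSmoothness_two_le_infty
      exact e1.trans (e2.symm.trans (hpush _ u hu))
    -- Verticality of `[G', X]` alone would not be carried over by the flow; its membership in `ker
    -- Ω_L` is essential.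
    have h2 := (h.mfderiv_flow_mem_verticalKer_iff hP hφ hu _ hε).2
      (h.mlieBracket_mem_verticalKer hW hG's hG'κ hX huW)
    have h3 : projT (φ ε u) (mlieBracket (velModel D) G P (φ ε u)) = 0 := hP.1.2.2 G hG _
    have h4 : projT (φ ε u) (mlieBracket (velModel D) G Y₀ (φ ε u)) = 0 := by
      rw [h1]
      exact h2.2
    have h5 : mlieBracket (velModel D) G (Y₀ + s • P) (φ ε u)
        = mlieBracket (velModel D) G Y₀ (φ ε u) + s • mlieBracket (velModel D) G P (φ ε u) := by
      rw [mlieBracket_add_right ((hY₀s u hu).mdifferentiableAt (by simp))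
        ((hsP _).mdifferentiableAt (by simp)),
        mlieBracket_const_smul_right ((hP.isSmoothVF _).mdifferentiableAt (by simp))]
    have h6 : projT (φ ε u) (mlieBracket (velModel D) G (Y₀ + s • P) (φ ε u)) = 0 := by
      rw [h5, map_add, map_smul, h3, h4, smul_zero, add_zero]
    exact h6

end IsSingularLagrangian

end SymmetryPushforward

/-! ### The transformation group and the main theorem. -/

noncomputable section SymmetryGroup

open Filter VectorField Module

variable {D : ℕ} {Q : Type*} [TopologicalSpace Q] [T2Space Q] [ChartedSpace (CoordSpace D) Q]
  [IsManifold (𝓡 D) ∞ Q] {L : VelPhase D Q → ℝ} {N₀ : ℕ} {W : Set (VelPhase D Q)}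
  {β₀ : VelForm D Q} {P X : VelField D Q} {φ : ℝ → VelPhase D Q → VelPhase D Q}

omit [T2Space Q] in
theorem IsFlow.isSmoothLocalFlow (hφ : IsFlow P φ) {a b : ℝ} (ha : a < 0) (hb : 0 < b) :
    IsSmoothLocalFlow (velModel D) P a b univ φ :=
  IsLocalFlow.isSmoothLocalFlow ⟨ha, hb, isOpen_univ, hφ.1.contMDiffOn,
    fun u _ => ⟨(hφ.2 u).1, (hφ.2 u).2.isMIntegralCurveOn _⟩⟩

theorem IsFlow.apply_add (hφ : IsFlow P φ) (hP : IsSmoothVF (velModel D) P) (s ε : ℝ)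
    (u : VelPhase D Q) : φ (s + ε) u = φ s (φ ε u) := by
  have : IsManifold (velModel D) 1 (VelPhase D Q) := .of_le (n := ∞) (by simp)
  have h := isMIntegralCurve_Ioo_eq_of_contMDiff_boundaryless (t₀ := 0) (hP.of_le (by simp))
    ((hφ.2 u).2.comp_add ε) (hφ.2 (φ ε u)).2 (by simp [(hφ.2 (φ ε u)).1])
  exact congrFun h s

theorem IsFlow.apply_neg_apply (hφ : IsFlow P φ) (hP : IsSmoothVF (velModel D) P) (ε : ℝ)
    (u : VelPhase D Q) : φ (-ε) (φ ε u) = u := by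
  rw [← hφ.apply_add hP, neg_add_cancel, (hφ.2 u).1]

/-- A smooth map whose pushforward preserves the second-order Euler-Lagrange vector fields. -/
def PreservesSolBar (L : VelPhase D Q → ℝ) (W : Set (VelPhase D Q)) (β₀ : VelForm D Q)
    (σ : VelPhase D Q → VelPhase D Q) : Prop :=
  ContMDiff (velModel D) (velModel D) ∞ σ ∧ ∀ X, IsSolBar L W β₀ univ X →
    ∃ Y, IsSolBar L W β₀ univ Y ∧ ∀ u, Y (σ u) = push σ u (X u)

namespace PreservesSolBar

variable {σ τ : VelPhase D Q → VelPhase D Q}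

omit [T2Space Q] in
theorem id : PreservesSolBar L W β₀ (fun u => u) :=
  ⟨contMDiff_id, fun X hX => ⟨X, hX, fun u =>
    (congrArg (fun A : TangentSpace (velModel D) u →L[ℝ] TangentSpace (velModel D) u => A (X u))
      (mfderiv_id (I := velModel D) (x := u))).symm⟩⟩

omit [T2Space Q] in
theorem comp (hσ : PreservesSolBar L W β₀ σ) (hτ : PreservesSolBar L W β₀ τ) :
    PreservesSolBar L W β₀ (fun u => σ (τ u)) := by
  refine ⟨hσ.1.comp hτ.1, fun X hX => ?_⟩
  obtain ⟨Y, hY, hYX⟩ := hτ.2 X hX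
  obtain ⟨Z, hZ, hZY⟩ := hσ.2 Y hY
  refine ⟨Z, hZ, fun u => (hZY (τ u)).trans ?_⟩
  rw [hYX]
  exact (mfderiv_comp_apply u ((hσ.1 _).mdifferentiableAt (by simp))
    ((hτ.1 u).mdifferentiableAt (by simp)) (X u)).symm

omit [T2Space Q] in
theorem mapsTo_orbitEL (hσ : PreservesSolBar L W β₀ σ) (T : Set ℝ) (t₀ : ℝ) (u₀ : VelPhase D Q) :
    MapsTo (fun c t => σ (c t)) (orbitEL L W β₀ T t₀ u₀) (orbitEL L W β₀ T t₀ (σ u₀)) := by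
  rintro c ⟨rfl, X, hX, hc⟩
  obtain ⟨Y, hY, hYX⟩ := hσ.2 X hX
  refine ⟨rfl, Y, hY, fun t ht => ?_⟩
  have h := ((hσ.1 (c t)).mdifferentiableAt (by simp)).hasMFDerivAt.comp_hasMFDerivWithinAt t
    (hc t ht)
  have h1 : ((mfderiv (velModel D) (velModel D) σ (c t)).comp
      ((1 : ℝ →L[ℝ] ℝ).smulRight (X (c t))) : ℝ →L[ℝ] TangentSpace (velModel D) (σ (c t)))
      = (1 : ℝ →L[ℝ] ℝ).smulRight (push σ (c t) (X (c t))) := by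
    ext
    simp [push]
  rw [hYX, ← h1]
  exact h

end PreservesSolBar

namespace IsSingularLagrangian

variable (h : IsSingularLagrangian L N₀) (hP : IsSym L W β₀ P) (hW : IsConstraintData L W β₀)
include h hP hW

theorem preservesSolBar_flow (hφ : IsFlow P φ) (ε : ℝ) : PreservesSolBar L W β₀ (φ ε) := by
  have hε := abs_lt.1 (lt_add_one |ε|)
  have hε0 : 0 < |ε| + 1 := by positivity
  -- A global flow is a local flow over the whole space on a symmetric interval; the bound `|ε| + 1`
  -- places `ε` strictly inside it and makes it nonempty even for `ε = 0`.
  have hl := hφ.isSmoothLocalFlow (neg_lt_zero.2 hε0) hε0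
  refine ⟨fun u => hl.contMDiffAt_map hε (mem_univ u), fun X hX => ?_⟩
  obtain ⟨Y, hY, hYX⟩ := h.exists_isSolBar_pushforward hP hl hW hX hε 0
  have himg : φ ε '' univ = univ := by
    refine image_univ_of_surjective fun u => ⟨φ (-ε) u, ?_⟩
    have := hφ.apply_neg_apply hP.isSmoothVF (-ε) u
    rwa [neg_neg] at this
  rw [himg] at hY
  exact ⟨Y, hY, fun u => by rw [hYX u (mem_univ u), zero_smul, add_zero]⟩

omit hP in
-- The induction carries `σ` and its inverse together: on generators the inverse is the flow at
-- `-ε`, and closure under inversion is then a mere exchange.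
theorem preservesSolBar_of_mem_grSym {σ : Equiv.Perm (VelPhase D Q)} (hσ : σ ∈ GrSym L W β₀) :
    PreservesSolBar L W β₀ σ ∧ PreservesSolBar L W β₀ σ.symm := by
  induction hσ using Subgroup.closure_induction with
  | mem σ hσ =>
    obtain ⟨P, φ, ε, hP, hφ, hσ⟩ := hσ
    have h1 : ⇑σ = φ ε := funext hσ
    have h2 : ⇑σ.symm = φ (-ε) := funext fun u => by
      obtain ⟨w, rfl⟩ := σ.surjective u
      rw [σ.symm_apply_apply, hσ, hφ.apply_neg_apply hP.isSmoothVF]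
    rw [h1, h2]
    exact ⟨h.preservesSolBar_flow hP hW hφ ε, h.preservesSolBar_flow hP hW hφ (-ε)⟩
  | one => exact ⟨.id, .id⟩
  | mul σ τ _ _ hσ hτ => exact ⟨hσ.1.comp hτ.1, hτ.2.comp hσ.2⟩
  | inv σ _ hσ => exact ⟨hσ.2, hσ.1⟩

omit hP in
-- Surjectivity comes from the inverse transformation, which also preserves the Euler-Lagrange
-- fields and hence carries orbits back.
theorem bijOn_orbitEL {σ : Equiv.Perm (VelPhase D Q)} (hσ : σ ∈ GrSym L W β₀) (T : Set ℝ) (t₀ : ℝ)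
    (u₀ : VelPhase D Q) :
    BijOn (fun c t => σ (c t)) (orbitEL L W β₀ T t₀ u₀) (orbitEL L W β₀ T t₀ (σ u₀)) := by
  obtain ⟨h1, h2⟩ := h.preservesSolBar_of_mem_grSym hW hσ
  refine ⟨h1.mapsTo_orbitEL T t₀ u₀, fun c _ d _ hcd => funext fun t =>
    σ.injective (congrFun hcd t), fun c hc => ⟨fun t => σ.symm (c t), ?_, ?_⟩⟩
  · have := h2.mapsTo_orbitEL T t₀ _ hc
    rwa [σ.symm_apply_apply] at this
  · exact funext fun t => σ.apply_symm_apply (c t)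

end IsSingularLagrangian

end SymmetryGroup

theorem mainTheorem3 {D : ℕ} {Q : Type*} [TopologicalSpace Q] [T2Space Q]
    [SecondCountableTopology Q] [ChartedSpace (CoordSpace D) Q] [IsManifold (𝓡 D) ∞ Q]
    (L : VelPhase D Q → ℝ) (N₀ : ℕ) (hL : IsSingularLagrangian L N₀)
    (W : Set (VelPhase D Q)) (β₀ : VelForm D Q) (hW : IsConstraintData L W β₀) :
    -- the group generated by the one-parameter subgroups
    (∀ σ ∈ GrSym L W β₀,
      ContMDiff (velModel D) (velModel D) ∞ σ ∧
      (∀ X, IsSolBar L W β₀ univ X →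
        ∃ Y, IsSolBar L W β₀ univ Y ∧ ∀ u, Y (σ u) = push σ u (X u)) ∧
      ∀ (T : Set ℝ) (t₀ : ℝ) (u₀ : VelPhase D Q), IsOpen T → T.OrdConnected → t₀ ∈ T →
        BijOn (fun c t => σ (c t)) (orbitEL L W β₀ T t₀ u₀) (orbitEL L W β₀ T t₀ (σ u₀))) ∧
    -- local flows, with a parameter that may depend on time
    (∀ (P : VelField D Q) (a b : ℝ) (U : Set (VelPhase D Q))
        (φ : ℝ → VelPhase D Q → VelPhase D Q),
      IsSym L W β₀ P → IsLocalFlow P a b U φ →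
      (∀ ε ∈ Ioo a b, IsOpen (φ ε '' U) ∧ InjOn (φ ε) U) ∧
      ∀ (X : VelField D Q) (T : Set ℝ) (t₀ : ℝ) (u₀ : VelPhase D Q) (c : ℝ → VelPhase D Q)
        (e : ℝ → ℝ),
        IsSolBar L W β₀ univ X → IsOpen T → T.OrdConnected → t₀ ∈ T →
        IsMIntegralCurveOn (I := velModel D) c X T → c t₀ = u₀ → (∀ t ∈ T, c t ∈ U) →
        DifferentiableOn ℝ e T → (∀ t ∈ T, e t ∈ Ioo a b) →
        (e t₀ = 0 → φ (e t₀) (c t₀) = u₀) ∧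
        ∃ Y : ℝ → VelField D Q, ∀ t ∈ T,
          IsSolBar L W β₀ (φ (e t) '' U) (Y t) ∧
          (∀ u ∈ U, Y t (φ (e t) u) = push (φ (e t)) u (X u) + deriv e t • P (φ (e t) u)) ∧
          HasMFDerivAt 𝓘(ℝ, ℝ) (velModel D) (fun s => φ (e s) (c s)) t
            ((1 : ℝ →L[ℝ] ℝ).smulRight (Y t (φ (e t) (c t))))) := by
  refine ⟨fun σ hσ => ?_, fun P a b U φ hP hφ => ?_⟩
  · have h := (hL.preservesSolBar_of_mem_grSym hW hσ).1
    exact ⟨h.1, h.2, fun T t₀ u₀ _ _ _ => hL.bijOn_orbitEL hW hσ T t₀ u₀⟩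
  have hl := hφ.isSmoothLocalFlow
  refine ⟨fun ε hε => ⟨hl.isOpen_image hP.isSmoothVF hε, hl.injOn hP.isSmoothVF hε⟩, ?_⟩
  intro X T t₀ u₀ c e hX hT _ ht₀ hc hcu hcU he heT
  refine ⟨fun h0 => ?_, ?_⟩
  · rw [h0, hl.zero _ (hcU t₀ ht₀), hcu]
  have key : ∀ t, ∃ Y : VelField D Q, t ∈ T → IsSolBar L W β₀ (φ (e t) '' U) Y ∧
      ∀ u ∈ U, Y (φ (e t) u) = push (φ (e t)) u (X u) + deriv e t • P (φ (e t) u) := fun t => by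
    by_cases ht : t ∈ T
    · obtain ⟨Y, hY⟩ := hL.exists_isSolBar_pushforward hP hl hW hX (heT t ht) (deriv e t)
      exact ⟨Y, fun _ => hY⟩
    · exact ⟨X, fun h => absurd h ht⟩
  choose Y hY using key
  refine ⟨Y, fun t ht => ⟨(hY t ht).1, (hY t ht).2, ?_⟩⟩
  rw [(hY t ht).2 _ (hcU t ht)]
  exact hl.hasMFDerivAt_comp ((hc t ht).hasMFDerivAt (hT.mem_nhds ht))
    (he.differentiableAt (hT.mem_nhds ht)).hasDerivAt (hcU t ht) (heT t ht)
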